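/- **Setting.** For integers $k\ge 3$ and $r\ge 1$ let $\mathrm{SC}(k,r)$ be the set of $kr$ points in the plane consisting of the corners of a regular $k$-gon together with $r-1$ evenly spaced points on each of its sides. A triangulation of a finite planar point set $S$ is a maximal set of pairwise non-crossing straight-line segments that join two points of $S$ and contain no further point of $S$ (equivalently, a dissection of the convex hull of $S$ into triangles with vertices in $S$ and containing no other points of $S$). Let $\mathrm{tr}(k,r)$ be the number of triangulations of $\mathrm{SC}(k,r)$. For $k=2$, let $\mathrm{tr}(2,r)$ be the number of triangulations of $2r$ points in convex position, labelled $P_{0,0},\dots,P_{0,r-1},P_{1,0},\dots,P_{1,r-1}$ in cyclic order, that use no segment joining two non-neighbouring points of $P_{0,0},\dots,P_{0,r-1},P_{1,0}$ or of $P_{1,0},\dots,P_{1,r-1},P_{0,0}$. For $0\le j\le k$ put $Q_{j,k}(x;t)=t^{k-j}(1-t)^j-x$. A *small zero* of $Q_{j,k}$ is a function $t(x)$, defined for complex $x\ne 0$ near $0$, with $Q_{j,k}(x;t(x))=0$ and $\lim_{x\to 0}t(x)=0$. **Theorem 3.2.** Let $k\ge 2$ be fixed. For each $0\le j\le k$,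 the polynomial $Q_{j,k}(x;t)$ has exactly $k-j$ small zeros: there are small zeros $t_{1,j}(x),\dots,t_{k-j,j}(x)$ that are pairwise distinct for all sufficiently small $x\ne 0$ and such that the value $s(x)$ of any small zero $s$ is one of $t_{1,j}(x),\dots,t_{k-j,j}(x)$ for all sufficiently small $x\neq 0$. For every such choice of the $t_{i,j}$ and all sufficiently small complex $x\neq0$, the following series converges and $$ \sum_{r\ge1}\mathrm{tr}(k,r)\,x^r= -\frac12\sum_{j=0}^k(-1)^j\binom kj\sum_{i=1}^{k-j} \frac{t_{i,j}(x)^{j+1}\,(1-t_{i,j}(x))^{k-j+1}}{(1-2t_{i,j}(x))^{k-2}\,\bigl(k-j-k\,t_{i,j}(x)\bigr)} . $$ Moreover, the formal power series $\sum_{r\ge1}\mathrm{tr}(k,r)x^r\in\mathbb Q[[x]]$ is algebraic over $\mathbb Q[x]$. -/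

import Mathlib

open Filter Topology

noncomputable section

/-- `e` is a diagonal of the planar point set `S`: a straight-line segment connecting two distinct
points of `S` and containing no other point of `S`. (Sides of the convex hull are included.) -/
def IsDiagonal (S : Set ℂ) (e : Sym2 ℂ) : Prop :=
  ∃ a b : ℂ, e = s(a, b) ∧ a ∈ S ∧ b ∈ S ∧ a ≠ b ∧ Disjoint (openSegment ℝ a b) S

/-- The segments `e` and `f` meet in a point that is an endpoint of neither of them. -/
def Crosses (e f : Sym2 ℂ) : Prop :=
  ∃ a b c d : ℂ, e = s(a, b) ∧ f = s(c, d) ∧ (openSegment ℝ a b ∩ openSegment ℝ c d).Nonempty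

/-- `D` is a set of pairwise non-crossing diagonals of `S`. -/
def IsNoncrossing (S : Set ℂ) (D : Set (Sym2 ℂ)) : Prop :=
  (∀ e ∈ D, IsDiagonal S e) ∧ ∀ e ∈ D, ∀ f ∈ D, e ≠ f → ¬ Crosses e f

/-- A triangulation of the finite planar point set `S`, given by its set of edges: a maximal set of
pairwise non-crossing diagonals of `S`. Such a set contains the boundary edges of the convex hull
and dissects the hull into triangles that contain no points of `S` other than their vertices. -/
def IsTriangulation (S : Set ℂ) (D : Set (Sym2 ℂ)) : Prop :=
  Maximal (IsNoncrossing S) D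

/-- The `m`-th vertex of the regular `n`-gon inscribed in the unit circle (`m` matters mod `n`). -/
def regularVertex (n m : ℕ) : ℂ :=
  Complex.exp (2 * Real.pi * Complex.I * (m / n))

/-- The point `P_{i,j}` of `SC(k,r)`: the `j`-th of the evenly spaced points on the side from the
corner `P_{i,0}` to the corner `P_{i+1,0}` of the regular `k`-gon. -/
def scPoint (k r i j : ℕ) : ℂ :=
  regularVertex k i + ((j : ℂ) / r) * (regularVertex k (i + 1) - regularVertex k i)

/-- `SC(k,r)`: the convex `k`-gon each of whose sides is subdivided by `r - 1` points. -/
def SC (k r : ℕ) : Set ℂ :=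
  {z | ∃ i < k, ∃ j < r, z = scPoint k r i j}

/-- The point `P_{i,j}` of the inflated configuration: the strings are replaced by arcs of the
circumscribed circle, so that the `k * r` points are in convex position. -/
def cPoint (k r i j : ℕ) : ℂ :=
  regularVertex (k * r) (i * r + j)

/-- `C(k·r)`: the `k * r` points in convex position. -/
def convexPoints (k r : ℕ) : Set ℂ :=
  {z | ∃ i < k, ∃ j < r, z = cPoint k r i j}

/-- `D` uses no forbidden diagonal, that is, none joining two points of the same string
`P_{i,0}, …, P_{i,r}` that are not neighbours on it. -/
def IsLegal (k r : ℕ) (D : Set (Sym2 ℂ)) : Prop :=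
  ∀ i < k, ∀ j j' : ℕ, j + 2 ≤ j' → j' ≤ r → s(cPoint k r i j, cPoint k r i j') ∉ D

/-- `tr(k,r)`: the number of triangulations of `SC(k,r)` for `k ≥ 3`; for `k = 2` (where there is
no such polygon) the number of triangulations of `C(2·r)` without forbidden diagonals. -/
def tr (k r : ℕ) : ℕ :=
  if k = 2 then {D | IsTriangulation (convexPoints 2 r) D ∧ IsLegal 2 r D}.ncard
  else {D | IsTriangulation (SC k r) D}.ncard

/-- The polynomial `Q_{j,k}(x;t) = t^{k-j} (1-t)^j - x` in the variable `t`. -/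
def Qpoly (k j : ℕ) (x : ℂ) : Polynomial ℂ :=
  Polynomial.X ^ (k - j) * (1 - Polynomial.X) ^ j - Polynomial.C x

/-- `s` is a small zero of `Q_{j,k}(x;t)`: `s x` is a zero for all `x ≠ 0` near `0`, and
`s x → 0` as `x → 0`. -/
def IsSmallZero (k j : ℕ) (s : ℂ → ℂ) : Prop :=
  (∀ᶠ x in 𝓝[≠] (0 : ℂ), (Qpoly k j x).IsRoot (s x)) ∧ Tendsto s (𝓝[≠] 0) (𝓝 0)

/-- `t` lists the small zeros of `Q_{j,k}(x;t)`: each `t i` is a small zero, they are pairwise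
distinct for `x ≠ 0` near `0`, and every small zero takes its values among them. -/
structure IsSmallZeroList (k j : ℕ) (t : Fin (k - j) → ℂ → ℂ) : Prop where
  isSmallZero : ∀ i, IsSmallZero k j (t i)
  injective : ∀ᶠ x in 𝓝[≠] (0 : ℂ), Function.Injective fun i => t i x
  complete : ∀ s, IsSmallZero k j s → ∀ᶠ x in 𝓝[≠] (0 : ℂ), ∃ i, s x = t i x

/-- The horizontal generating function `∑_{r ≥ 1} tr(k,r) x^r` as a formal power series. -/
def horizontalGF (k : ℕ) : PowerSeries ℚ :=
  PowerSeries.mk fun r => if r = 0 then 0 else (tr k r : ℚ)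

end

/-! Number the points cyclically by 0, …, kr − 1. The points are in weakly convex position, so
geometric crossing of admissible segments is interlacing of labels (`IsConvexChain.crosses_iff`).
Maximal non-crossing sets then become dissections of a labelled polygon into triangles, which obey a
Catalan-type recursion (`triCount_rec`). The chords forbidden by the string that wraps around to 0
are removed by a subtraction in `tr_add_eq`, leaving the linear condition `SideFree`. The linear
counts form a strictly upper triangular matrix M. The recursion reads M = A + M², where A is banded:
1 for each side, −1 for each pair of consecutive sides inside a string (`triMatrix_eq`). Hence
t(1−t) − A = (t − M)(1 − t − M), and (1−2t)(t(1−t) − A)⁻¹ is the difference of the resolvents of M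
at t and at 1 − t. The first row of (t(1−t) − A)⁻¹ solves a linear recurrence that restarts at every
corner, so it is a product of the explicit factors `stringSum` (`pathSum_eq`). Reading off the
coefficient of M as a residue gives tr(k,r) as the contour integral of t(1−2t)S_r(t)^k around 0,
with S_r the factor of a full string (`tr_eq_contour`). Since S_r is a polynomial in 1/(t(1−t))
without constant term, (1−2t)S_r^k has a primitive and integrates to 0. So t(1−2t) may be replaced
by −(1−2t)²/2, and the binomial theorem splits the integrand into terms density ·
(t^(k−j)(1−t)^j)^(−r) (`tr_eq_sum_contour`). The sum over r is geometric and turns the kernel into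
x/Q_{j,k}(x;t). Its poles inside a small fixed circle are exactly the small zeros, all simple, and
the residues are the claimed terms (`IsSmallZeroList.contour_eq`). The small zeros themselves come
from inverting t(1−t)^(j/(k−j)) near 0 and taking roots of x (`exists_branches`). Algebraicity: the
small zeros are algebraic germs over ℚ[x], hence so is the closed form. An equation for its values
transfers to the formal series by the identity theorem (`eq_zero_of_hasEval`). -/

/-! ### Triangulations of a labelled polygon and their recursion -/

/-- The chords `e` and `f` of a convex polygon with vertices `0, 1, 2, …` cross, with `e` starting
first. -/
def Interlaced (e f : ℕ × ℕ) : Prop := e.1 < f.1 ∧ f.1 < e.2 ∧ e.2 < f.2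

/-- `E` is a triangulation of the convex polygon `i, i + 1, …, j` by chords satisfying `p`. -/
structure IsPolyTri (p : ℕ → ℕ → Prop) (i j : ℕ) (E : Set (ℕ × ℕ)) : Prop where
  base : (i, j) ∈ E
  mem : ∀ e ∈ E, i ≤ e.1 ∧ e.1 < e.2 ∧ e.2 ≤ j ∧ p e.1 e.2
  noncross : ∀ e ∈ E, ∀ f ∈ E, ¬ Interlaced e f
  apex : ∀ e ∈ E, e.1 + 2 ≤ e.2 → ∃ l, e.1 < l ∧ l < e.2 ∧ (e.1, l) ∈ E ∧ (l, e.2) ∈ E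

/-- The number of triangulations of the convex polygon `i, i + 1, …, j` by chords satisfying `p`. -/
noncomputable def triCount (p : ℕ → ℕ → Prop) (i j : ℕ) : ℕ := {E | IsPolyTri p i j E}.ncard

theorem finite_isPolyTri (p : ℕ → ℕ → Prop) (i j : ℕ) : {E | IsPolyTri p i j E}.Finite := by
  refine ((Set.finite_Icc (i, i) (j, j)).finite_subsets).subset fun E hE e he => ?_
  obtain ⟨h1, h2, h3, -⟩ := hE.mem e he
  exact ⟨⟨h1, by simp; omega⟩, ⟨by simp; omega, h3⟩⟩

theorem triCount_of_not {p : ℕ → ℕ → Prop} {i j : ℕ} (h : ¬ p i j) : triCount p i j = 0 := by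
  have : {E | IsPolyTri p i j E} = ∅ := by
    ext E
    simp only [Set.mem_ofPred_eq, Set.mem_empty_iff_false, iff_false]
    exact fun hE => h (hE.mem _ hE.base).2.2.2
  rw [triCount, this, Set.ncard_empty]

theorem triCount_of_le {p : ℕ → ℕ → Prop} {i j : ℕ} (h : j ≤ i) : triCount p i j = 0 := by
  have : {E | IsPolyTri p i j E} = ∅ := by
    ext E
    simp only [Set.mem_ofPred_eq, Set.mem_empty_iff_false, iff_false]
    intro hE
    have := (hE.mem _ hE.base).2.1
    simp only at this
    omega
  rw [triCount, this, Set.ncard_empty]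

theorem triCount_succ {p : ℕ → ℕ → Prop} {i : ℕ} (h : p i (i + 1)) :
    triCount p i (i + 1) = 1 := by
  have : {E | IsPolyTri p i (i + 1) E} = {{(i, i + 1)}} := by
    ext E
    simp only [Set.mem_ofPred_eq, Set.mem_singleton_iff]
    constructor
    · intro hE
      ext ⟨a, b⟩
      constructor
      · intro he
        have := hE.mem _ he
        simp only at this
        simp only [Set.mem_singleton_iff, Prod.mk.injEq]
        omega
      · intro he
        rw [Set.mem_singleton_iff.1 he]
        exact hE.base
    · rintro rfl
      refine ⟨rfl, ?_, ?_, ?_⟩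
      · rintro e rfl
        exact ⟨le_rfl, by simp, le_rfl, h⟩
      · rintro e rfl f rfl h
        exact lt_irrefl _ h.1
      · rintro e rfl h
        simp at h
  rw [triCount, this, Set.ncard_singleton]

theorem triCount_congr {p q : ℕ → ℕ → Prop} {i j : ℕ}
    (h : ∀ a b, i ≤ a → a < b → b ≤ j → (p a b ↔ q a b)) : triCount p i j = triCount q i j := by
  have : {E | IsPolyTri p i j E} = {E | IsPolyTri q i j E} := by
    ext E
    constructor
    · intro hE
      refine ⟨hE.base, fun e he => ?_, hE.noncross, hE.apex⟩
      obtain ⟨h1, h2, h3, h4⟩ := hE.mem e he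
      exact ⟨h1, h2, h3, (h _ _ h1 h2 h3).1 h4⟩
    · intro hE
      refine ⟨hE.base, fun e he => ?_, hE.noncross, hE.apex⟩
      obtain ⟨h1, h2, h3, h4⟩ := hE.mem e he
      exact ⟨h1, h2, h3, (h _ _ h1 h2 h3).2 h4⟩
  rw [triCount, triCount, this]

/-- Glue triangulations of `i, …, l` and of `l, …, j` along the triangle `i, l, j`. -/
theorem IsPolyTri.glue {p : ℕ → ℕ → Prop} {i l j : ℕ} (hp : p i j) {A B : Set (ℕ × ℕ)}
    (hA : IsPolyTri p i l A) (hB : IsPolyTri p l j B) :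
    IsPolyTri p i j (insert (i, j) (A ∪ B)) := by
  have hil := (hA.mem _ hA.base).2.1
  have hlj := (hB.mem _ hB.base).2.1
  simp only at hil hlj
  refine ⟨Set.mem_insert _ _, ?_, ?_, ?_⟩
  · rintro e (rfl | he | he)
    · exact ⟨le_rfl, hil.trans hlj, le_rfl, hp⟩
    · obtain ⟨h1, h2, h3, h4⟩ := hA.mem e he
      exact ⟨h1, h2, by omega, h4⟩
    · obtain ⟨h1, h2, h3, h4⟩ := hB.mem e he
      exact ⟨by omega, h2, h3, h4⟩
  · rintro e (rfl | he | he) f (rfl | hf | hf) ⟨h1, h2, h3⟩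
    · simp only at h1 h2 h3
      omega
    · have := hA.mem f hf
      simp only at h1 h2 h3
      omega
    · have := hB.mem f hf
      simp only at h1 h2 h3
      omega
    · have := hA.mem e he
      simp only at h1 h2 h3
      omega
    · exact hA.noncross e he f hf ⟨h1, h2, h3⟩
    · have := hA.mem e he
      have := hB.mem f hf
      omega
    · have := hB.mem e he
      simp only at h1 h2 h3
      omega
    · have := hB.mem e he
      have := hA.mem f hf
      omega
    · exact hB.noncross e he f hf ⟨h1, h2, h3⟩
  · rintro e (rfl | he | he) h
    · exact ⟨l, hil, hlj, Or.inr (Or.inl hA.base), Or.inr (Or.inr hB.base)⟩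
    · obtain ⟨m, h1, h2, h3, h4⟩ := hA.apex e he h
      exact ⟨m, h1, h2, Or.inr (Or.inl h3), Or.inr (Or.inl h4)⟩
    · obtain ⟨m, h1, h2, h3, h4⟩ := hB.apex e he h
      exact ⟨m, h1, h2, Or.inr (Or.inr h3), Or.inr (Or.inr h4)⟩

/-- The part of a triangulation cut off by one of its chords. -/
theorem IsPolyTri.restrict {p : ℕ → ℕ → Prop} {i j a b : ℕ} {E : Set (ℕ × ℕ)}
    (hE : IsPolyTri p i j E) (h : (a, b) ∈ E) :
    IsPolyTri p a b {e ∈ E | a ≤ e.1 ∧ e.2 ≤ b} := by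
  refine ⟨⟨h, le_rfl, le_rfl⟩, ?_, ?_, ?_⟩
  · rintro e ⟨he, h1, h2⟩
    exact ⟨h1, (hE.mem e he).2.1, h2, (hE.mem e he).2.2.2⟩
  · exact fun e he f hf => hE.noncross e he.1 f hf.1
  · rintro e ⟨he, h1, h2⟩ h
    obtain ⟨l, h3, h4, h5, h6⟩ := hE.apex e he h
    exact ⟨l, h3, h4, ⟨h5, h1, by simp; omega⟩, ⟨h6, by simp; omega, h2⟩⟩

/-- A chord contained in neither half passes over `l`, so it interlaces with one of the two sides of
the triangle at `l` unless it is the base itself. -/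
theorem IsPolyTri.eq_glue {p : ℕ → ℕ → Prop} {i j l : ℕ} {E : Set (ℕ × ℕ)}
    (hE : IsPolyTri p i j E) (h1 : (i, l) ∈ E) (h2 : (l, j) ∈ E) :
    E = insert (i, j) ({e ∈ E | i ≤ e.1 ∧ e.2 ≤ l} ∪ {e ∈ E | l ≤ e.1 ∧ e.2 ≤ j}) := by
  ext e
  constructor
  · intro he
    have := hE.mem e he
    by_cases h3 : e.2 ≤ l
    · exact Or.inr (Or.inl ⟨he, this.1, h3⟩)
    by_cases h4 : l ≤ e.1
    · exact Or.inr (Or.inr ⟨he, h4, this.2.2.1⟩)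
    have h5 : ¬ i < e.1 := fun h => hE.noncross _ h1 _ he ⟨h, by simp; omega, by simp; omega⟩
    have h6 : ¬ e.2 < j := fun h => hE.noncross _ he _ h2 ⟨by simp; omega, by simp; omega, h⟩
    left
    ext <;> simp <;> omega
  · rintro (rfl | h | h)
    · exact hE.base
    · exact h.1
    · exact h.1

/-- Catalan recursion: `l` is the apex of the triangle on the base. It is unique because two
different apexes would produce interlaced chords, and the two halves are recovered from the whole by
restriction. -/
theorem triCount_rec {p : ℕ → ℕ → Prop} {i j : ℕ} (hp : p i j) (hij : i + 2 ≤ j) :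
    triCount p i j = ∑ l ∈ Finset.Ioo i j, triCount p i l * triCount p l j := by
  classical
  let F : ℕ → Finset (Set (ℕ × ℕ) × Set (ℕ × ℕ)) := fun l =>
    (finite_isPolyTri p i l).toFinset ×ˢ (finite_isPolyTri p l j).toFinset
  have hF : ∀ l, (F l).card = triCount p i l * triCount p l j := fun l => by
    rw [Finset.card_product, triCount, triCount, Set.ncard_eq_toFinset_card _ (finite_isPolyTri p i l),
      Set.ncard_eq_toFinset_card _ (finite_isPolyTri p l j)]
  rw [triCount, Set.ncard_eq_toFinset_card _ (finite_isPolyTri p i j)]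
  simp_rw [← hF]
  rw [← Finset.card_sigma]
  symm
  refine Finset.card_bij (fun x _ => insert (i, j) (x.2.1 ∪ x.2.2)) ?_ ?_ ?_
  · rintro ⟨l, A, B⟩ h
    simp only [F, Finset.mem_sigma, Finset.mem_product, Set.Finite.mem_toFinset,
      Set.mem_ofPred_eq] at h ⊢
    exact IsPolyTri.glue hp h.2.1 h.2.2
  · rintro ⟨l, A, B⟩ h ⟨l', A', B'⟩ h' heq
    simp only [F, Finset.mem_sigma, Finset.mem_product, Set.Finite.mem_toFinset,
      Set.mem_ofPred_eq, Finset.mem_Ioo] at h h' heq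
    obtain ⟨hl, hA, hB⟩ := h
    obtain ⟨hl', hA', hB'⟩ := h'
    have hE := IsPolyTri.glue hp hA hB
    have hll : l = l' := by
      have m1 : (i, l) ∈ insert (i, j) (A ∪ B) := Or.inr (Or.inl hA.base)
      have m2 : (l, j) ∈ insert (i, j) (A ∪ B) := Or.inr (Or.inr hB.base)
      have m3 : (i, l') ∈ insert (i, j) (A ∪ B) := by rw [heq]; exact Or.inr (Or.inl hA'.base)
      have m4 : (l', j) ∈ insert (i, j) (A ∪ B) := by rw [heq]; exact Or.inr (Or.inr hB'.base)
      rcases lt_trichotomy l l' with h | h | h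
      · exact absurd ⟨hl.1, h, hl'.2⟩ (hE.noncross _ m3 _ m2)
      · exact h
      · exact absurd ⟨hl'.1, h, hl.2⟩ (hE.noncross _ m1 _ m4)
    subst hll
    have key : ∀ {A B : Set (ℕ × ℕ)}, IsPolyTri p i l A → IsPolyTri p l j B →
        A = {e ∈ insert (i, j) (A ∪ B) | e.2 ≤ l} ∧
        B = {e ∈ insert (i, j) (A ∪ B) | l ≤ e.1} := by
      intro A B hA hB
      constructor
      · ext e
        constructor
        · intro he
          exact ⟨Or.inr (Or.inl he), (hA.mem e he).2.2.1⟩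
        · rintro ⟨rfl | he | he, h⟩
          · simp at h; omega
          · exact he
          · have := hB.mem e he; omega
      · ext e
        constructor
        · intro he
          exact ⟨Or.inr (Or.inr he), (hB.mem e he).1⟩
        · rintro ⟨rfl | he | he, h⟩
          · simp at h; omega
          · have := hA.mem e he; omega
          · exact he
    obtain ⟨k1, k2⟩ := key hA hB
    obtain ⟨k3, k4⟩ := key hA' hB'
    have e1 : A = A' := by rw [k1, k3, heq]
    have e2 : B = B' := by rw [k2, k4, heq]
    rw [e1, e2]
  · intro E hE
    simp only [Set.Finite.mem_toFinset, Set.mem_ofPred_eq] at hE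
    obtain ⟨l, h1, h2, h3, h4⟩ := hE.apex _ hE.base hij
    refine ⟨⟨l, _, _⟩, ?_, (hE.eq_glue h3 h4).symm⟩
    exact Finset.mem_sigma.2 ⟨Finset.mem_Ioo.2 ⟨h1, h2⟩, Finset.mem_product.2
      ⟨(Set.Finite.mem_toFinset _).2 (hE.restrict h3),
        (Set.Finite.mem_toFinset _).2 (hE.restrict h4)⟩⟩

/-- A chord that crosses no chord of a triangulation belongs to it. -/
theorem IsPolyTri.mem_of_noncross {p : ℕ → ℕ → Prop} {i j : ℕ} {E : Set (ℕ × ℕ)}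
    (hE : IsPolyTri p i j E) {a b : ℕ} (hia : i ≤ a) (hab : a < b) (hbj : b ≤ j)
    (h1 : ∀ e ∈ E, ¬ Interlaced e (a, b)) (h2 : ∀ e ∈ E, ¬ Interlaced (a, b) e) :
    (a, b) ∈ E := by
  -- Descend through triangles lying over the chord. If the apex fell strictly between `a` and `b`,
  -- one of the two sides of the triangle would interlace with `(a, b)`, so some smaller chord of
  -- `E` still encloses it.
  have main : ∀ d u v : ℕ, v - u ≤ d → (u, v) ∈ E → u ≤ a → b ≤ v → (a, b) ∈ E := by
    intro d
    induction d with
    | zero => intro u v h _ _ _; omega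
    | succ d ih =>
      intro u v h huv hu hv
      by_cases h3 : u = a ∧ v = b
      · rwa [← h3.1, ← h3.2]
      obtain ⟨l, h4, h5, h6, h7⟩ := hE.apex _ huv (by simp; omega)
      simp only at h4 h5 h6 h7
      by_cases h8 : b ≤ l
      · exact ih u l (by omega) h6 hu h8
      by_cases h9 : l ≤ a
      · exact ih l v (by omega) h7 h9 hv
      by_cases h10 : u < a
      · exact absurd ⟨h10, by simp; omega, by simp; omega⟩ (h1 _ h6)
      · exact absurd ⟨by simp; omega, by simp; omega, by simp; omega⟩ (h2 _ h7)
  exact main (j - i) i j le_rfl hE.base hia hbj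

/-! ### Maximal non-crossing chord sets -/

/-- A set of pairwise non-crossing chords satisfying `p` of the polygon `0, …, n - 1`. -/
def IsPolyNoncrossing (p : ℕ → ℕ → Prop) (n : ℕ) (E : Set (ℕ × ℕ)) : Prop :=
  (∀ e ∈ E, e.1 < e.2 ∧ e.2 < n ∧ p e.1 e.2) ∧ ∀ e ∈ E, ∀ f ∈ E, ¬ Interlaced e f

theorem Maximal.polyNoncrossing_mem {p : ℕ → ℕ → Prop} {n : ℕ} {E : Set (ℕ × ℕ)}
    (hE : Maximal (IsPolyNoncrossing p n) E) {a b : ℕ} (hab : a < b) (hb : b < n) (hp : p a b)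
    (h1 : ∀ e ∈ E, ¬ Interlaced e (a, b)) (h2 : ∀ e ∈ E, ¬ Interlaced (a, b) e) :
    (a, b) ∈ E := by
  refine hE.2 (y := insert (a, b) E) ⟨?_, ?_⟩ (Set.subset_insert _ _) (Set.mem_insert _ _)
  · rintro e (rfl | he)
    · exact ⟨hab, hb, hp⟩
    · exact hE.1.1 e he
  · rintro e (rfl | he) f (rfl | hf)
    · exact fun h => lt_irrefl _ h.1
    · exact h2 f hf
    · exact h1 e he
    · exact hE.1.2 e he f hf

/-- The apex over `(i, j)` is the farthest neighbour `l` of `i` below `j`: nothing in `E` crosses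
`(l, j)`, so maximality supplies it when it is admissible. The hypothesis `hp` is what excludes the
case of an inadmissible `(l, j)`. -/
theorem Maximal.isPolyTri {p : ℕ → ℕ → Prop} {n : ℕ} (hn : 2 ≤ n) {E : Set (ℕ × ℕ)}
    (hE : Maximal (IsPolyNoncrossing p n) E) (hadj : ∀ i, i + 1 < n → p i (i + 1))
    (hroot : p 0 (n - 1))
    (hp : ∀ i l m j, i < l → l < m → m < j → j < n → p i l → p i j → ¬ p l j → p i m) :
    IsPolyTri p 0 (n - 1) E := by
  have hmem := hE.1.1
  refine ⟨?_, ?_, hE.1.2, ?_⟩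
  · refine hE.polyNoncrossing_mem (by omega) (by omega) hroot ?_ ?_
    · rintro e he ⟨h, -, -⟩
      simp at h
    · rintro e he ⟨-, -, h⟩
      have := hmem e he
      simp at h; omega
  · intro e he
    have := hmem e he
    exact ⟨by omega, this.1, by omega, this.2.2⟩
  rintro ⟨i, j⟩ he hij
  simp only at hij ⊢
  obtain ⟨-, hjn, hpij⟩ := hmem _ he
  simp only at hjn hpij
  have hside : ∀ a, a + 1 < n → (a, a + 1) ∈ E := by
    intro a ha
    refine hE.polyNoncrossing_mem (by omega) ha (hadj a ha) ?_ ?_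
    · rintro e - ⟨h1, h2, h3⟩
      simp only at h1 h2 h3; omega
    · rintro e - ⟨h1, h2, h3⟩
      simp only at h1 h2 h3; omega
  classical
  obtain ⟨l, ⟨hl1, hl2, hl3⟩, hlmax⟩ : ∃ l, (i < l ∧ l < j ∧ (i, l) ∈ E) ∧
      ∀ m, l < m → m < j → (i, m) ∉ E := by
    have hex : ∃ m, m < j ∧ (i, j - m - 1) ∈ E ∧ i < j - m - 1 :=
      ⟨j - i - 2, by omega, by
        rw [show j - (j - i - 2) - 1 = i + 1 by omega]; exact hside i (by omega), by omega⟩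
    have hs := Nat.find_spec hex
    refine ⟨j - Nat.find hex - 1, ⟨hs.2.2, by omega, hs.2.1⟩, fun m hm1 hm2 hm3 => ?_⟩
    refine Nat.find_min hex (m := j - m - 1) (by omega) ⟨by omega, ?_, by omega⟩
    rwa [show j - (j - m - 1) - 1 = m by omega]
  by_cases hplj : p l j
  · refine ⟨l, hl1, hl2, hl3, hE.polyNoncrossing_mem hl2 hjn hplj ?_ ?_⟩
    · rintro ⟨u, v⟩ hf ⟨h1, h2, h3⟩
      simp only at h1 h2 h3
      rcases lt_trichotomy u i with h | rfl | h
      · exact hE.1.2 _ hf _ he ⟨h, by simp; omega, h3⟩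
      · exact hlmax v h2 h3 hf
      · exact hE.1.2 _ hl3 _ hf ⟨h, h1, h2⟩
    · rintro ⟨u, v⟩ hf ⟨h1, h2, h3⟩
      simp only at h1 h2 h3
      exact hE.1.2 _ he _ hf ⟨by simp; omega, h2, h3⟩
  -- Let `m` be the nearest neighbour of `j` beyond `l`. By `hp` the chord `(i, m)` is admissible,
  -- and it crosses nothing in `E`, so it lies in `E`, against the choice of `l`.
  · exfalso
    obtain ⟨m, ⟨hm1, hm2, hm3⟩, hmmin⟩ : ∃ m, (l < m ∧ m < j ∧ (m, j) ∈ E) ∧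
        ∀ u, l < u → u < m → (u, j) ∉ E := by
      have hlj : l + 1 ≠ j := fun h => hplj (h ▸ hadj l (by omega))
      have hex : ∃ m, l < m ∧ m < j ∧ (m, j) ∈ E := ⟨j - 1, by omega, by omega, by
        have := hside (j - 1) (by omega)
        rwa [show j - 1 + 1 = j by omega] at this⟩
      have hs := Nat.find_spec hex
      refine ⟨Nat.find hex, hs, fun u h1 h2 h3 => Nat.find_min hex h2 ⟨h1, by omega, h3⟩⟩
    refine hlmax m hm1 hm2 (hE.polyNoncrossing_mem (by omega) (by omega)
      (hp i l m j hl1 hm1 hm2 hjn (hmem _ hl3).2.2 hpij hplj) ?_ ?_)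
    · rintro ⟨u, v⟩ hf ⟨h1, h2, h3⟩
      simp only at h1 h2 h3
      exact hE.1.2 _ hf _ he ⟨h1, h2, by simp; omega⟩
    · rintro ⟨u, v⟩ hf ⟨h1, h2, h3⟩
      simp only at h1 h2 h3
      rcases lt_trichotomy v j with h | rfl | h
      · exact hE.1.2 _ hf _ hm3 ⟨h2, h3, h⟩
      · rcases lt_trichotomy u l with h | rfl | h
        · exact hE.1.2 _ hl3 _ hf ⟨h1, h, by simp; omega⟩
        · exact hplj (hmem _ hf).2.2
        · exact hmmin u h h2 hf
      · exact hE.1.2 _ he _ hf ⟨h1, by simp; omega, h⟩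

/-! ### Signed areas and crossing segments -/

/-- Twice the signed area of the triangle `a, b, c`. -/
def orient (a b c : ℂ) : ℝ := (b.re - a.re) * (c.im - a.im) - (b.im - a.im) * (c.re - a.re)

theorem crosses_mk {a b c d : ℂ} :
    Crosses s(a, b) s(c, d) ↔ (openSegment ℝ a b ∩ openSegment ℝ c d).Nonempty := by
  constructor
  · rintro ⟨a', b', c', d', h1, h2, h⟩
    have e1 : openSegment ℝ a b = openSegment ℝ a' b' := by
      rcases Sym2.eq_iff.1 h1 with ⟨rfl, rfl⟩ | ⟨rfl, rfl⟩
      · rfl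
      · exact openSegment_symm ℝ _ _
    have e2 : openSegment ℝ c d = openSegment ℝ c' d' := by
      rcases Sym2.eq_iff.1 h2 with ⟨rfl, rfl⟩ | ⟨rfl, rfl⟩
      · rfl
      · exact openSegment_symm ℝ _ _
    rwa [e1, e2]
  · exact fun h => ⟨a, b, c, d, rfl, rfl, h⟩

theorem crosses_comm {e f : Sym2 ℂ} : Crosses e f ↔ Crosses f e := by
  induction e with | _ a b
  induction f with | _ c d
  rw [crosses_mk, crosses_mk, Set.inter_comm]

theorem isDiagonal_mk {S : Set ℂ} {a b : ℂ} :
    IsDiagonal S s(a, b) ↔ a ∈ S ∧ b ∈ S ∧ a ≠ b ∧ Disjoint (openSegment ℝ a b) S := by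
  constructor
  · rintro ⟨a', b', h1, h⟩
    rcases Sym2.eq_iff.1 h1 with ⟨rfl, rfl⟩ | ⟨rfl, rfl⟩
    · exact h
    · exact ⟨h.2.1, h.1, h.2.2.1.symm, by rw [openSegment_symm]; exact h.2.2.2⟩
  · exact fun h => ⟨a, b, rfl, h⟩

theorem mem_openSegment_iff_lineMap {a b x : ℂ} :
    x ∈ openSegment ℝ a b ↔ ∃ t : ℝ, 0 < t ∧ t < 1 ∧ x = a + t * (b - a) := by
  rw [openSegment_eq_image]
  constructor
  · rintro ⟨t, ⟨h1, h2⟩, rfl⟩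
    refine ⟨t, h1, h2, ?_⟩
    simp only [Complex.real_smul]; push_cast; ring
  · rintro ⟨t, h1, h2, rfl⟩
    refine ⟨t, ⟨h1, h2⟩, ?_⟩
    simp only [Complex.real_smul]; push_cast; ring

theorem orient_rotate (a b c : ℂ) : orient a b c = orient c a b := by unfold orient; ring

theorem orient_swap (a b c : ℂ) : orient a b c = -orient a c b := by unfold orient; ring

theorem orient_lineMap (a b c d : ℂ) (t : ℝ) :
    orient a b (c + t * (d - c)) = (1 - t) * orient a b c + t * orient a b d := by
  simp only [orient, Complex.add_re, Complex.add_im, Complex.sub_re, Complex.sub_im,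
    Complex.mul_re, Complex.mul_im, Complex.ofReal_re, Complex.ofReal_im]
  ring

theorem orient_self_left (a b : ℂ) : orient a b a = 0 := by unfold orient; ring

theorem orient_self_right (a b : ℂ) : orient a b b = 0 := by unfold orient; ring

theorem orient_eq_zero_of_mem_openSegment {a b x : ℂ} (h : x ∈ openSegment ℝ a b) :
    orient a b x = 0 := by
  obtain ⟨t, -, -, rfl⟩ := mem_openSegment_iff_lineMap.1 h
  rw [orient_lineMap, orient_self_left, orient_self_right]; ring

theorem exists_eq_add_of_orient_eq_zero {a b c : ℂ} (hab : a ≠ b) (h : orient a b c = 0) :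
    ∃ t : ℝ, c = a + t * (b - a) := by
  have hn : (b.re - a.re) ^ 2 + (b.im - a.im) ^ 2 ≠ 0 := by
    intro h0
    apply hab
    have h1 : b.re - a.re = 0 := by nlinarith [sq_nonneg (b.re - a.re), sq_nonneg (b.im - a.im)]
    have h2 : b.im - a.im = 0 := by nlinarith [sq_nonneg (b.re - a.re), sq_nonneg (b.im - a.im)]
    apply Complex.ext <;> linarith
  refine ⟨((c.re - a.re) * (b.re - a.re) + (c.im - a.im) * (b.im - a.im)) /
    ((b.re - a.re) ^ 2 + (b.im - a.im) ^ 2), ?_⟩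
  unfold orient at h
  apply Complex.ext
  · simp only [Complex.add_re, Complex.mul_re, Complex.ofReal_re, Complex.ofReal_im,
      Complex.sub_re]
    field_simp
    linear_combination (-(b.im - a.im)) * h
  · simp only [Complex.add_im, Complex.mul_im, Complex.ofReal_re, Complex.ofReal_im,
      Complex.sub_im]
    field_simp
    linear_combination (b.re - a.re) * h

/-- Two overlapping collinear segments, neither of which contains an endpoint of the other in its
interior, coincide. -/
theorem sym2_eq_of_collinear {a b c d x : ℂ} (hab : a ≠ b) (hc : orient a b c = 0)
    (hd : orient a b d = 0) (hx1 : x ∈ openSegment ℝ a b) (hx2 : x ∈ openSegment ℝ c d)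
    (h1 : c ∉ openSegment ℝ a b) (h2 : d ∉ openSegment ℝ a b)
    (h3 : a ∉ openSegment ℝ c d) (h4 : b ∉ openSegment ℝ c d) : s(a, b) = s(c, d) := by
  obtain ⟨u, rfl⟩ := exists_eq_add_of_orient_eq_zero hab hc
  obtain ⟨v, rfl⟩ := exists_eq_add_of_orient_eq_zero hab hd
  have hba : b - a ≠ 0 := sub_ne_zero.2 hab.symm
  rw [mem_openSegment_iff_lineMap] at hx1 hx2 h1 h2 h3 h4
  obtain ⟨t, ht0, ht1, rfl⟩ := hx1
  obtain ⟨w, hw0, hw1, hw⟩ := hx2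
  have ht : t = u + w * (v - u) := by
    have : (t : ℂ) = u + w * (v - u) := by
      apply mul_right_cancel₀ hba
      linear_combination hw
    exact_mod_cast this
  have hu : u ≤ 0 ∨ 1 ≤ u := by
    by_contra! h
    exact h1 ⟨u, h.1, h.2, rfl⟩
  have hv : v ≤ 0 ∨ 1 ≤ v := by
    by_contra! h
    exact h2 ⟨v, h.1, h.2, rfl⟩
  -- In the affine coordinate with `a` at 0 and `b` at 1, the other segment has ends `u` and `v`.
  -- Neither 0 nor 1 lies strictly between them; `ha` and `hb` record this as signs of products.
  have ha : u * v ≥ 0 := by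
    by_contra! h
    have huv : v - u ≠ 0 := by
      intro h'
      have : v = u := by linarith
      subst this
      nlinarith
    have huv' : (v : ℂ) - u ≠ 0 := by exact_mod_cast huv
    refine h3 ⟨-u / (v - u), ?_, ?_, ?_⟩
    · rcases lt_or_gt_of_ne huv with h' | h'
      · exact div_pos_of_neg_of_neg (by nlinarith) h'
      · exact div_pos (by nlinarith) h'
    · rcases lt_or_gt_of_ne huv with h' | h'
      · rw [div_lt_one_of_neg h']; nlinarith
      · rw [div_lt_one h']; nlinarith
    · push_cast
      field_simp
      ring
  have hb : (u - 1) * (v - 1) ≥ 0 := by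
    by_contra! h
    have huv : v - u ≠ 0 := by
      intro h'
      have : v = u := by linarith
      subst this
      nlinarith
    have huv' : (v : ℂ) - u ≠ 0 := by exact_mod_cast huv
    refine h4 ⟨(1 - u) / (v - u), ?_, ?_, ?_⟩
    · rcases lt_or_gt_of_ne huv with h' | h'
      · exact div_pos_of_neg_of_neg (by nlinarith) h'
      · exact div_pos (by nlinarith) h'
    · rcases lt_or_gt_of_ne huv with h' | h'
      · rw [div_lt_one_of_neg h']; nlinarith
      · rw [div_lt_one h']; nlinarith
    · push_cast
      field_simp
      ring
  rcases hu with hu | hu <;> rcases hv with hv | hv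
  · nlinarith
  · have hu0 : u = 0 := by nlinarith
    have hv1 : v = 1 := by subst hu0; linarith
    subst hu0 hv1
    simp
  · have hv0 : v = 0 := by nlinarith
    have hu1 : u = 1 := by subst hv0; linarith
    subst hv0 hu1
    simp [Sym2.eq_swap]
  · nlinarith

/-- The diagonals of a convex quadrilateral cross. -/
theorem openSegment_inter_nonempty {a c b d : ℂ} (h1 : 0 < orient a c b) (h2 : 0 < orient a b d)
    (h3 : 0 < orient a c d) (h4 : 0 < orient c b d) :
    (openSegment ℝ a b ∩ openSegment ℝ c d).Nonempty := by
  have hsum : orient a c b + orient a b d = orient a c d + orient c b d := by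
    unfold orient; ring
  have hs1 : 0 < orient a c b + orient a b d := by linarith
  -- By Cramer's rule the intersection point divides each diagonal in a ratio of triangle areas; the
  -- common denominator is the area of the quadrilateral.
  refine ⟨c + ((orient a c b / (orient a c b + orient a b d) : ℝ) : ℂ) * (d - c),
    mem_openSegment_iff_lineMap.2 ⟨orient a c d / (orient a c b + orient a b d), by positivity,
      by rw [div_lt_one hs1]; linarith, ?_⟩,
    mem_openSegment_iff_lineMap.2 ⟨_, by positivity, by rw [div_lt_one hs1]; linarith, rfl⟩⟩
  have hs2 := hs1.ne'
  apply Complex.ext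
  · simp only [Complex.add_re, Complex.mul_re, Complex.ofReal_re, Complex.ofReal_im,
      Complex.sub_re]
    field_simp
    unfold orient
    ring
  · simp only [Complex.add_im, Complex.mul_im, Complex.ofReal_re, Complex.ofReal_im,
      Complex.sub_im]
    field_simp
    unfold orient
    ring

/-! ### Convex chains: from plane segments to labelled chords -/

/-- The points `P 0, …, P (n - 1)` of `S` are in weakly convex position, in cyclic order, and `adm`
describes the pairs of points that are joined by a diagonal of `S`. -/
structure IsConvexChain (S : Set ℂ) (P : ℕ → ℂ) (n : ℕ) (adm : ℕ → ℕ → Prop) : Prop where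
  mem_iff : ∀ z, z ∈ S ↔ ∃ a < n, z = P a
  inj : ∀ a < n, ∀ b < n, P a = P b → a = b
  orient_nonneg : ∀ a b c, a < b → b < c → c < n → 0 ≤ orient (P a) (P b) (P c)
  diagonal : ∀ a b, a < b → b < n → (IsDiagonal S s(P a, P b) ↔ adm a b)
  orient_pos : ∀ a c b d, a < c → c < b → b < d → d < n → adm a b → adm c d →
    0 < orient (P a) (P c) (P b) ∧ 0 < orient (P a) (P b) (P d) ∧
    0 < orient (P a) (P c) (P d) ∧ 0 < orient (P c) (P b) (P d)

/-- The segment with the given labelled endpoints. -/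
def chord (P : ℕ → ℂ) (e : ℕ × ℕ) : Sym2 ℂ := s(P e.1, P e.2)

section
variable {S : Set ℂ} {P : ℕ → ℂ} {n : ℕ} {adm : ℕ → ℕ → Prop}

theorem IsConvexChain.orient_nonneg_outside (h : IsConvexChain S P n adm) {a b c : ℕ} (hab : a < b)
    (hb : b < n) (hc : c < n) (hout : ¬ (a < c ∧ c < b)) : 0 ≤ orient (P a) (P b) (P c) := by
  rcases lt_trichotomy c a with h1 | rfl | h1
  · rw [orient_rotate]; exact h.orient_nonneg _ _ _ h1 hab hb
  · rw [orient_self_left]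
  rcases lt_trichotomy c b with h2 | rfl | h2
  · exact absurd ⟨h1, h2⟩ hout
  · rw [orient_self_right]
  · exact h.orient_nonneg _ _ _ hab h2 hc

theorem IsConvexChain.orient_nonpos_inside (h : IsConvexChain S P n adm) {a b c : ℕ}
    (hb : b < n) (hac : a ≤ c) (hcb : c ≤ b) : orient (P a) (P b) (P c) ≤ 0 := by
  rcases hac.eq_or_lt with rfl | h1
  · rw [orient_self_left]
  rcases hcb.eq_or_lt with rfl | h2
  · rw [orient_self_right]
  rw [orient_swap]
  linarith [h.orient_nonneg _ _ _ h1 h2 hb]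

/-- If the labels do not interlace, both ends of `f` lie weakly on one side of the line through `e`.
A common interior point then forces both ends onto that line, and collinear diagonals that overlap
must coincide. Interlaced admissible chords are the diagonals of a strictly convex quadrilateral, by
`orient_pos`. -/
theorem IsConvexChain.crosses_iff (h : IsConvexChain S P n adm) {e f : ℕ × ℕ}
    (he : e.1 < e.2 ∧ e.2 < n ∧ adm e.1 e.2) (hf : f.1 < f.2 ∧ f.2 < n ∧ adm f.1 f.2)
    (hef : chord P e ≠ chord P f) :
    Crosses (chord P e) (chord P f) ↔ Interlaced e f ∨ Interlaced f e := by
  obtain ⟨a, b⟩ := e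
  obtain ⟨c, d⟩ := f
  simp only at he hf
  obtain ⟨hab, hb, hpe⟩ := he
  obtain ⟨hcd, hd, hpf⟩ := hf
  constructor
  · intro hX
    by_contra! hI
    simp only [Interlaced, not_and, not_lt] at hI
    obtain ⟨hI1, hI2⟩ := hI
    obtain ⟨x, hx1, hx2⟩ := crosses_mk.1 hX
    have hde := isDiagonal_mk.1 ((h.diagonal a b hab hb).2 hpe)
    have hdf := isDiagonal_mk.1 ((h.diagonal c d hcd hd).2 hpf)
    simp only at hx1 hx2
    have hx0 := orient_eq_zero_of_mem_openSegment hx1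
    obtain ⟨t, ht0, ht1, hxt⟩ := mem_openSegment_iff_lineMap.1 hx2
    rw [hxt, orient_lineMap] at hx0
    have hzero : orient (P a) (P b) (P c) = 0 ∧ orient (P a) (P b) (P d) = 0 := by
      by_cases hin : a ≤ c ∧ d ≤ b
      · have k1 := h.orient_nonpos_inside hb hin.1 (by omega : c ≤ b)
        have k2 := h.orient_nonpos_inside hb (by omega : a ≤ d) hin.2
        constructor <;> nlinarith
      · have k1 := h.orient_nonneg_outside hab hb (c := c) (by omega)
          (fun hh => hin ⟨hh.1.le, hI1 hh.1 hh.2⟩)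
        have k2 := h.orient_nonneg_outside hab hb hd (fun hh => hin ⟨by
          by_contra! hca
          have := hI2 hca hh.1
          omega, hh.2.le⟩)
        constructor <;> nlinarith
    refine hef (sym2_eq_of_collinear hde.2.2.1 hzero.1 hzero.2 hx1 hx2 ?_ ?_ ?_ ?_)
    · exact fun hh => Set.disjoint_left.1 hde.2.2.2 hh hdf.1
    · exact fun hh => Set.disjoint_left.1 hde.2.2.2 hh hdf.2.1
    · exact fun hh => Set.disjoint_left.1 hdf.2.2.2 hh hde.1
    · exact fun hh => Set.disjoint_left.1 hdf.2.2.2 hh hde.2.1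
  · rintro (⟨h1, h2, h3⟩ | ⟨h1, h2, h3⟩)
    · obtain ⟨k1, k2, k3, k4⟩ := h.orient_pos a c b d h1 h2 h3 hd hpe hpf
      exact crosses_mk.2 (openSegment_inter_nonempty k1 k2 k3 k4)
    · obtain ⟨k1, k2, k3, k4⟩ := h.orient_pos c a d b h1 h2 h3 hb hpf hpe
      exact crosses_comm.1 (crosses_mk.2 (openSegment_inter_nonempty k1 k2 k3 k4))

theorem IsConvexChain.chord_inj (h : IsConvexChain S P n adm) {e f : ℕ × ℕ}
    (he : e.1 < e.2 ∧ e.2 < n) (hf : f.1 < f.2 ∧ f.2 < n) (hef : chord P e = chord P f) :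
    e = f := by
  rcases Sym2.eq_iff.1 hef with ⟨h1, h2⟩ | ⟨h1, h2⟩
  · exact Prod.ext (h.inj _ (by omega) _ (by omega) h1) (h.inj _ (by omega) _ (by omega) h2)
  · have k1 := h.inj _ (by omega) _ (by omega) h1
    have k2 := h.inj _ (by omega) _ (by omega) h2
    omega

theorem IsConvexChain.exists_chord (h : IsConvexChain S P n adm) {e : Sym2 ℂ}
    (he : IsDiagonal S e) :
    ∃ a b, a < b ∧ b < n ∧ adm a b ∧ chord P (a, b) = e := by
  obtain ⟨x, y, rfl, hx, hy, hne, hd⟩ := he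
  obtain ⟨a, ha, rfl⟩ := (h.mem_iff x).1 hx
  obtain ⟨b, hb, rfl⟩ := (h.mem_iff y).1 hy
  have hdiag : IsDiagonal S s(P a, P b) := ⟨_, _, rfl, hx, hy, hne, hd⟩
  rcases lt_trichotomy a b with hab | rfl | hab
  · exact ⟨a, b, hab, hb, (h.diagonal a b hab hb).1 hdiag, rfl⟩
  · exact absurd rfl hne
  · rw [Sym2.eq_swap] at hdiag ⊢
    exact ⟨b, a, hab, ha, (h.diagonal b a hab ha).1 hdiag, rfl⟩

theorem IsConvexChain.isNoncrossing_image (h : IsConvexChain S P n adm) {E : Set (ℕ × ℕ)}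
    (hE : IsPolyNoncrossing adm n E) : IsNoncrossing S (chord P '' E) := by
  refine ⟨?_, ?_⟩
  · rintro _ ⟨e, he, rfl⟩
    obtain ⟨h1, h2, h3⟩ := hE.1 e he
    exact (h.diagonal _ _ h1 h2).2 h3
  · rintro _ ⟨e, he, rfl⟩ _ ⟨f, hf, rfl⟩ hef
    rw [h.crosses_iff (hE.1 e he) (hE.1 f hf) hef]
    rintro (hI | hI)
    · exact hE.2 _ he _ hf hI
    · exact hE.2 _ hf _ he hI

theorem IsConvexChain.exists_image_eq (h : IsConvexChain S P n adm) {D : Set (Sym2 ℂ)}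
    (hD : IsNoncrossing S D) : ∃ E, IsPolyNoncrossing adm n E ∧ chord P '' E = D := by
  have hmem : ∀ e ∈ {e : ℕ × ℕ | e.1 < e.2 ∧ e.2 < n ∧ adm e.1 e.2 ∧ chord P e ∈ D},
      e.1 < e.2 ∧ e.2 < n ∧ adm e.1 e.2 := fun e he => ⟨he.1, he.2.1, he.2.2.1⟩
  refine ⟨{e | e.1 < e.2 ∧ e.2 < n ∧ adm e.1 e.2 ∧ chord P e ∈ D}, ⟨hmem, ?_⟩, ?_⟩
  · intro e he f hf hI
    have hne : chord P e ≠ chord P f := fun heq => by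
      rw [h.chord_inj ⟨he.1, he.2.1⟩ ⟨hf.1, hf.2.1⟩ heq] at hI
      exact lt_irrefl _ hI.1
    exact hD.2 _ he.2.2.2 _ hf.2.2.2 hne
      ((h.crosses_iff (hmem _ he) (hmem _ hf) hne).2 (Or.inl hI))
  · ext e
    constructor
    · rintro ⟨e, he, rfl⟩
      exact he.2.2.2
    · intro he
      obtain ⟨a, b, h1, h2, h3, rfl⟩ := h.exists_chord (hD.1 e he)
      exact ⟨_, ⟨h1, h2, h3, he⟩, rfl⟩

theorem IsConvexChain.image_subset_image (h : IsConvexChain S P n adm) {E F : Set (ℕ × ℕ)}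
    (hE : ∀ e ∈ E, e.1 < e.2 ∧ e.2 < n ∧ adm e.1 e.2)
    (hF : ∀ e ∈ F, e.1 < e.2 ∧ e.2 < n ∧ adm e.1 e.2)
    (hEF : chord P '' E ⊆ chord P '' F) : E ⊆ F := by
  intro e he
  obtain ⟨f, hf, hfe⟩ := hEF ⟨e, he, rfl⟩
  have k1 := hE e he
  have k2 := hF f hf
  rwa [← h.chord_inj ⟨k2.1, k2.2.1⟩ ⟨k1.1, k1.2.1⟩ hfe]

theorem IsConvexChain.isTriangulation_iff (h : IsConvexChain S P n adm) {D : Set (Sym2 ℂ)} :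
    IsTriangulation S D ↔ ∃ E, Maximal (IsPolyNoncrossing adm n) E ∧ chord P '' E = D := by
  constructor
  · intro hD
    obtain ⟨E, hE, rfl⟩ := h.exists_image_eq hD.1
    refine ⟨E, ⟨hE, fun F hF hEF => ?_⟩, rfl⟩
    exact h.image_subset_image hF.1 hE.1
      (hD.2 (h.isNoncrossing_image hF) (Set.image_mono hEF))
  · rintro ⟨E, hE, rfl⟩
    refine ⟨h.isNoncrossing_image hE.1, fun D' hD' hsub => ?_⟩
    obtain ⟨F, hF, rfl⟩ := h.exists_image_eq hD'
    exact Set.image_mono (hE.2 hF (h.image_subset_image hE.1.1 hF.1 hsub))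

theorem IsConvexChain.ncard_image (h : IsConvexChain S P n adm) (A : Set (Set (ℕ × ℕ)))
    (hA : ∀ E ∈ A, ∀ e ∈ E, e.1 < e.2 ∧ e.2 < n ∧ adm e.1 e.2) :
    ((fun E => chord P '' E) '' A).ncard = A.ncard := by
  refine Set.InjOn.ncard_image fun E hE F hF hEF => ?_
  exact Set.Subset.antisymm (h.image_subset_image (hA E hE) (hA F hF) hEF.subset)
    (h.image_subset_image (hA F hF) (hA E hE) hEF.symm.subset)

end

/-! ### Orientation of points on a regular polygon -/

theorem regularVertex_re (n m : ℕ) : (regularVertex n m).re = Real.cos (2 * Real.pi * (m / n)) := by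
  rw [regularVertex, show (2 * Real.pi * Complex.I * (m / n) : ℂ) =
    ((2 * Real.pi * (m / n) : ℝ) : ℂ) * Complex.I by push_cast; ring, Complex.exp_ofReal_mul_I_re]

theorem regularVertex_im (n m : ℕ) : (regularVertex n m).im = Real.sin (2 * Real.pi * (m / n)) := by
  rw [regularVertex, show (2 * Real.pi * Complex.I * (m / n) : ℂ) =
    ((2 * Real.pi * (m / n) : ℝ) : ℂ) * Complex.I by push_cast; ring, Complex.exp_ofReal_mul_I_im]

theorem regularVertex_zero (n : ℕ) : regularVertex n 0 = 1 := by
  simp [regularVertex]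

theorem regularVertex_self {n : ℕ} (hn : n ≠ 0) : regularVertex n n = 1 := by
  have : (n : ℂ) ≠ 0 := by exact_mod_cast hn
  rw [regularVertex, div_self this, mul_one, Complex.exp_two_pi_mul_I]

/-- Twice the area of a triangle inscribed in the unit circle is half the product of its sides, and
a chord is twice the sine of half its central angle. The signs are correct as well, so positivity
becomes a statement about sines on [0, π]. -/
theorem orient_regularVertex {n : ℕ} (a b c : ℕ) :
    orient (regularVertex n a) (regularVertex n b) (regularVertex n c) =
      4 * Real.sin (Real.pi * ((b - a) / n)) * Real.sin (Real.pi * ((c - b) / n)) *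
        Real.sin (Real.pi * ((c - a) / n)) := by
  have h1 : Real.pi * ((c - a) / n) = Real.pi * (((b : ℝ) - a) / n) + Real.pi * ((c - b) / n) := by
    ring
  simp only [orient, regularVertex_re, regularVertex_im]
  set x := Real.pi * (((b : ℝ) - a) / n)
  set y := Real.pi * (((c : ℝ) - b) / n)
  set u := 2 * Real.pi * ((a : ℝ) / n) with hu
  have hb : 2 * Real.pi * ((b : ℝ) / n) = u + 2 * x := by simp only [u, x]; ring
  have hc : 2 * Real.pi * ((c : ℝ) / n) = u + 2 * (x + y) := by simp only [u, x, y]; ring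
  rw [h1, hb, hc]
  simp only [Real.cos_add, Real.sin_add, Real.cos_two_mul, Real.sin_two_mul]
  have e1 := Real.sin_sq_add_cos_sq u
  have e2 := Real.sin_sq_add_cos_sq x
  have e3 := Real.sin_sq_add_cos_sq y
  have f1 : Real.cos u ^ 2 = 1 - Real.sin u ^ 2 := by linarith
  have f2 : Real.cos x ^ 2 = 1 - Real.sin x ^ 2 := by linarith
  have f3 : Real.cos y ^ 2 = 1 - Real.sin y ^ 2 := by linarith
  generalize Real.sin u = su at *
  generalize Real.cos u = cu at *
  generalize Real.sin x = sx at *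
  generalize Real.cos x = cx at *
  generalize Real.sin y = sy at *
  generalize Real.cos y = cy at *
  grind

theorem orient_regularVertex_nonneg {n a b c : ℕ} (h1 : a ≤ b) (h2 : b ≤ c) (h3 : c ≤ a + n) :
    0 ≤ orient (regularVertex n a) (regularVertex n b) (regularVertex n c) := by
  rw [orient_regularVertex]
  have h1' : (a : ℝ) ≤ b := by exact_mod_cast h1
  have h2' : (b : ℝ) ≤ c := by exact_mod_cast h2
  have h3' : (c : ℝ) ≤ a + n := by exact_mod_cast h3
  have key : ∀ x : ℝ, 0 ≤ x → x ≤ n → 0 ≤ Real.sin (Real.pi * (x / n)) := fun x hx hxn =>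
    Real.sin_nonneg_of_nonneg_of_le_pi (by positivity)
      (mul_le_of_le_one_right Real.pi_pos.le (div_le_one_of_le₀ hxn (Nat.cast_nonneg n)))
  have k1 := key (b - a) (by linarith) (by linarith)
  have k2 := key (c - b) (by linarith) (by linarith)
  have k3 := key (c - a) (by linarith) (by linarith)
  positivity

theorem orient_regularVertex_pos {n a b c : ℕ} (h1 : a < b) (h2 : b < c) (h3 : c < a + n) :
    0 < orient (regularVertex n a) (regularVertex n b) (regularVertex n c) := by
  rw [orient_regularVertex]
  have h1' : (a : ℝ) < b := by exact_mod_cast h1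
  have h2' : (b : ℝ) < c := by exact_mod_cast h2
  have h3' : (c : ℝ) < a + n := by exact_mod_cast h3
  have hn : (0 : ℝ) < n := by linarith
  have key : ∀ x : ℝ, 0 < x → x < n → 0 < Real.sin (Real.pi * (x / n)) := fun x hx hxn =>
    Real.sin_pos_of_pos_of_lt_pi (by positivity)
      (mul_lt_of_lt_one_right Real.pi_pos ((div_lt_one hn).2 hxn))
  have k1 := key (b - a) (by linarith) (by linarith)
  have k2 := key (c - b) (by linarith) (by linarith)
  have k3 := key (c - a) (by linarith) (by linarith)
  positivity

/-- The point dividing the `i`-th side of the regular `k`-gon in the ratio `t : 1 - t`. -/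
noncomputable def sidePoint (k i : ℕ) (t : ℝ) : ℂ :=
  regularVertex k i + t * (regularVertex k (i + 1) - regularVertex k i)

theorem orient_sidePoint (k i : ℕ) (t : ℝ) (a b : ℂ) : orient a b (sidePoint k i t) =
    (1 - t) * orient a b (regularVertex k i) + t * orient a b (regularVertex k (i + 1)) :=
  orient_lineMap _ _ _ _ _

theorem orient_vertex_vertex_nonneg {k i u v : ℕ} {α : ℝ} (h0 : 0 ≤ α) (h1 : α ≤ 1)
    (hi : i + 1 ≤ u) (huv : u ≤ v) (hv : v ≤ i + k) :
    0 ≤ orient (sidePoint k i α) (regularVertex k u) (regularVertex k v) := by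
  rw [← orient_rotate, orient_sidePoint, orient_rotate, orient_rotate _ _ (regularVertex k (i + 1))]
  have k1 := orient_regularVertex_nonneg (n := k) (by omega : i ≤ u) huv hv
  have k2 := orient_regularVertex_nonneg (n := k) hi huv (by omega)
  have : 0 ≤ 1 - α := by linarith
  positivity

/-- `orient` is affine in each argument, so a point on a side is handled by averaging over its two
corners. Since α < 1, the corner preceding the point has positive weight, and strictness there
suffices. The later lemmas move the remaining points in the same way. -/
theorem orient_vertex_vertex_pos {k i u v : ℕ} {α : ℝ} (h0 : 0 ≤ α) (h1 : α < 1)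
    (hi : i + 1 ≤ u) (huv : u < v) (hv : v < i + k) :
    0 < orient (sidePoint k i α) (regularVertex k u) (regularVertex k v) := by
  rw [← orient_rotate, orient_sidePoint, orient_rotate, orient_rotate _ _ (regularVertex k (i + 1))]
  have k1 := orient_regularVertex_pos (n := k) (by omega : i < u) huv hv
  have k2 := orient_regularVertex_nonneg (n := k) hi huv.le (by omega)
  have : 0 < 1 - α := by linarith
  positivity

theorem orient_side_vertex_nonneg {k i j v : ℕ} {α β : ℝ} (h0 : 0 ≤ α) (h1 : α ≤ 1)
    (h2 : 0 ≤ β) (h3 : β ≤ 1) (hij : i < j) (hjv : j < v) (hv : v ≤ i + k) :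
    0 ≤ orient (sidePoint k i α) (sidePoint k j β) (regularVertex k v) := by
  rw [orient_rotate, orient_sidePoint, ← orient_rotate, ← orient_rotate _ (regularVertex k (j + 1))]
  have k1 := orient_vertex_vertex_nonneg (k := k) h0 h1 hij hjv.le hv
  have k2 := orient_vertex_vertex_nonneg (k := k) h0 h1 (by omega) (by omega : j + 1 ≤ v) hv
  have : 0 ≤ 1 - β := by linarith
  positivity

theorem orient_side_vertex_pos {k i j v : ℕ} {α β : ℝ} (h0 : 0 ≤ α) (h1 : α < 1)
    (h2 : 0 ≤ β) (h3 : β < 1) (hij : i < j) (hjv : j < v) (hv : v < i + k) :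
    0 < orient (sidePoint k i α) (sidePoint k j β) (regularVertex k v) := by
  rw [orient_rotate, orient_sidePoint, ← orient_rotate, ← orient_rotate _ (regularVertex k (j + 1))]
  have k1 := orient_vertex_vertex_pos (k := k) h0 h1 hij hjv hv
  have k2 := orient_vertex_vertex_nonneg (k := k) h0 h1.le (by omega) (by omega : j + 1 ≤ v) hv.le
  have : 0 < 1 - β := by linarith
  positivity

/-- Points in the interiors of three different sides of a regular polygon, or the corners preceding
them. -/
theorem orient_sides_pos {k i j l : ℕ} {α β γ : ℝ} (h0 : 0 ≤ α) (h1 : α < 1)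
    (h2 : 0 ≤ β) (h3 : β < 1) (h4 : 0 ≤ γ) (h5 : γ < 1) (hij : i < j) (hjl : j < l) (hl : l < k) :
    0 < orient (sidePoint k i α) (sidePoint k j β) (sidePoint k l γ) := by
  rw [orient_sidePoint]
  have k1 := orient_side_vertex_pos (k := k) h0 h1 h2 h3 hij hjl (by omega)
  have k2 := orient_side_vertex_nonneg (k := k) h0 h1.le h2 h3.le hij (by omega : j < l + 1)
    (by omega)
  have : 0 < 1 - γ := by linarith
  positivity

theorem orient_same_side (k i : ℕ) (α β : ℝ) (z : ℂ) :
    orient (sidePoint k i α) (sidePoint k i β) z =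
      (β - α) * orient (regularVertex k i) (regularVertex k (i + 1)) z := by
  simp only [orient, sidePoint, Complex.add_re, Complex.add_im, Complex.sub_re, Complex.sub_im,
    Complex.mul_re, Complex.mul_im, Complex.ofReal_re, Complex.ofReal_im]
  ring

theorem orient_edge_side_nonneg {k i l : ℕ} {γ : ℝ} (h4 : 0 ≤ γ) (h5 : γ ≤ 1) (hil : i < l)
    (hl : l < k) :
    0 ≤ orient (regularVertex k i) (regularVertex k (i + 1)) (sidePoint k l γ) := by
  rw [orient_sidePoint]
  have k1 := orient_regularVertex_nonneg (n := k) (by omega : i ≤ i + 1) hil (by omega)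
  have k2 := orient_regularVertex_nonneg (n := k) (by omega : i ≤ i + 1)
    (by omega : i + 1 ≤ l + 1) (by omega)
  have : 0 ≤ 1 - γ := by linarith
  positivity

/-- A point on the following side may degenerate to the shared corner, which is collinear with the
edge; `hdeg` excludes exactly this. -/
theorem orient_edge_side_pos {k i l : ℕ} {γ : ℝ} (hk : 3 ≤ k) (h4 : 0 ≤ γ) (h5 : γ < 1)
    (hil : i < l) (hl : l < k) (hdeg : l = i + 1 → 0 < γ) :
    0 < orient (regularVertex k i) (regularVertex k (i + 1)) (sidePoint k l γ) := by
  rw [orient_sidePoint]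
  have k1 := orient_regularVertex_nonneg (n := k) (by omega : i ≤ i + 1) hil (by omega)
  have k2 := orient_regularVertex_nonneg (n := k) (by omega : i ≤ i + 1)
    (by omega : i + 1 ≤ l + 1) (by omega)
  have : 0 < 1 - γ := by linarith
  rcases (by omega : l = i + 1 ∨ i + 1 < l) with h | h
  · have h6 := hdeg h
    have k3 := orient_regularVertex_pos (n := k) (by omega : i < i + 1)
      (by omega : i + 1 < l + 1) (by omega)
    positivity
  · have k3 := orient_regularVertex_pos (n := k) (by omega : i < i + 1) h (by omega)
    positivity

theorem orient_side_edge_nonneg {k i j : ℕ} {α : ℝ} (h4 : 0 ≤ α) (h5 : α ≤ 1) (hij : i < j)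
    (hj : j < k) :
    0 ≤ orient (regularVertex k j) (regularVertex k (j + 1)) (sidePoint k i α) := by
  rw [orient_rotate]
  exact orient_vertex_vertex_nonneg h4 h5 hij (by omega) (by omega)

theorem orient_side_edge_pos {k i j : ℕ} {α : ℝ} (hk : 3 ≤ k) (h4 : 0 ≤ α) (h5 : α < 1)
    (hij : i < j) (hj : j < k) (hdeg : i = 0 → j + 1 = k → 0 < α) :
    0 < orient (regularVertex k j) (regularVertex k (j + 1)) (sidePoint k i α) := by
  rcases (by omega : j + 1 < i + k ∨ (i = 0 ∧ j + 1 = k)) with h | ⟨rfl, h⟩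
  · rw [orient_rotate]
    exact orient_vertex_vertex_pos h4 h5 hij (by omega) h
  · have h6 := hdeg rfl h
    rw [orient_sidePoint, orient_rotate, orient_rotate _ _ (regularVertex k (0 + 1))]
    have k1 := orient_regularVertex_nonneg (n := k) (by omega : 0 ≤ j) (by omega : j ≤ j + 1)
      (by omega)
    have k2 := orient_regularVertex_pos (n := k) (by omega : 0 + 1 < j) (by omega : j < j + 1)
      (by omega)
    have : 0 < 1 - α := by linarith
    positivity

/-! ### The point set SC(k,r) as a convex chain -/

/-- The points of `SC(k,r)` numbered consecutively; the number `k * r` stands for `0`. -/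
noncomputable def scAt (k r a : ℕ) : ℂ := scPoint k r (a / r) (a % r)

theorem scPoint_eq_sidePoint (k r i j : ℕ) : scPoint k r i j = sidePoint k i ((j : ℝ) / r) := by
  simp [scPoint, sidePoint]

/-- The closed side is allowed: its final corner, which integer division assigns to the next side,
is the point with parameter 1 on this one. -/
theorem scAt_eq_sidePoint {k r s a : ℕ} (hr : 0 < r) (h1 : s * r ≤ a) (h2 : a ≤ (s + 1) * r) :
    scAt k r a = sidePoint k s (((a : ℝ) - s * r) / r) := by
  have hr' : (r : ℝ) ≠ 0 := by exact_mod_cast hr.ne'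
  rw [scAt, scPoint_eq_sidePoint]
  rcases h2.eq_or_lt with rfl | h2
  · rw [Nat.mul_div_cancel _ hr, Nat.mul_mod_left]
    have : (((((s + 1) * r : ℕ) : ℝ)) - s * r) / r = 1 := by
      push_cast; field_simp; ring
    rw [this]
    simp [sidePoint]
  · have hs : a / r = s := by
      rw [Nat.div_eq_iff hr]; constructor
      · exact h1
      · rw [Nat.add_mul] at h2; omega
    have : (a : ℝ) = r * s + (a % r : ℕ) := by
      have := Nat.div_add_mod a r
      rw [hs] at this
      exact_mod_cast this.symm
    rw [hs]
    congr 2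
    rw [this]; ring

theorem scAt_mul_self {k r : ℕ} (hk : 0 < k) (hr : 0 < r) : scAt k r (k * r) = scAt k r 0 := by
  rw [scAt, scAt, Nat.mul_div_cancel _ hr, Nat.mul_mod_left]
  simp [scPoint, regularVertex_self hk.ne', regularVertex_zero]

theorem exists_scAt_eq {k r : ℕ} {a : ℕ} (hr : 0 < r) (ha : a < k * r) :
    ∃ (i : ℕ) (t : ℝ), i < k ∧ 0 ≤ t ∧ t < 1 ∧ scAt k r a = sidePoint k i t ∧ a = (i + t) * r := by
  have hr' : (0 : ℝ) < r := by exact_mod_cast hr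
  refine ⟨a / r, (a % r : ℕ) / r, (Nat.div_lt_iff_lt_mul hr).2 ha, by positivity, ?_, ?_, ?_⟩
  · rw [div_lt_one hr']
    exact_mod_cast Nat.mod_lt a hr
  · rw [scAt, scPoint_eq_sidePoint]
  · have := Nat.div_add_mod a r
    have h : (a : ℝ) = r * (a / r : ℕ) + (a % r : ℕ) := by exact_mod_cast this.symm
    rw [add_mul, div_mul_cancel₀ _ hr'.ne']
    linarith

theorem orient_scAt_nonneg {k r a b c : ℕ} (hr : 0 < r) (hab : a < b) (hbc : b < c)
    (hc : c < k * r) : 0 ≤ orient (scAt k r a) (scAt k r b) (scAt k r c) := by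
  obtain ⟨i, α, hi, h0, h1, ea, ha⟩ := exists_scAt_eq hr (by omega : a < k * r)
  obtain ⟨j, β, hj, h2, h3, eb, hb⟩ := exists_scAt_eq hr (by omega : b < k * r)
  obtain ⟨l, γ, hl, h4, h5, ec, hcc⟩ := exists_scAt_eq hr hc
  have hr' : (0 : ℝ) < r := by exact_mod_cast hr
  have hab' : (i : ℝ) + α < j + β := by
    have : (a : ℝ) < b := by exact_mod_cast hab
    rw [ha, hb] at this
    exact lt_of_mul_lt_mul_right this hr'.le
  have hbc' : (j : ℝ) + β < l + γ := by
    have : (b : ℝ) < c := by exact_mod_cast hbc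
    rw [hb, hcc] at this
    exact lt_of_mul_lt_mul_right this hr'.le
  have hij : i ≤ j := by
    have : (i : ℝ) < j + 1 := by linarith
    have : i < j + 1 := by exact_mod_cast this
    omega
  have hjl : j ≤ l := by
    have : (j : ℝ) < l + 1 := by linarith
    have : j < l + 1 := by exact_mod_cast this
    omega
  rw [ea, eb, ec]
  rcases hij.eq_or_lt with rfl | hij
  · rw [orient_same_side]
    rcases hjl.eq_or_lt with rfl | hjl
    · rw [orient_sidePoint, orient_self_left, orient_self_right]; simp
    · exact mul_nonneg (by linarith) (orient_edge_side_nonneg h4 h5.le hjl hl)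
  · rcases hjl.eq_or_lt with rfl | hjl
    · rw [orient_rotate, orient_rotate, orient_same_side]
      exact mul_nonneg (by linarith) (orient_side_edge_nonneg h0 h1.le hij hj)
    · exact (orient_sides_pos h0 h1 h2 h3 h4 h5 hij hjl hl).le

/-- Three points are collinear only when they share a closed side. `hd1` rules this out for sides
read in label order, and `hd2` for the last side, whose final corner carries the label 0. -/
theorem orient_scAt_pos {k r a b c : ℕ} (hk : 3 ≤ k) (hr : 0 < r) (hab : a < b) (hbc : b < c)
    (hc : c < k * r) (hd1 : ∀ s, ¬ (s * r ≤ a ∧ c ≤ (s + 1) * r))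
    (hd2 : ¬ (a = 0 ∧ (k - 1) * r ≤ b)) :
    0 < orient (scAt k r a) (scAt k r b) (scAt k r c) := by
  obtain ⟨i, α, hi, h0, h1, ea, ha⟩ := exists_scAt_eq hr (by omega : a < k * r)
  obtain ⟨j, β, hj, h2, h3, eb, hb⟩ := exists_scAt_eq hr (by omega : b < k * r)
  obtain ⟨l, γ, hl, h4, h5, ec, hcc⟩ := exists_scAt_eq hr hc
  have hr' : (0 : ℝ) < r := by exact_mod_cast hr
  have hab' : (i : ℝ) + α < j + β := by
    have : (a : ℝ) < b := by exact_mod_cast hab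
    rw [ha, hb] at this
    exact lt_of_mul_lt_mul_right this hr'.le
  have hbc' : (j : ℝ) + β < l + γ := by
    have : (b : ℝ) < c := by exact_mod_cast hbc
    rw [hb, hcc] at this
    exact lt_of_mul_lt_mul_right this hr'.le
  have hij : i ≤ j := by
    have : (i : ℝ) < j + 1 := by linarith
    have : i < j + 1 := by exact_mod_cast this
    omega
  have hjl : j ≤ l := by
    have : (j : ℝ) < l + 1 := by linarith
    have : j < l + 1 := by exact_mod_cast this
    omega
  have hia : i * r ≤ a := by
    have : (i : ℝ) * r ≤ a := by rw [ha]; nlinarith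
    exact_mod_cast this
  have hjb : j * r ≤ b := by
    have : (j : ℝ) * r ≤ b := by rw [hb]; nlinarith
    exact_mod_cast this
  rw [ea, eb, ec]
  rcases hij.eq_or_lt with rfl | hij
  · rw [orient_same_side]
    rcases hjl.eq_or_lt with rfl | hjl
    · refine absurd ⟨hia, ?_⟩ (hd1 i)
      have : (c : ℝ) ≤ (i + 1) * r := by rw [hcc]; nlinarith
      exact_mod_cast this
    · refine mul_pos (by linarith) (orient_edge_side_pos hk h4 h5 hjl hl fun h => ?_)
      by_contra! hγ
      refine hd1 i ⟨hia, ?_⟩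
      have : γ = 0 := le_antisymm hγ h4
      subst this h
      have : (c : ℝ) ≤ (i + 1) * r := by rw [hcc]; push_cast; nlinarith
      exact_mod_cast this
  · rcases hjl.eq_or_lt with rfl | hjl
    · rw [orient_rotate, orient_rotate, orient_same_side]
      refine mul_pos (by linarith) (orient_side_edge_pos hk h0 h1 hij hj fun h h' => ?_)
      by_contra! hα
      have : α = 0 := le_antisymm hα h0
      subst this h
      refine hd2 ⟨?_, ?_⟩
      · have : (a : ℝ) = 0 := by rw [ha]; simp
        exact_mod_cast this
      · rwa [show k - 1 = j by omega]
    · exact orient_sides_pos h0 h1 h2 h3 h4 h5 hij hjl hl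

theorem regularVertex_succ_ne {k : ℕ} (hk : 3 ≤ k) (s : ℕ) :
    regularVertex k (s + 1) - regularVertex k s ≠ 0 := by
  intro h
  have := orient_regularVertex_pos (n := k) (by omega : s < s + 1) (by omega : s + 1 < s + 2)
    (by omega)
  rw [sub_eq_zero.1 h] at this
  simp [orient] at this

theorem scAt_ne {k r a b : ℕ} (hk : 3 ≤ k) (hr : 0 < r) (hab : a < b) (hb : b < k * r) :
    scAt k r a ≠ scAt k r b := by
  obtain ⟨i, α, hi, h0, h1, ea, ha⟩ := exists_scAt_eq hr (by omega : a < k * r)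
  obtain ⟨j, β, hj, h2, h3, eb, hbb⟩ := exists_scAt_eq hr hb
  have hr' : (0 : ℝ) < r := by exact_mod_cast hr
  have hab' : (i : ℝ) + α < j + β := by
    have : (a : ℝ) < b := by exact_mod_cast hab
    rw [ha, hbb] at this
    exact lt_of_mul_lt_mul_right this hr'.le
  have hij : i ≤ j := by
    have : (i : ℝ) < j + 1 := by linarith
    have : i < j + 1 := by exact_mod_cast this
    omega
  rw [ea, eb]
  intro heq
  rcases hij.eq_or_lt with rfl | hij
  · have h6 : ((α : ℂ) - β) * (regularVertex k (i + 1) - regularVertex k i) = 0 := by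
      unfold sidePoint at heq
      linear_combination heq
    rcases mul_eq_zero.1 h6 with h | h
    · have : α = β := by exact_mod_cast sub_eq_zero.1 h
      linarith
    · exact regularVertex_succ_ne hk i h
  · rcases (by omega : j + 1 < i + k ∨ (i = 0 ∧ j + 1 = k)) with h | ⟨rfl, h⟩
    · have := orient_side_vertex_pos (k := k) h0 h1 h2 h3 hij (by omega : j < j + 1) h
      rw [heq] at this
      simp [orient] at this
    -- On the first and last sides the end of the later side may be the start of the earlier one, so
    -- corner 1 is used as reference: the triangle with the two points and that corner has positive
    -- area, which fails if they coincide.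
    · have k1 := orient_vertex_vertex_pos (k := k) (i := 0) h0 h1 (by omega : 0 + 1 ≤ 1)
        (by omega : 1 < j) (by omega)
      have k2 := orient_vertex_vertex_nonneg (k := k) (i := 0) h0 h1.le (by omega : 0 + 1 ≤ 1)
        (by omega : 1 ≤ j + 1) (by omega)
      have k3 := orient_sidePoint k j β (sidePoint k 0 α) (regularVertex k 1)
      rw [← heq, orient_self_left] at k3
      have : 0 < 1 - β := by linarith
      have : 0 < (1 - β) * orient (sidePoint k 0 α) (regularVertex k 1) (regularVertex k j) := by
        positivity
      have : 0 ≤ β * orient (sidePoint k 0 α) (regularVertex k 1) (regularVertex k (j + 1)) := by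
        positivity
      linarith

theorem scAt_mem_openSegment {k r s a b c : ℕ} (hr : 0 < r) (hs : s * r ≤ a) (hac : a < c)
    (hcb : c < b) (hb : b ≤ (s + 1) * r) :
    scAt k r c ∈ openSegment ℝ (scAt k r a) (scAt k r b) := by
  rw [scAt_eq_sidePoint hr hs (by omega), scAt_eq_sidePoint hr (by omega : s * r ≤ b) hb,
    scAt_eq_sidePoint hr (by omega : s * r ≤ c) (by omega), mem_openSegment_iff_lineMap]
  have h1 : (a : ℝ) < c := by exact_mod_cast hac
  have h2 : (c : ℝ) < b := by exact_mod_cast hcb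
  have hba : (b : ℝ) - a ≠ 0 := by linarith
  have hr' : (r : ℝ) ≠ 0 := by exact_mod_cast hr.ne'
  refine ⟨(c - a) / (b - a), div_pos (by linarith) (by linarith), ?_, ?_⟩
  · rw [div_lt_one (by linarith)]; linarith
  · have : ((c : ℝ) - s * r) / r = (a - s * r) / r + (c - a) / (b - a) *
        ((b - s * r) / r - (a - s * r) / r) := by
      field_simp; ring
    rw [this]
    simp only [sidePoint]
    push_cast
    ring

theorem lt_of_scAt_mem_openSegment {k r s a b c : ℕ} (hk : 3 ≤ k) (hr : 0 < r) (ha : s * r ≤ a)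
    (hab : a < b) (hb : b ≤ (s + 1) * r) (hc : s * r ≤ c) (hc' : c ≤ (s + 1) * r)
    (h : scAt k r c ∈ openSegment ℝ (scAt k r a) (scAt k r b)) : a < c ∧ c < b := by
  rw [scAt_eq_sidePoint hr ha (by omega), scAt_eq_sidePoint hr (by omega : s * r ≤ b) hb,
    scAt_eq_sidePoint hr hc hc', mem_openSegment_iff_lineMap] at h
  obtain ⟨t, ht0, ht1, h⟩ := h
  have hr' : (r : ℝ) ≠ 0 := by exact_mod_cast hr.ne'
  have h1 : (a : ℝ) < b := by exact_mod_cast hab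
  have h2 : ((c : ℝ) - s * r) / r = (a - s * r) / r + t * ((b - s * r) / r - (a - s * r) / r) := by
    have : ((((c : ℝ) - s * r) / r : ℝ) : ℂ) =
        (((a - s * r) / r + t * ((b - s * r) / r - (a - s * r) / r) : ℝ) : ℂ) := by
      apply mul_right_cancel₀ (regularVertex_succ_ne hk s)
      simp only [sidePoint] at h
      push_cast at h ⊢
      linear_combination h
    exact_mod_cast this
  have h3 : (c : ℝ) = a + t * (b - a) := by
    field_simp at h2
    linarith
  constructor
  · have : (a : ℝ) < c := by rw [h3]; nlinarith
    exact_mod_cast this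
  · have : (c : ℝ) < b := by rw [h3]; nlinarith
    exact_mod_cast this

/-- `a` and `b` are not two non-neighbouring points of one of the intervals `[s r, (s + 1) r]`. -/
def SideFree (r a b : ℕ) : Prop := ∀ s, ¬ (s * r ≤ a ∧ a + 2 ≤ b ∧ b ≤ (s + 1) * r)

/-- The points numbered `a < b` are not two non-neighbouring points of one string. -/
def StringFree (k r a b : ℕ) : Prop :=
  SideFree r a b ∧ ¬ (a = 0 ∧ (k - 1) * r ≤ b ∧ b + 2 ≤ k * r)

/-- A forbidden chord contains a neighbour of one of its ends, with 0 relabelled as kr for the last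
side. Conversely, a third point on the segment makes an area vanish, so all three points share a
closed side; the order along that side then contradicts the chord being permitted. -/
theorem isDiagonal_scAt_iff {k r a b : ℕ} (hk : 3 ≤ k) (hr : 0 < r)
    (hS : ∀ z, z ∈ SC k r ↔ ∃ a < k * r, z = scAt k r a) (hab : a < b) (hb : b < k * r) :
    IsDiagonal (SC k r) s(scAt k r a, scAt k r b) ↔ StringFree k r a b := by
  have hk1 : k - 1 + 1 = k := by omega
  have hk2 : (k - 1 + 1) * r = k * r := by rw [hk1]
  have hk3 : (k - 1) * r ≤ k * r := Nat.mul_le_mul_right _ (by omega)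
  rw [isDiagonal_mk]
  constructor
  · rintro ⟨-, -, -, hdis⟩
    rw [Set.disjoint_left] at hdis
    refine ⟨?_, ?_⟩
    · rintro s ⟨h1, h2, h3⟩
      exact hdis (scAt_mem_openSegment hr h1 (by omega : a < a + 1) (by omega) h3)
        ((hS _).2 ⟨a + 1, by omega, rfl⟩)
    · rintro ⟨rfl, h1, h2⟩
      refine hdis (a := scAt k r (b + 1)) ?_ ((hS _).2 ⟨b + 1, by omega, rfl⟩)
      rw [openSegment_symm, ← scAt_mul_self (by omega) hr]
      exact scAt_mem_openSegment hr h1 (by omega) (by omega) hk2.ge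
  · rintro ⟨h1, h2⟩
    have hne := scAt_ne hk hr hab hb
    refine ⟨(hS _).2 ⟨a, by omega, rfl⟩, (hS _).2 ⟨b, hb, rfl⟩, hne, ?_⟩
    rw [Set.disjoint_left]
    intro z hz hzS
    obtain ⟨c, hc, rfl⟩ := (hS _).1 hzS
    have hca : c ≠ a := by
      rintro rfl
      exact hne (left_mem_openSegment_iff.1 hz)
    have hcb : c ≠ b := by
      rintro rfl
      exact hne (right_mem_openSegment_iff.1 hz)
    have h0 := orient_eq_zero_of_mem_openSegment hz
    rcases (by omega : c < a ∨ (a < c ∧ c < b) ∨ b < c) with h | ⟨h, h'⟩ | h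
    · rw [orient_rotate] at h0
      by_cases hd1 : ∃ s, s * r ≤ c ∧ b ≤ (s + 1) * r
      · obtain ⟨s, hs1, hs2⟩ := hd1
        have := lt_of_scAt_mem_openSegment hk hr (by omega : s * r ≤ a) hab hs2 hs1 (by omega) hz
        omega
      by_cases hd2 : c = 0 ∧ (k - 1) * r ≤ a
      · rw [hd2.1, ← scAt_mul_self (by omega) hr] at hz
        have := lt_of_scAt_mem_openSegment hk hr hd2.2 hab (by omega) (by omega) (by omega) hz
        omega
      exact (orient_scAt_pos hk hr h hab hb (not_exists.1 hd1) hd2).ne' h0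
    · rw [orient_swap, neg_eq_zero] at h0
      by_cases hd1 : ∃ s, s * r ≤ a ∧ b ≤ (s + 1) * r
      · obtain ⟨s, hs1, hs2⟩ := hd1
        exact h1 s ⟨hs1, by omega, hs2⟩
      by_cases hd2 : a = 0 ∧ (k - 1) * r ≤ c
      · have hb' : ¬ b + 2 ≤ k * r := fun hh => h2 ⟨hd2.1, by omega, hh⟩
        rw [hd2.1, ← scAt_mul_self (by omega) hr, openSegment_symm] at hz
        have := lt_of_scAt_mem_openSegment hk hr (by omega : (k - 1) * r ≤ b) hb hk2.ge hd2.2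
          (by omega) hz
        omega
      exact (orient_scAt_pos hk hr h h' hb (not_exists.1 hd1) hd2).ne' h0
    · by_cases hd1 : ∃ s, s * r ≤ a ∧ c ≤ (s + 1) * r
      · obtain ⟨s, hs1, hs2⟩ := hd1
        have := lt_of_scAt_mem_openSegment hk hr hs1 hab (by omega) (by omega) hs2 hz
        omega
      by_cases hd2 : a = 0 ∧ (k - 1) * r ≤ b
      · exact h2 ⟨hd2.1, hd2.2, by omega⟩
      exact (orient_scAt_pos hk hr hab h hc (not_exists.1 hd1) hd2).ne' h0

theorem mem_SC_iff {k r : ℕ} (hr : 0 < r) (z : ℂ) :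
    z ∈ SC k r ↔ ∃ a < k * r, z = scAt k r a := by
  constructor
  · rintro ⟨i, hi, j, hj, rfl⟩
    refine ⟨r * i + j, ?_, ?_⟩
    · calc r * i + j < r * i + r := by omega
        _ = (i + 1) * r := by ring
        _ ≤ k * r := Nat.mul_le_mul_right _ hi
    · rw [scAt, Nat.mul_add_div hr, Nat.div_eq_of_lt hj, add_zero,
        Nat.mul_add_mod, Nat.mod_eq_of_lt hj]
  · rintro ⟨a, ha, rfl⟩
    exact ⟨a / r, (Nat.div_lt_iff_lt_mul hr).2 ha, a % r, Nat.mod_lt a hr, rfl⟩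

theorem isConvexChain_SC {k r : ℕ} (hk : 3 ≤ k) (hr : 0 < r) :
    IsConvexChain (SC k r) (scAt k r) (k * r) (StringFree k r) := by
  have hk2 : (k - 1 + 1) * r = k * r := by rw [show k - 1 + 1 = k by omega]
  refine ⟨mem_SC_iff hr, ?_, fun a b c => orient_scAt_nonneg hr,
    fun a b => isDiagonal_scAt_iff hk hr (mem_SC_iff hr), ?_⟩
  · intro a ha b hb h
    rcases lt_trichotomy a b with hab | hab | hab
    · exact absurd h (scAt_ne hk hr hab hb)
    · exact hab
    · exact absurd h.symm (scAt_ne hk hr hab ha)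
  · rintro a c b d hac hcb hbd hd ⟨p1, p2⟩ ⟨q1, q2⟩
    refine ⟨orient_scAt_pos hk hr hac hcb (by omega) ?_ ?_,
      orient_scAt_pos hk hr (by omega) hbd hd ?_ ?_,
      orient_scAt_pos hk hr hac (by omega) hd ?_ ?_,
      orient_scAt_pos hk hr hcb hbd hd ?_ ?_⟩
    · exact fun s hs => p1 s ⟨hs.1, by omega, hs.2⟩
    · exact fun h => p2 ⟨h.1, by omega, by omega⟩
    · exact fun s hs => p1 s ⟨hs.1, by omega, by omega⟩
    · exact fun h => p2 ⟨h.1, by omega, by omega⟩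
    · exact fun s hs => q1 s ⟨by omega, by omega, hs.2⟩
    · exact fun h => q1 (k - 1) ⟨h.2, by omega, by omega⟩
    · exact fun s hs => q1 s ⟨hs.1, by omega, hs.2⟩
    · omega

/-! ### Points in strictly convex position, for k = 2 -/

theorem mem_convexPoints_iff {k r : ℕ} (hr : 0 < r) (z : ℂ) :
    z ∈ convexPoints k r ↔ ∃ a < k * r, z = regularVertex (k * r) a := by
  constructor
  · rintro ⟨i, hi, j, hj, rfl⟩
    refine ⟨i * r + j, ?_, rfl⟩
    calc i * r + j < i * r + r := by omega
      _ = (i + 1) * r := by ring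
      _ ≤ k * r := Nat.mul_le_mul_right _ hi
  · rintro ⟨a, ha, rfl⟩
    refine ⟨a / r, (Nat.div_lt_iff_lt_mul hr).2 ha, a % r, Nat.mod_lt a hr, ?_⟩
    rw [cPoint, Nat.div_add_mod']

/-- Argued with cosines instead of areas, so that n = 2, where no third vertex is available, is
covered. -/
theorem regularVertex_ne {n a b : ℕ} (hab : a < b) (hb : b < n) :
    regularVertex n a ≠ regularVertex n b := by
  intro h
  have hn : (0 : ℝ) < n := by exact_mod_cast (by omega : 0 < n)
  have hd : Real.sin (Real.pi * (((b : ℝ) - a) / n)) ≠ 0 := by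
    have hab' : (a : ℝ) < b := by exact_mod_cast hab
    have hb' : (b : ℝ) < n := by exact_mod_cast hb
    have ha' : (0 : ℝ) ≤ a := Nat.cast_nonneg a
    refine (Real.sin_pos_of_pos_of_lt_pi
      (mul_pos Real.pi_pos (div_pos (by linarith) hn)) ?_).ne'
    exact mul_lt_of_lt_one_right Real.pi_pos ((div_lt_one hn).2 (by linarith))
  have h1 := congrArg Complex.re h
  have h2 := congrArg Complex.im h
  rw [regularVertex_re, regularVertex_re] at h1
  rw [regularVertex_im, regularVertex_im] at h2
  have h3 : Real.cos (2 * (Real.pi * (((b : ℝ) - a) / n))) = 1 := by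
    rw [show 2 * (Real.pi * (((b : ℝ) - a) / n)) =
      2 * Real.pi * (b / n) - 2 * Real.pi * (a / n) by ring, Real.cos_sub, h1, h2,
      ← sq, ← sq, Real.cos_sq_add_sin_sq]
  rw [Real.cos_two_mul, Real.cos_sq'] at h3
  exact hd (pow_eq_zero_iff (two_ne_zero) |>.1 (by linarith))

theorem isConvexChain_regular {S : Set ℂ} {n : ℕ}
    (hS : ∀ z, z ∈ S ↔ ∃ a < n, z = regularVertex n a) :
    IsConvexChain S (regularVertex n) n (fun _ _ => True) := by
  refine ⟨hS, ?_, fun a b c h1 h2 h3 => orient_regularVertex_nonneg h1.le h2.le (by omega), ?_, ?_⟩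
  · intro a ha b hb h
    rcases lt_trichotomy a b with hab | hab | hab
    · exact absurd h (regularVertex_ne hab hb)
    · exact hab
    · exact absurd h.symm (regularVertex_ne hab ha)
  · intro a b hab hb
    simp only [iff_true]
    have hne := regularVertex_ne hab hb
    refine isDiagonal_mk.2 ⟨(hS _).2 ⟨a, by omega, rfl⟩, (hS _).2 ⟨b, hb, rfl⟩, hne, ?_⟩
    rw [Set.disjoint_left]
    intro z hz hzS
    obtain ⟨c, hc, rfl⟩ := (hS _).1 hzS
    have hca : c ≠ a := by
      rintro rfl
      exact hne (left_mem_openSegment_iff.1 hz)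
    have hcb : c ≠ b := by
      rintro rfl
      exact hne (right_mem_openSegment_iff.1 hz)
    have h0 := orient_eq_zero_of_mem_openSegment hz
    rcases (by omega : c < a ∨ (a < c ∧ c < b) ∨ b < c) with h | ⟨h, h'⟩ | h
    · rw [orient_rotate] at h0
      exact (orient_regularVertex_pos h hab (by omega)).ne' h0
    · rw [orient_swap, neg_eq_zero] at h0
      exact (orient_regularVertex_pos h h' (by omega)).ne' h0
    · exact (orient_regularVertex_pos hab h (by omega)).ne' h0
  · intro a c b d h1 h2 h3 h4 _ _
    exact ⟨orient_regularVertex_pos h1 h2 (by omega),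
      orient_regularVertex_pos (by omega) h3 (by omega),
      orient_regularVertex_pos h1 (by omega) (by omega),
      orient_regularVertex_pos h2 h3 (by omega)⟩

/-! ### Reducing the number of triangulations to polygon counts -/

/-- A full triangulation stays maximal when more chords are permitted, because every chord it lacks
crosses one of its own. For k = 2 this says that a legal triangulation is maximal among all chords
of the convex polygon. -/
theorem IsPolyTri.maximal {p q : ℕ → ℕ → Prop} {n : ℕ} (hn : 0 < n) {E : Set (ℕ × ℕ)}
    (hpq : ∀ a b, p a b → q a b) (hE : IsPolyTri p 0 (n - 1) E) :
    Maximal (IsPolyNoncrossing q n) E := by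
  refine ⟨⟨fun e he => ?_, hE.noncross⟩, fun F hF hEF e he => ?_⟩
  · obtain ⟨-, h2, h3, h4⟩ := hE.mem e he
    exact ⟨h2, by omega, hpq _ _ h4⟩
  · have h1 := hF.1 e he
    exact hE.mem_of_noncross (Nat.zero_le _) h1.1 (by omega)
      (fun f hf => hF.2 f (hEF hf) e he) (fun f hf => hF.2 e he f (hEF hf))

theorem Maximal.polyNoncrossing_of_imp {p q : ℕ → ℕ → Prop} {n : ℕ} {E : Set (ℕ × ℕ)}
    (hpq : ∀ a b, p a b → q a b) (hE : Maximal (IsPolyNoncrossing q n) E)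
    (h : ∀ e ∈ E, p e.1 e.2) : Maximal (IsPolyNoncrossing p n) E := by
  refine ⟨⟨fun e he => ?_, hE.1.2⟩, fun F hF hEF => hE.2 ⟨fun e he => ?_, hF.2⟩ hEF⟩
  · obtain ⟨h1, h2, -⟩ := hE.1.1 e he
    exact ⟨h1, h2, h e he⟩
  · obtain ⟨h1, h2, h3⟩ := hF.1 e he
    exact ⟨h1, h2, hpq _ _ h3⟩

theorem stringFree_succ {k r : ℕ} (hk : 2 ≤ k) (i : ℕ) : StringFree k r i (i + 1) := by
  refine ⟨fun s hs => by omega, ?_⟩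
  rintro ⟨rfl, h1, h2⟩
  obtain ⟨k, rfl⟩ := Nat.exists_eq_add_of_le hk
  have : (2 + k - 1) * r = k * r + r := by
    rw [show 2 + k - 1 = k + 1 by omega]; ring
  have : (2 + k) * r = k * r + 2 * r := by ring
  omega

theorem stringFree_root {k r : ℕ} (hk : 2 ≤ k) (hr : 0 < r) : StringFree k r 0 (k * r - 1) := by
  refine ⟨?_, by omega⟩
  rintro s ⟨h1, h2, h3⟩
  have hs : s = 0 := by
    rcases Nat.mul_eq_zero.1 (Nat.le_zero.1 h1) with h | h <;> omega
  subst hs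
  have : 2 * r ≤ k * r := Nat.mul_le_mul_right _ hk
  omega

/-- This is the hypothesis `hp` of `Maximal.isPolyTri`. As l > 0, the chord `(l, j)` fails because l
and j lie on one side s. If `(i, m)` failed too, then either i is on side s and `(i, j)` is
forbidden, or i = 0, l is on the last side and `(0, l)` is forbidden. -/
theorem stringFree_of_not {k r i l m j : ℕ} (hil : i < l) (hlm : l < m)
    (hmj : m < j) (hj : j < k * r) (h1 : StringFree k r i l) (h2 : StringFree k r i j)
    (h3 : ¬ StringFree k r l j) : StringFree k r i m := by
  obtain ⟨s, hs1, hs2, hs3⟩ : ∃ s, s * r ≤ l ∧ l + 2 ≤ j ∧ j ≤ (s + 1) * r := by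
    by_contra! h
    exact h3 ⟨fun s hs => absurd hs.2.2 (h s hs.1 hs.2.1).not_ge, fun h => by omega⟩
  refine ⟨?_, ?_⟩
  · rintro s' ⟨h4, h5, h6⟩
    have e1 : s < s' + 1 := lt_of_mul_lt_mul_right (by omega : s * r < (s' + 1) * r) (Nat.zero_le r)
    have e2 : s' < s + 1 := lt_of_mul_lt_mul_right (by omega : s' * r < (s + 1) * r) (Nat.zero_le r)
    obtain rfl : s = s' := by omega
    exact h2.1 s ⟨h4, by omega, hs3⟩
  · rintro ⟨rfl, h5, h6⟩
    have e1 : k - 1 < s + 1 :=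
      lt_of_mul_lt_mul_right (by omega : (k - 1) * r < (s + 1) * r) (Nat.zero_le r)
    have : (k - 1) * r ≤ s * r := Nat.mul_le_mul_right _ (by omega)
    exact h1.2 ⟨rfl, by omega, by omega⟩

theorem Maximal.isPolyTri_stringFree {k r : ℕ} (hk : 2 ≤ k) (hr : 0 < r) {E : Set (ℕ × ℕ)}
    (hE : Maximal (IsPolyNoncrossing (StringFree k r) (k * r)) E) :
    IsPolyTri (StringFree k r) 0 (k * r - 1) E := by
  have : 2 * 1 ≤ k * r := Nat.mul_le_mul hk hr
  exact hE.isPolyTri (by omega) (fun i _ => stringFree_succ hk i) (stringFree_root hk hr)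
    fun i l m j h1 h2 h3 h4 => stringFree_of_not h1 h2 h3 h4

theorem tr_eq_triCount_of_three_le {k r : ℕ} (hk : 3 ≤ k) (hr : 0 < r) :
    tr k r = triCount (StringFree k r) 0 (k * r - 1) := by
  have hn : 0 < k * r := Nat.mul_pos (by omega) hr
  rw [tr, if_neg (by omega), triCount]
  have h := isConvexChain_SC hk hr
  rw [← h.ncard_image]
  · congr 1
    ext D
    rw [Set.mem_ofPred_eq, h.isTriangulation_iff]
    constructor
    · rintro ⟨E, hE, rfl⟩
      exact ⟨E, hE.isPolyTri_stringFree (by omega) hr, rfl⟩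
    · rintro ⟨E, hE, rfl⟩
      exact ⟨E, hE.maximal hn (fun _ _ h => h), rfl⟩
  · intro E hE e he
    obtain ⟨-, h2, h3, h4⟩ := hE.mem e he
    exact ⟨h2, by omega, h4⟩

theorem isLegal_two_iff {r : ℕ} (hr : 0 < r) {E : Set (ℕ × ℕ)}
    (hE : ∀ e ∈ E, e.1 < e.2 ∧ e.2 < 2 * r) :
    IsLegal 2 r (chord (regularVertex (2 * r)) '' E) ↔ ∀ e ∈ E, StringFree 2 r e.1 e.2 := by
  have h := isConvexChain_regular (mem_convexPoints_iff (k := 2) hr)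
  -- The second string ends at the point labelled 0, so legality at its far end is the wrap-around
  -- clause of `StringFree`.
  have hwrap : regularVertex (2 * r) (1 * r + r) = regularVertex (2 * r) 0 := by
    rw [show 1 * r + r = 2 * r by ring, regularVertex_self (by omega), regularVertex_zero]
  constructor
  · intro hL e he
    obtain ⟨h1, h2⟩ := hE e he
    refine ⟨?_, ?_⟩
    · rintro s ⟨h3, h4, h5⟩
      have hs : s < 2 := lt_of_mul_lt_mul_right (by omega : s * r < 2 * r) (Nat.zero_le r)
      rw [add_mul, one_mul] at h5
      refine hL s hs (e.1 - s * r) (e.2 - s * r) (by omega) (by omega) ⟨e, he, ?_⟩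
      simp only [cPoint, chord]
      rw [Nat.add_sub_cancel' h3, Nat.add_sub_cancel' (by omega)]
    · rintro ⟨h3, h4, h5⟩
      refine hL 1 (by omega) (e.2 - r) r (by omega) le_rfl ⟨e, he, ?_⟩
      simp only [cPoint, chord]
      rw [hwrap, one_mul, Nat.add_sub_cancel' (by omega), h3, Sym2.eq_swap]
  · rintro hL i hi j j' hj hj' ⟨e, he, hec⟩
    obtain ⟨h1, h2⟩ := hE e he
    obtain ⟨h3, h4⟩ := hL e he
    simp only [cPoint] at hec
    have hir : (i + 1) * r = i * r + r := by ring
    rcases (by omega : i * r + j' < 2 * r ∨ 2 * r ≤ i * r + j') with hlt | hge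
    · have := h.chord_inj (e := e) (f := (i * r + j, i * r + j')) ⟨h1, h2⟩
        ⟨by simp; omega, hlt⟩ hec
      subst this
      exact h3 i ⟨by simp, by simp; omega, by simp; omega⟩
    · have hi1 : i = 1 := by
        by_contra hne
        have : i = 0 := by omega
        subst this
        omega
      subst hi1
      have hj'r : j' = r := by omega
      subst hj'r
      rw [hwrap, Sym2.eq_swap] at hec
      have := h.chord_inj (e := e) (f := (0, 1 * j' + j)) ⟨h1, h2⟩
        ⟨by simp; omega, by simp; omega⟩ hec
      subst this
      exact h4 ⟨rfl, by simp, by simp; omega⟩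

theorem tr_two_eq_triCount {r : ℕ} (hr : 0 < r) :
    tr 2 r = triCount (StringFree 2 r) 0 (2 * r - 1) := by
  have hn : 0 < 2 * r := by omega
  rw [tr, if_pos rfl, triCount]
  have h := isConvexChain_regular (mem_convexPoints_iff (k := 2) hr)
  rw [← h.ncard_image]
  · congr 1
    ext D
    rw [Set.mem_ofPred_eq, h.isTriangulation_iff]
    constructor
    · rintro ⟨⟨E, hE, rfl⟩, hL⟩
      rw [isLegal_two_iff hr fun e he => ⟨(hE.1.1 e he).1, (hE.1.1 e he).2.1⟩] at hL
      exact ⟨E, (hE.polyNoncrossing_of_imp (fun _ _ _ => trivial) hL).isPolyTri_stringFree le_rfl hr,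
        rfl⟩
    · rintro ⟨E, hE, rfl⟩
      have hmax := hE.maximal hn (q := fun _ _ => True) (fun _ _ _ => trivial)
      refine ⟨⟨E, hmax, rfl⟩, ?_⟩
      simp only
      rw [isLegal_two_iff hr fun e he => ⟨(hmax.1.1 e he).1, (hmax.1.1 e he).2.1⟩]
      exact fun e he => (hE.mem e he).2.2.2
  · intro E hE e he
    obtain ⟨-, h2, h3, h4⟩ := hE.mem e he
    exact ⟨h2, by omega, trivial⟩

theorem tr_eq_triCount {k r : ℕ} (hk : 2 ≤ k) (hr : 0 < r) :
    tr k r = triCount (StringFree k r) 0 (k * r - 1) := by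
  rcases hk.eq_or_lt with rfl | hk
  · exact tr_two_eq_triCount hr
  · exact tr_eq_triCount_of_three_le hk hr

/-- Passing from the cyclic configuration to the linear one: triangulations that use a chord from
the last string to `0` use the ear at the last point. -/
theorem tr_add_eq {k r : ℕ} (hk : 2 ≤ k) (hr : 0 < r) :
    tr k r + (if r = 1 then 0 else triCount (SideFree r) 0 (k * r - 2)) =
      triCount (SideFree r) 0 (k * r - 1) := by
  have hk2 : k * r = (k - 1) * r + r := by
    rw [← Nat.succ_mul]; congr 1; omega
  have hk3 : r ≤ (k - 1) * r := Nat.le_mul_of_pos_left r (by omega)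
  rw [tr_eq_triCount hk hr]
  split_ifs with h1
  · subst h1
    rw [add_zero]
    refine triCount_congr fun a b h1 h2 h3 => ?_
    exact ⟨fun h => h.1, fun h => ⟨h, fun hh => by omega⟩⟩
  have hroot := stringFree_root hk hr
  rw [triCount_rec hroot (by omega), triCount_rec hroot.1 (by omega)]
  have hlast : k * r - 2 ∈ Finset.Ioo 0 (k * r - 1) := by rw [Finset.mem_Ioo]; omega
  rw [← Finset.sum_erase_add _ _ hlast, ← Finset.sum_erase_add _ _ hlast]
  have e1 : triCount (StringFree k r) 0 (k * r - 2) = 0 :=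
    triCount_of_not fun h => h.2 ⟨rfl, by omega, by omega⟩
  have e2 : triCount (SideFree r) (k * r - 2) (k * r - 1) = 1 := by
    have := triCount_succ (p := SideFree r) (i := k * r - 2) (fun s hs => by omega)
    rwa [show k * r - 2 + 1 = k * r - 1 by omega] at this
  rw [e1, e2, zero_mul, add_zero, mul_one, Nat.add_right_cancel_iff]
  refine Finset.sum_congr rfl fun l hl => ?_
  rw [Finset.mem_erase, Finset.mem_Ioo] at hl
  obtain ⟨hl1, hl2, hl3⟩ := hl
  -- Compare by the apex `l` of the base triangle. On the last side, other than the removed ear, `l`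
  -- contributes nothing to either count. Before it, no wrap-around chord fits in either half, so
  -- the two conditions agree.
  by_cases hl4 : (k - 1) * r ≤ l
  · have e3 : triCount (SideFree r) l (k * r - 1) = 0 :=
      triCount_of_not fun h => h (k - 1) ⟨hl4, by omega, by
        rw [show k - 1 + 1 = k by omega]; omega⟩
    have e4 : triCount (StringFree k r) 0 l = 0 :=
      triCount_of_not fun h => h.2 ⟨rfl, hl4, by omega⟩
    rw [e3, e4]; simp
  · congr 1
    · refine triCount_congr fun a b h1 h2 h3 => ?_
      exact ⟨fun h => h.1, fun h => ⟨h, fun hh => by omega⟩⟩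
    · refine triCount_congr fun a b h1 h2 h3 => ?_
      exact ⟨fun h => h.1, fun h => ⟨h, fun hh => by omega⟩⟩

/-! ### Quadratic matrix equation and its resolvent -/

/-- The generating polynomial, in `1 / (t - t ^ 2)`, of the ways to merge disjoint pairs of
consecutive sides of a string with `j` sides, counted with sign. -/
noncomputable def stringSum (j : ℕ) (t : ℂ) : ℂ :=
  t * (1 - t) / (1 - 2 * t) * (t⁻¹ ^ (j + 1) - (1 - t)⁻¹ ^ (j + 1))

theorem stringSum_zero {t : ℂ} (h0 : t ≠ 0) (h1 : 1 - t ≠ 0) (h2 : 1 - 2 * t ≠ 0) :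
    stringSum 0 t = 1 := by
  have ha := mul_inv_cancel₀ h0
  have hb := mul_inv_cancel₀ h1
  have hc := mul_inv_cancel₀ h2
  rw [stringSum, div_eq_mul_inv]
  linear_combination ((1 - 2 * t)⁻¹ * (1 - t)) * ha - ((1 - 2 * t)⁻¹ * t) * hb + hc

theorem stringSum_one {t : ℂ} (h0 : t ≠ 0) (h1 : 1 - t ≠ 0) (h2 : 1 - 2 * t ≠ 0) :
    t * (1 - t) * stringSum 1 t = 1 := by
  have ha := mul_inv_cancel₀ h0
  have hb := mul_inv_cancel₀ h1
  have hc := mul_inv_cancel₀ h2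
  rw [stringSum, div_eq_mul_inv]
  linear_combination ((1 - 2 * t)⁻¹ * (1 - t) ^ 2 * (t * t⁻¹ + 1)) * ha -
    ((1 - 2 * t)⁻¹ * t ^ 2 * ((1 - t) * (1 - t)⁻¹ + 1)) * hb + hc

theorem stringSum_add_two {t : ℂ} (h0 : t ≠ 0) (h1 : 1 - t ≠ 0) (j : ℕ) :
    t * (1 - t) * stringSum (j + 2) t = stringSum (j + 1) t - stringSum j t := by
  have key : ∀ s : ℂ, s ≠ 0 →
      s * (1 - s) * s⁻¹ ^ (j + 2 + 1) = s⁻¹ ^ (j + 1 + 1) - s⁻¹ ^ (j + 1) := fun s hs => by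
    linear_combination (s⁻¹ ^ j * (s⁻¹ ^ 2 - s⁻¹ * (s * s⁻¹ + 1))) * mul_inv_cancel₀ hs
  have e1 := key t h0
  have e2 := key (1 - t) h1
  unfold stringSum
  linear_combination t * (1 - t) / (1 - 2 * t) * (e1 - e2)

/-- `stringSum` along consecutive strings of length `r`, up to the `v`-th point. -/
noncomputable def pathSum (r v : ℕ) (t : ℂ) : ℂ :=
  stringSum r t ^ (v / r) * stringSum (v % r) t

theorem pathSum_mul_add {t : ℂ} (h0 : t ≠ 0) (h1 : 1 - t ≠ 0)
    (h2 : 1 - 2 * t ≠ 0) {r : ℕ} (hr : 0 < r) (i j : ℕ) (hj : j ≤ r) :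
    pathSum r (r * i + j) t = stringSum r t ^ i * stringSum j t := by
  unfold pathSum
  rcases hj.eq_or_lt with rfl | hj
  · rw [← Nat.mul_succ, Nat.mul_div_cancel_left _ hr, Nat.mul_mod_right, stringSum_zero h0 h1 h2,
      pow_succ, mul_one]
  · rw [Nat.mul_add_div hr, Nat.div_eq_of_lt hj, add_zero, Nat.mul_add_mod, Nat.mod_eq_of_lt hj]

theorem pathSum_zero {t : ℂ} (h0 : t ≠ 0) (h1 : 1 - t ≠ 0)
    (h2 : 1 - 2 * t ≠ 0) {r : ℕ} (hr : 0 < r) : pathSum r 0 t = 1 := by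
  have := pathSum_mul_add h0 h1 h2 hr 0 0 hr.le
  simpa [stringSum_zero h0 h1 h2] using this

theorem pathSum_succ {t : ℂ} (h0 : t ≠ 0) (h1 : 1 - t ≠ 0)
    (h2 : 1 - 2 * t ≠ 0) {r : ℕ} (hr : 0 < r) {v : ℕ} (hv : r ∣ v) :
    t * (1 - t) * pathSum r (v + 1) t = pathSum r v t := by
  obtain ⟨i, rfl⟩ := hv
  rw [pathSum_mul_add h0 h1 h2 hr i 1 hr, ← add_zero (r * i),
    pathSum_mul_add h0 h1 h2 hr i 0 hr.le, stringSum_zero h0 h1 h2, mul_left_comm,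
    stringSum_one h0 h1 h2]

theorem pathSum_add_two {t : ℂ} (h0 : t ≠ 0) (h1 : 1 - t ≠ 0)
    (h2 : 1 - 2 * t ≠ 0) {r : ℕ} (hr : 0 < r) {v : ℕ} (hv : ¬ r ∣ v + 1) :
    t * (1 - t) * pathSum r (v + 2) t = pathSum r (v + 1) t - pathSum r v t := by
  have hlt : v % r + 1 < r := by
    by_contra! h
    have h3 := Nat.mod_lt v hr
    apply hv
    rw [← Nat.div_add_mod v r, add_assoc, show v % r + 1 = r by omega]
    exact ⟨v / r + 1, by ring⟩
  obtain ⟨i, j, hj, rfl⟩ : ∃ i j, j + 1 < r ∧ v = r * i + j :=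
    ⟨v / r, v % r, hlt, (Nat.div_add_mod v r).symm⟩
  rw [add_assoc, add_assoc, pathSum_mul_add h0 h1 h2 hr i _ (by omega),
    pathSum_mul_add h0 h1 h2 hr i _ (by omega), pathSum_mul_add h0 h1 h2 hr i _ (by omega),
    mul_left_comm, stringSum_add_two h0 h1]
  ring

/-- Strictly upper triangular matrices are nilpotent. -/
theorem pow_apply_eq_zero_of_strictUpper {n : ℕ} {M : Matrix (Fin n) (Fin n) ℂ}
    (hM : ∀ i j, j ≤ i → M i j = 0) (N : ℕ) (i j : Fin n) (h : (j : ℕ) < i + N) :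
    (M ^ N) i j = 0 := by
  induction N generalizing j with
  | zero =>
    rw [pow_zero, Matrix.one_apply_ne]
    rintro rfl
    omega
  | succ N ih =>
    rw [pow_succ, Matrix.mul_apply]
    refine Finset.sum_eq_zero fun l _ => ?_
    by_cases hl : (l : ℕ) < i + N
    · rw [ih l hl, zero_mul]
    · rw [hM l j (by rw [Fin.le_def]; omega), mul_zero]

/-- The matrix of the numbers of triangulations of the polygons `i, …, j`. -/
noncomputable def triMatrix (r n : ℕ) : Matrix (Fin n) (Fin n) ℂ :=
  fun i j => (triCount (SideFree r) i j : ℂ)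

/-- One step along the sides of a subdivided polygon: a side, or, with sign, a merged pair. -/
noncomputable def stepMatrix (r n : ℕ) : Matrix (Fin n) (Fin n) ℂ := fun i j =>
  if (j : ℕ) = i + 1 then 1 else if (j : ℕ) = i + 2 ∧ ¬ r ∣ (i : ℕ) + 1 then -1 else 0

theorem triCount_sideFree_pair {r i : ℕ} (hr : 0 < r) :
    triCount (SideFree r) i (i + 2) = if r ∣ i + 1 then 1 else 0 := by
  split_ifs with h
  · obtain ⟨c, hc⟩ := h
    have hp : SideFree r i (i + 2) := by
      rintro s ⟨h1, -, h3⟩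
      have e1 : s < c := lt_of_mul_lt_mul_right (by rw [mul_comm c r]; omega : s * r < c * r)
        (Nat.zero_le r)
      have e2 : c < s + 1 := lt_of_mul_lt_mul_right
        (by rw [mul_comm c r]; omega : c * r < (s + 1) * r) (Nat.zero_le r)
      omega
    rw [triCount_rec hp le_rfl, show Finset.Ioo i (i + 2) = {i + 1} by
      ext; simp only [Finset.mem_Ioo, Finset.mem_singleton]; omega, Finset.sum_singleton,
      triCount_succ (fun s hs => by omega), triCount_succ (fun s hs => by omega)]
  · refine triCount_of_not fun hp => hp (i / r) ⟨Nat.div_mul_le_self i r, le_rfl, ?_⟩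
    have h3 := Nat.mod_lt i hr
    have h4 := Nat.div_add_mod i r
    have h5 : i % r + 1 ≠ r := fun h5 => h ⟨i / r + 1, by rw [mul_add, mul_one]; omega⟩
    rw [add_mul, one_mul, mul_comm]; omega

/-- The entries of A = M − M² correct the recursion where it fails. A side has no apex, giving 1. A
forbidden chord over two sides has count 0 although its two parts glue once, giving −1. For a longer
forbidden chord every apex leaves a forbidden part, so both M and M² vanish there. -/
theorem triMatrix_eq {r : ℕ} (hr : 0 < r) (n : ℕ) :
    triMatrix r n = stepMatrix r n + triMatrix r n * triMatrix r n := by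
  ext i j
  have hsum : (triMatrix r n * triMatrix r n) i j =
      ((∑ l ∈ Finset.Ioo (i : ℕ) j,
        triCount (SideFree r) i l * triCount (SideFree r) l j : ℕ) : ℂ) := by
    rw [Matrix.mul_apply, Nat.cast_sum]
    have : ∑ l : Fin n, triMatrix r n i l * triMatrix r n l j = ∑ l ∈ Finset.range n,
        ((triCount (SideFree r) i l * triCount (SideFree r) l j : ℕ) : ℂ) := by
      rw [Finset.sum_range]
      simp [triMatrix]
    rw [this]
    symm
    refine Finset.sum_subset (fun l hl => ?_) (fun l _ hl => ?_)
    · rw [Finset.mem_Ioo] at hl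
      rw [Finset.mem_range]
      omega
    · rw [Finset.mem_Ioo, not_and_or, not_lt, not_lt] at hl
      rcases hl with hl | hl <;> simp [triCount_of_le hl]
  rw [Matrix.add_apply, hsum]
  simp only [triMatrix, stepMatrix]
  rcases (by omega : (j : ℕ) ≤ i ∨ (j : ℕ) = i + 1 ∨ (j : ℕ) = i + 2 ∨ (i : ℕ) + 3 ≤ j) with
    h | h | h | h
  · rw [if_neg (by omega), if_neg (by omega), triCount_of_le h, Finset.Ioo_eq_empty (by omega)]
    simp
  · rw [if_pos h, h, triCount_succ (fun s hs => by omega), show Finset.Ioo (i : ℕ) (i + 1) = ∅ by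
      ext; simp only [Finset.mem_Ioo, Finset.notMem_empty, iff_false]; omega]
    simp
  · rw [if_neg (by omega), h, triCount_sideFree_pair hr,
      show Finset.Ioo (i : ℕ) (i + 2) = {(i : ℕ) + 1} by
        ext; simp only [Finset.mem_Ioo, Finset.mem_singleton]; omega, Finset.sum_singleton,
      triCount_succ (fun s hs => by omega), triCount_succ (fun s hs => by omega)]
    by_cases hd : r ∣ (i : ℕ) + 1 <;> simp [hd]
  · rw [if_neg (by omega), if_neg (by omega), zero_add, Nat.cast_inj]
    by_cases hp : SideFree r i j
    · exact triCount_rec hp (by omega)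
    · rw [triCount_of_not hp]
      symm
      refine Finset.sum_eq_zero fun l hl => ?_
      rw [Finset.mem_Ioo] at hl
      unfold SideFree at hp
      push Not at hp
      obtain ⟨s, hs1, -, hs3⟩ := hp
      by_cases hl2 : (i : ℕ) + 2 ≤ l
      · rw [triCount_of_not fun h => h s ⟨hs1, hl2, by omega⟩, zero_mul]
      · rw [triCount_of_not (j := (j : ℕ)) fun h => h s ⟨by omega, by omega, hs3⟩, mul_zero]

/-- The sum `∑ N, L ^ N / t ^ (N + 1)`, the inverse of `t - L` for a nilpotent matrix `L`. -/
noncomputable def resolventSum {n : ℕ} (M : Matrix (Fin n) (Fin n) ℂ) (t : ℂ) :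
    Matrix (Fin n) (Fin n) ℂ := ∑ N ∈ Finset.range n, t⁻¹ ^ (N + 1) • M ^ N

theorem sub_mul_resolventSum {n : ℕ} {M : Matrix (Fin n) (Fin n) ℂ} (hM : M ^ n = 0) {t : ℂ}
    (ht : t ≠ 0) : (t • (1 : Matrix (Fin n) (Fin n) ℂ) - M) * resolventSum M t = 1 := by
  have h : ∀ N ∈ Finset.range n, (t • (1 : Matrix (Fin n) (Fin n) ℂ) - M) *
      (t⁻¹ ^ (N + 1) • M ^ N) = t⁻¹ ^ N • M ^ N - t⁻¹ ^ (N + 1) • M ^ (N + 1) := by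
    intro N _
    rw [sub_mul, smul_mul_smul_comm, one_mul, mul_smul_comm, ← pow_succ']
    congr 2
    rw [pow_succ]; field_simp
  rw [resolventSum, Finset.mul_sum, Finset.sum_congr rfl h, Finset.sum_range_sub', hM]
  simp

/-- With A = M − M², the matrix t(1−t) − A factors into commuting factors t − M and 1 − t − M, so
its inverse times 1 − 2t is a difference of two finite Neumann sums. The first row of the inverse is
known explicitly, which gives the left-hand side. -/
theorem pathSum_eq {r n : ℕ} (hr : 0 < r) {t : ℂ} (h0 : t ≠ 0) (h1 : 1 - t ≠ 0)
    (h2 : 1 - 2 * t ≠ 0) (v : Fin (n + 1)) :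
    (1 - 2 * t) * (pathSum r v t / (t * (1 - t))) = ∑ N ∈ Finset.range (n + 1),
      (t⁻¹ ^ (N + 1) - (1 - t)⁻¹ ^ (N + 1)) * (triMatrix r (n + 1) ^ N) 0 v := by
  set M := triMatrix r (n + 1) with hMdef
  set A := stepMatrix r (n + 1) with hA
  have hM : M ^ (n + 1) = 0 := by
    ext i j
    refine pow_apply_eq_zero_of_strictUpper (fun i j hij => ?_) _ _ _ (by omega)
    simp only [hMdef, triMatrix]
    rw [triCount_of_le (by exact hij), Nat.cast_zero]
  have hMA : A = M - M * M := by
    have := triMatrix_eq hr (n + 1)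
    rw [eq_sub_iff_add_eq]; exact this.symm
  let B : Matrix (Fin (n + 1)) (Fin (n + 1)) ℂ := (t * (1 - t)) • 1 - A
  have hB1 : B = (t • 1 - M) * ((1 - t) • 1 - M) := by
    simp only [B, hMA, sub_mul, mul_sub, one_mul, mul_smul_comm,
      smul_mul_assoc, mul_one, sub_smul, one_smul, mul_smul]
    module
  have hB2 : B = ((1 - t) • 1 - M) * (t • 1 - M) := by
    simp only [B, hMA, sub_mul, mul_sub, one_mul, mul_smul_comm,
      smul_mul_assoc, mul_one, sub_smul, one_smul, mul_smul, smul_sub]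
    module
  have hR : B * (resolventSum M t - resolventSum M (1 - t)) = (1 - 2 * t) • 1 := by
    rw [mul_sub]
    nth_rewrite 1 [hB2]
    rw [hB1, mul_assoc, mul_assoc, sub_mul_resolventSum hM h0, sub_mul_resolventSum hM h1, mul_one,
      mul_one, sub_sub_sub_cancel_right, ← sub_smul]
    congr 1; ring
  let R : Fin (n + 1) → ℂ := fun v => pathSum r v t / (t * (1 - t))
  have hz : t * (1 - t) ≠ 0 := mul_ne_zero h0 h1
  -- Column by column this is the recurrence for `pathSum`: the initial value at 0, and then the
  -- two-term rule inside a string or the one-term rule just after a corner.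
  have hRB : Matrix.vecMul R B = Pi.single 0 1 := by
    ext v
    have e1 : Matrix.vecMul R B v = t * (1 - t) * R v - ∑ l, R l * A l v := by
      simp only [B, Matrix.vecMul_sub, Pi.sub_apply, Matrix.vecMul_smul, Matrix.vecMul_one,
        Pi.smul_apply, smul_eq_mul]
      rfl
    have e2 : ∑ l, R l * A l v = ∑ l ∈ Finset.range (n + 1), pathSum r l t / (t * (1 - t)) *
        (if (v : ℕ) = l + 1 then 1 else if (v : ℕ) = l + 2 ∧ ¬ r ∣ l + 1 then -1 else 0) := by
      rw [Finset.sum_range]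
      rfl
    rw [e1, e2]
    have hR' : t * (1 - t) * R v = pathSum r v t := by
      simp only [R]; field_simp
    rw [hR']
    obtain ⟨v, hv⟩ := v
    simp only
    rcases v with _ | _ | v
    · rw [pathSum_zero h0 h1 h2 hr, Finset.sum_eq_zero fun l _ => by
        rw [if_neg (by omega), if_neg (by omega), mul_zero]]
      simp
    · rw [Finset.sum_eq_single_of_mem 0 (by simp)
        fun l _ hl => by rw [if_neg (by omega), if_neg (by omega), mul_zero]]
      rw [if_pos rfl, ← pathSum_succ h0 h1 h2 hr (dvd_zero r)]
      rw [Pi.single_eq_of_ne (by simp [Fin.ext_iff])]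
      field_simp
      simp
    · have hsub : ({v, v + 1} : Finset ℕ) ⊆ Finset.range (n + 1) := by
        intro l hl
        simp only [Finset.mem_insert, Finset.mem_singleton] at hl
        rw [Finset.mem_range]; omega
      rw [← Finset.sum_subset hsub fun l _ hl => by
        simp only [Finset.mem_insert, Finset.mem_singleton, not_or] at hl
        rw [if_neg (by omega), if_neg (by omega), mul_zero]]
      rw [Finset.sum_pair (by omega), if_neg (by omega), if_pos rfl,
        Pi.single_eq_of_ne (by simp [Fin.ext_iff])]
      by_cases hd : r ∣ v + 1
      · have := pathSum_succ h0 h1 h2 hr hd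
        simp only [hd, not_true_eq_false, and_false, if_false]
        rw [← this]
        field_simp
        simp
      · have := pathSum_add_two h0 h1 h2 hr hd
        simp only [hd, not_false_eq_true, and_self, if_true]
        have e3 : pathSum r (v + 1 + 1) t =
          (pathSum r (v + 1) t - pathSum r v t) / (t * (1 - t)) := by
          rw [eq_div_iff hz, ← this]; ring
        rw [e3]; ring
  have key : Matrix.vecMul R (B * (resolventSum M t - resolventSum M (1 - t))) v =
      (resolventSum M t - resolventSum M (1 - t)) 0 v := by
    rw [← Matrix.vecMul_vecMul, hRB, Matrix.single_one_vecMul]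
    rfl
  rw [hR, Matrix.vecMul_smul, Matrix.vecMul_one] at key
  simp only [Pi.smul_apply, smul_eq_mul, R] at key
  rw [key, resolventSum, resolventSum, ← Finset.sum_sub_distrib]
  simp only [← sub_smul]
  rw [Matrix.sum_apply]
  simp only [Matrix.smul_apply, smul_eq_mul]

/-! ### Contour integrals for the counts -/

/-- The normalized contour integral over the circle of radius `ε` about `0`. -/
noncomputable def contour (ε : ℝ) (f : ℂ → ℂ) : ℂ :=
  (2 * Real.pi * Complex.I)⁻¹ * ∮ z in C(0, ε), f z

section
variable {ε : ℝ} {f g : ℂ → ℂ}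

theorem contour_congr (hε : 0 ≤ ε) (h : ∀ z, ‖z‖ = ε → f z = g z) :
    contour ε f = contour ε g := by
  rw [contour, contour, circleIntegral.integral_congr hε fun z hz => h z (by simpa using hz)]

theorem contour_sub (hf : CircleIntegrable f 0 ε) (hg : CircleIntegrable g 0 ε) :
    contour ε (fun z => f z - g z) = contour ε f - contour ε g := by
  simp only [contour]
  rw [circleIntegral.integral_sub hf hg, mul_sub]

theorem contour_const_mul (a : ℂ) : contour ε (fun z => a * f z) = a * contour ε f := by
  simp only [contour]
  rw [circleIntegral.integral_const_mul]
  ring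

theorem contour_sum {ι : Type*} {s : Finset ι} {F : ι → ℂ → ℂ}
    (h : ∀ i ∈ s, CircleIntegrable (F i) 0 ε) :
    contour ε (fun z => ∑ i ∈ s, F i z) = ∑ i ∈ s, contour ε (F i) := by
  simp only [contour]
  rw [circleIntegral.integral_fun_sum h, Finset.mul_sum]

theorem contour_eq_zero (hε : 0 ≤ ε) (h : ∀ z, ‖z‖ ≤ ε → DifferentiableAt ℂ f z) :
    contour ε f = 0 := by
  rw [contour, Complex.circleIntegral_eq_zero_of_differentiable_on_off_countable hε
    Set.countable_empty, mul_zero]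
  · exact fun z hz => (h z (by simpa using hz)).continuousAt.continuousWithinAt
  · exact fun z hz => h z (by have := hz.1; simp at this; exact this.le)

theorem contour_inv (hε : ε ≠ 0) : contour ε (fun z => z⁻¹) = 1 := by
  have h := circleIntegral.integral_sub_center_inv (0 : ℂ) hε
  simp only [sub_zero] at h
  rw [contour, h]
  exact inv_mul_cancel₀ Complex.two_pi_I_ne_zero

theorem contour_of_hasDerivAt (hε : 0 ≤ ε) (F : ℂ → ℂ)
    (h : ∀ z, ‖z‖ = ε → HasDerivAt F (f z) z) : contour ε f = 0 := by
  rw [contour, circleIntegral.integral_eq_zero_of_hasDerivWithinAt (f := F) hε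
    (fun z hz => (h z (by simpa using hz)).hasDerivWithinAt), mul_zero]

theorem circleIntegrable_of_differentiableAt (hε : 0 ≤ ε)
    (h : ∀ z, ‖z‖ = ε → DifferentiableAt ℂ f z) : CircleIntegrable f 0 ε :=
  ContinuousOn.circleIntegrable hε fun z hz =>
    (h z (by simpa using hz)).continuousAt.continuousWithinAt

end

theorem one_sub_ne_zero_of_norm {z : ℂ} (h : ‖z‖ < 1 / 2) : 1 - z ≠ 0 := by
  intro h'
  rw [← sub_eq_zero.1 h', norm_one] at h
  norm_num at h

theorem one_sub_two_mul_ne_zero_of_norm {z : ℂ} (h : ‖z‖ < 1 / 2) : 1 - 2 * z ≠ 0 := by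
  intro h'
  have : ‖2 * z‖ = 1 := by rw [← sub_eq_zero.1 h', norm_one]
  rw [norm_mul, Complex.norm_two] at this
  linarith

theorem ne_zero_of_norm_eq {ε : ℝ} (hε : 0 < ε) {z : ℂ} (hz : ‖z‖ = ε) : z ≠ 0 := by
  rintro rfl
  simp at hz
  linarith

theorem contour_mul_inv_pow {ε : ℝ} (hε : 0 < ε) (N : ℕ) :
    contour ε (fun z => z * z⁻¹ ^ (N + 1)) = if N = 1 then 1 else 0 := by
  rcases N with _ | _ | N
  · rw [if_neg (by norm_num), contour_congr (g := fun _ => 1) hε.le]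
    · exact contour_eq_zero hε.le fun z _ => by fun_prop
    · intro z hz
      have := ne_zero_of_norm_eq hε hz
      simp [this]
  · rw [if_pos rfl, contour_congr (g := fun z => z⁻¹) hε.le]
    · exact contour_inv hε.ne'
    · intro z hz
      have := ne_zero_of_norm_eq hε hz
      rw [pow_two, mul_inv_cancel_left₀ this]
  · rw [if_neg (by omega)]
    refine contour_of_hasDerivAt hε.le (fun z => -(N + 1 : ℂ)⁻¹ * z⁻¹ ^ (N + 1)) fun z hz => ?_
    have hz0 := ne_zero_of_norm_eq hε hz
    have hN : (N : ℂ) + 1 ≠ 0 := by exact_mod_cast N.succ_ne_zero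
    refine (((hasDerivAt_inv hz0).fun_pow (N + 1)).const_mul (-(N + 1 : ℂ)⁻¹)).congr_deriv ?_
    have h3 := mul_inv_cancel₀ hz0
    have h4 := inv_mul_cancel₀ hN
    rw [← inv_pow z 2, Nat.add_sub_cancel]
    push_cast
    linear_combination (z⁻¹ ^ N * z⁻¹ ^ 2) * h4 - (z⁻¹ ^ N * z⁻¹ ^ 2) * h3

theorem contour_mul_one_sub_inv_pow {ε : ℝ} (hε : 0 < ε) (hε2 : ε < 1 / 2)
    (N : ℕ) :
    contour ε (fun z => z * (1 - z)⁻¹ ^ N) = 0 := by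
  refine contour_eq_zero hε.le fun z hz => ?_
  have := one_sub_ne_zero_of_norm (hz.trans_lt hε2)
  fun_prop (disch := assumption)

theorem differentiableAt_stringSum {ε : ℝ} (hε : 0 < ε) (hε2 : ε < 1 / 2)
    (r : ℕ) {z : ℂ} (hz : ‖z‖ = ε) :
    DifferentiableAt ℂ (stringSum r) z := by
  have h0 := ne_zero_of_norm_eq hε hz
  have h1 := one_sub_ne_zero_of_norm (hz.trans_lt hε2)
  have h2 := one_sub_two_mul_ne_zero_of_norm (hz.trans_lt hε2)
  unfold stringSum
  fun_prop (disch := assumption)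

/-- After multiplication by z the terms in 1/z have residue only at N = 1, where the matrix power is
M itself; the terms in 1/(1 − z) are holomorphic in the disc. -/
theorem contour_pathSum {ε : ℝ} (hε : 0 < ε) (hε2 : ε < 1 / 2)
    {r : ℕ} (hr : 0 < r) (v : ℕ) :
    contour ε (fun z => z * ((1 - 2 * z) * (pathSum r v z / (z * (1 - z))))) =
      triCount (SideFree r) 0 v := by
  -- The matrix has size v + 2, one more than needed to contain the index v, so that N = 1 occurs in
  -- the sum also when v = 0.
  have key : ∀ z, ‖z‖ = ε → z * ((1 - 2 * z) * (pathSum r v z / (z * (1 - z)))) =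
      ∑ N ∈ Finset.range (v + 1 + 1), (triMatrix r (v + 1 + 1) ^ N) 0 ⟨v, by omega⟩ *
        (z * z⁻¹ ^ (N + 1) - z * (1 - z)⁻¹ ^ (N + 1)) := by
    intro z hz
    have h0 := ne_zero_of_norm_eq hε hz
    have h1 := one_sub_ne_zero_of_norm (hz.trans_lt hε2)
    have h2 := one_sub_two_mul_ne_zero_of_norm (hz.trans_lt hε2)
    have := pathSum_eq (n := v + 1) hr h0 h1 h2 ⟨v, by omega⟩
    simp only at this
    rw [this, Finset.mul_sum]
    exact Finset.sum_congr rfl fun N _ => by ring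
  have i1 : ∀ N, CircleIntegrable (fun z : ℂ => z * z⁻¹ ^ (N + 1)) 0 ε := fun N =>
    circleIntegrable_of_differentiableAt hε.le fun z hz => by
      have h0 := ne_zero_of_norm_eq hε hz
      fun_prop (disch := assumption)
  have i2 : ∀ N, CircleIntegrable (fun z : ℂ => z * (1 - z)⁻¹ ^ (N + 1)) 0 ε := fun N =>
    circleIntegrable_of_differentiableAt hε.le fun z hz => by
      have h1 := one_sub_ne_zero_of_norm (hz.trans_lt hε2)
      fun_prop (disch := assumption)
  rw [contour_congr hε.le key, contour_sum fun N _ => ?_]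
  · rw [Finset.sum_congr rfl fun N _ => by
      rw [contour_const_mul, contour_sub (i1 N) (i2 N), contour_mul_inv_pow hε,
        contour_mul_one_sub_inv_pow hε hε2, sub_zero]]
    rw [Finset.sum_eq_single_of_mem 1 (by simp) fun N _ hN => by rw [if_neg hN, mul_zero]]
    simp [triMatrix]
  · exact ((i1 N).sub (i2 N)).const_smul (a := (triMatrix r (v + 1 + 1) ^ N) 0 ⟨v, by omega⟩)

/-- With kr = n + 2, the difference of counts at n + 1 and n is one step of the recurrence for
`pathSum`, and it cancels the denominator t(1−t). When r = 1 there is no subtraction, and the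
one-term rule at a corner does the same. At kr all strings are complete, which leaves a pure k-th
power. -/
theorem tr_eq_contour {ε : ℝ} (hε : 0 < ε) (hε2 : ε < 1 / 2)
    {k r : ℕ} (hk : 2 ≤ k) (hr : 0 < r) :
    (tr k r : ℂ) = contour ε (fun z => z * ((1 - 2 * z) * stringSum r z ^ k)) := by
  have hn : 2 ≤ k * r := by
    have := Nat.mul_le_mul hk hr
    omega
  obtain ⟨n, hn'⟩ : ∃ n, k * r = n + 2 := ⟨k * r - 2, by omega⟩
  have htr := tr_add_eq hk hr
  rw [hn', Nat.add_sub_cancel, show n + 2 - 1 = n + 1 by omega] at htr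
  have hpath : ∀ z, ‖z‖ = ε → pathSum r (n + 2) z = stringSum r z ^ k := fun z hz => by
    have h0 := ne_zero_of_norm_eq hε hz
    have h1 := one_sub_ne_zero_of_norm (hz.trans_lt hε2)
    have h2 := one_sub_two_mul_ne_zero_of_norm (hz.trans_lt hε2)
    have := pathSum_mul_add h0 h1 h2 hr k 0 hr.le
    rwa [add_zero, mul_comm r k, hn', stringSum_zero h0 h1 h2, mul_one] at this
  have hint : ∀ v, CircleIntegrable
      (fun z => z * ((1 - 2 * z) * (pathSum r v z / (z * (1 - z))))) 0 ε := fun v =>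
    circleIntegrable_of_differentiableAt hε.le fun z hz => by
      have h0 := ne_zero_of_norm_eq hε hz
      have h1 := one_sub_ne_zero_of_norm (hz.trans_lt hε2)
      have h3 := differentiableAt_stringSum hε hε2 r hz
      have h4 := differentiableAt_stringSum hε hε2 (v % r) hz
      have h5 : z * (1 - z) ≠ 0 := mul_ne_zero h0 h1
      unfold pathSum
      fun_prop (disch := assumption)
  split_ifs at htr with h1
  · subst h1
    rw [add_zero] at htr
    rw [htr, ← contour_pathSum hε hε2 one_pos]
    refine contour_congr hε.le fun z hz => ?_
    have h0 := ne_zero_of_norm_eq hε hz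
    have h1 := one_sub_ne_zero_of_norm (hz.trans_lt hε2)
    have h2 := one_sub_two_mul_ne_zero_of_norm (hz.trans_lt hε2)
    rw [← hpath z hz, ← pathSum_succ h0 h1 h2 one_pos (one_dvd (n + 1))]
    field_simp
  · have htr' : (tr k r : ℂ) = triCount (SideFree r) 0 (n + 1) - triCount (SideFree r) 0 n := by
      rw [← htr]; push_cast; ring
    rw [htr', ← contour_pathSum hε hε2 hr, ← contour_pathSum hε hε2 hr,
      ← contour_sub (hint _) (hint _)]
    refine contour_congr hε.le fun z hz => ?_
    have h0 := ne_zero_of_norm_eq hε hz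
    have h1' := one_sub_ne_zero_of_norm (hz.trans_lt hε2)
    have h2 := one_sub_two_mul_ne_zero_of_norm (hz.trans_lt hε2)
    have hd : ¬ r ∣ n + 1 := fun hd => by
      have h3 : r ∣ n + 1 + 1 := by rw [← hn']; exact dvd_mul_left r k
      exact h1 (Nat.dvd_one.1 ((Nat.dvd_add_right hd).1 h3))
    have := pathSum_add_two h0 h1' h2 hr hd
    rw [← hpath z hz, ← mul_sub, ← mul_sub, ← sub_div, ← this]
    field_simp

/-- The recurrence keeps the sums polynomial in w = 1/(t(1−t)). The second clause, divisibility by w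
from index 1 on, is carried along for use in the primitive of `contour_stringSum_pow`. -/
theorem stringSum_eq_eval (j : ℕ) :
    (∃ P : Polynomial ℂ, ∀ t : ℂ, t ≠ 0 → 1 - t ≠ 0 → 1 - 2 * t ≠ 0 →
      stringSum j t = P.eval (t * (1 - t))⁻¹) ∧
    ∃ P : Polynomial ℂ, ∀ t : ℂ, t ≠ 0 → 1 - t ≠ 0 → 1 - 2 * t ≠ 0 →
      stringSum (j + 1) t = (t * (1 - t))⁻¹ * P.eval (t * (1 - t))⁻¹ := by
  induction j with
  | zero =>
    refine ⟨⟨1, fun t h0 h1 h2 => by rw [stringSum_zero h0 h1 h2, Polynomial.eval_one]⟩,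
      ⟨1, fun t h0 h1 h2 => ?_⟩⟩
    rw [Polynomial.eval_one, mul_one]
    exact eq_inv_of_mul_eq_one_right (stringSum_one h0 h1 h2)
  | succ j ih =>
    obtain ⟨⟨P, hP⟩, Q, hQ⟩ := ih
    refine ⟨⟨Polynomial.X * Q, fun t h0 h1 h2 => by
      rw [hQ t h0 h1 h2, Polynomial.eval_mul, Polynomial.eval_X]⟩,
      ⟨Polynomial.X * Q - P, fun t h0 h1 h2 => ?_⟩⟩
    rw [Polynomial.eval_sub, Polynomial.eval_mul, Polynomial.eval_X, ← hQ t h0 h1 h2,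
      ← hP t h0 h1 h2, ← stringSum_add_two h0 h1,
      inv_mul_cancel_left₀ (mul_ne_zero h0 h1)]

/-- With w = 1/(z(1−z)) one has dw/dz = −(1−2z)w². Since k ≥ 2 and r ≥ 1, the integrand is (1−2z)
times a polynomial in w divisible by w², so it has a primitive that is a polynomial in w. -/
theorem contour_stringSum_pow {ε : ℝ} (hε : 0 < ε) (hε2 : ε < 1 / 2)
    {k r : ℕ} (hk : 2 ≤ k) (hr : 0 < r) :
    contour ε (fun z => (1 - 2 * z) * stringSum r z ^ k) = 0 := by
  obtain ⟨r, rfl⟩ : ∃ s, r = s + 1 := ⟨r - 1, by omega⟩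
  obtain ⟨k, rfl⟩ : ∃ l, k = l + 2 := ⟨k - 2, by omega⟩
  obtain ⟨-, P, hP⟩ := stringSum_eq_eval r
  set G := Polynomial.X ^ k * P ^ (k + 2)
  have key : ∀ z, ‖z‖ = ε → (1 - 2 * z) * stringSum (r + 1) z ^ (k + 2) =
      ∑ i ∈ Finset.range (G.natDegree + 1),
        G.coeff i * ((1 - 2 * z) * (z * (1 - z))⁻¹ ^ (i + 2)) := by
    intro z hz
    have h0 := ne_zero_of_norm_eq hε hz
    have h1 := one_sub_ne_zero_of_norm (hz.trans_lt hε2)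
    have h2 := one_sub_two_mul_ne_zero_of_norm (hz.trans_lt hε2)
    have : stringSum (r + 1) z ^ (k + 2) = (z * (1 - z))⁻¹ ^ 2 * G.eval (z * (1 - z))⁻¹ := by
      rw [hP z h0 h1 h2]
      simp only [G, Polynomial.eval_mul, Polynomial.eval_pow, Polynomial.eval_X]
      ring
    rw [this, Polynomial.eval_eq_sum_range, Finset.mul_sum, Finset.mul_sum]
    exact Finset.sum_congr rfl fun i _ => by ring
  rw [contour_congr hε.le key, contour_sum fun i _ => ?_]
  · refine Finset.sum_eq_zero fun i _ => ?_
    rw [contour_const_mul, contour_of_hasDerivAt hε.le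
      (fun z => -(i + 1 : ℂ)⁻¹ * (z * (1 - z))⁻¹ ^ (i + 1)), mul_zero]
    intro z hz
    have h0 := ne_zero_of_norm_eq hε hz
    have h1 := one_sub_ne_zero_of_norm (hz.trans_lt hε2)
    have hz' : z * (1 - z) ≠ 0 := mul_ne_zero h0 h1
    have hi : (i : ℂ) + 1 ≠ 0 := by exact_mod_cast i.succ_ne_zero
    have hd : HasDerivAt (fun z : ℂ => z * (1 - z)) (1 - 2 * z) z := by
      refine ((hasDerivAt_id' z).fun_mul ((hasDerivAt_id' z).const_sub 1)).congr_deriv ?_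
      ring
    refine (((hd.fun_inv hz').fun_pow (i + 1)).const_mul (-(i + 1 : ℂ)⁻¹)).congr_deriv ?_
    have h4 := inv_mul_cancel₀ hi
    rw [Nat.add_sub_cancel, div_eq_mul_inv, ← inv_pow _ 2]
    push_cast
    linear_combination ((z * (1 - z))⁻¹ ^ i * (z * (1 - z))⁻¹ ^ 2 * (1 - 2 * z)) * h4

  · refine circleIntegrable_of_differentiableAt hε.le fun z hz => ?_
    have h0 := ne_zero_of_norm_eq hε hz
    have h1 := one_sub_ne_zero_of_norm (hz.trans_lt hε2)
    have hz' : z * (1 - z) ≠ 0 := mul_ne_zero h0 h1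
    fun_prop (disch := assumption)

/-! ### Binomial expansion of the integrand -/

/-- The density whose contour integrals against powers of `1 / (t ^ (k - j) * (1 - t) ^ j)` give
the numbers of triangulations. -/
noncomputable def density (k j : ℕ) (t : ℂ) : ℂ := t ^ j * (1 - t) ^ (k - j) / (1 - 2 * t) ^ (k - 2)

/-- The polynomial `t ^ (k - j) * (1 - t) ^ j`. -/
noncomputable def branchFun (k j : ℕ) (t : ℂ) : ℂ := t ^ (k - j) * (1 - t) ^ j

theorem stringSum_pow_eq {k r : ℕ} (hk : 2 ≤ k) {t : ℂ} (h0 : t ≠ 0) (h1 : 1 - t ≠ 0)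
    (h2 : 1 - 2 * t ≠ 0) :
    (1 - 2 * t) ^ 2 * stringSum r t ^ k = ∑ j ∈ Finset.range (k + 1),
      (-1) ^ j * (k.choose j : ℂ) * (density k j t * (branchFun k j t)⁻¹ ^ r) := by
  rw [stringSum, mul_pow, sub_eq_neg_add (t⁻¹ ^ (r + 1)), add_pow, Finset.mul_sum, Finset.mul_sum]
  refine Finset.sum_congr rfl fun j hj => ?_
  rw [Finset.mem_range] at hj
  obtain ⟨m, rfl⟩ : ∃ m, k = j + m := ⟨k - j, by omega⟩
  have e : (1 - 2 * t) ^ 2 * (t * (1 - t) / (1 - 2 * t)) ^ (j + m) =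
      (t * (1 - t)) ^ (j + m) / (1 - 2 * t) ^ (j + m - 2) := by
    obtain ⟨l, hl⟩ : ∃ l, j + m = l + 2 := ⟨j + m - 2, by omega⟩
    rw [hl, Nat.add_sub_cancel, div_pow, pow_add (1 - 2 * t)]
    field_simp
  rw [← mul_assoc, e, density, branchFun, Nat.add_sub_cancel_left]
  have ea : t⁻¹ ^ (r + 1) = t⁻¹ * t⁻¹ ^ r := by ring
  have eb : (1 - t)⁻¹ ^ (r + 1) = (1 - t)⁻¹ * (1 - t)⁻¹ ^ r := by ring
  rw [neg_pow, ea, eb, mul_inv, mul_pow t, ← inv_pow t, ← inv_pow (1 - t), mul_pow (t⁻¹ ^ m),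
    pow_right_comm t⁻¹ m, pow_right_comm (1 - t)⁻¹ j, pow_add t, pow_add (1 - t)]
  have ha : t ^ m * t⁻¹ ^ m = 1 := by rw [← mul_pow, mul_inv_cancel₀ h0, one_pow]
  have hb : (1 - t) ^ j * (1 - t)⁻¹ ^ j = 1 := by rw [← mul_pow, mul_inv_cancel₀ h1, one_pow]
  rw [mul_pow, mul_pow]
  rw [div_eq_mul_inv, div_eq_mul_inv]
  linear_combination (((1 - 2 * t) ^ (j + m - 2))⁻¹ * (-1) ^ j * ((j + m).choose j : ℂ) * t ^ j *
    (1 - t) ^ m * (t⁻¹ ^ r) ^ m * ((1 - t)⁻¹ ^ r) ^ j) *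
    (ha * ((1 - t) ^ j * (1 - t)⁻¹ ^ j) + hb)

/-- Write (1−2z)² = (1−2z) − 2z(1−2z). The first part integrates to 0 and the second to −2 tr(k,r),
whence the factor −1/2; the square is what makes the expanded densities have denominator
(1−2z)^(k−2). -/
theorem tr_eq_sum_contour {ε : ℝ} (hε : 0 < ε) (hε2 : ε < 1 / 2) {k r : ℕ} (hk : 2 ≤ k)
    (hr : 0 < r) :
    (tr k r : ℂ) = -(1 / 2) * ∑ j ∈ Finset.range (k + 1), (-1) ^ j * (k.choose j : ℂ) *
      contour ε (fun t => density k j t * (branchFun k j t)⁻¹ ^ r) := by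
  have i1 : CircleIntegrable (fun z => (1 - 2 * z) * stringSum r z ^ k) 0 ε :=
    circleIntegrable_of_differentiableAt hε.le fun z hz => by
      have := differentiableAt_stringSum hε hε2 r hz
      fun_prop
  have i2 : CircleIntegrable (fun z => z * ((1 - 2 * z) * stringSum r z ^ k)) 0 ε :=
    circleIntegrable_of_differentiableAt hε.le fun z hz => by
      have := differentiableAt_stringSum hε hε2 r hz
      fun_prop
  have i3 : ∀ j, CircleIntegrable (fun t => (-1) ^ j * (k.choose j : ℂ) *
      (density k j t * (branchFun k j t)⁻¹ ^ r)) 0 ε := fun j =>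
    circleIntegrable_of_differentiableAt hε.le fun z hz => by
      have h0 := ne_zero_of_norm_eq hε hz
      have h1 := one_sub_ne_zero_of_norm (hz.trans_lt hε2)
      have h2 := one_sub_two_mul_ne_zero_of_norm (hz.trans_lt hε2)
      have h3 : (1 - 2 * z) ^ (k - 2) ≠ 0 := pow_ne_zero _ h2
      have h4 : z ^ (k - j) * (1 - z) ^ j ≠ 0 := mul_ne_zero (pow_ne_zero _ h0) (pow_ne_zero _ h1)
      unfold density branchFun
      fun_prop (disch := assumption)
  have h1 : contour ε (fun z => (1 - 2 * z) ^ 2 * stringSum r z ^ k) = -2 * tr k r := by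
    have : contour ε (fun z => (1 - 2 * z) ^ 2 * stringSum r z ^ k) =
        contour ε (fun z => (1 - 2 * z) * stringSum r z ^ k -
          2 * (z * ((1 - 2 * z) * stringSum r z ^ k))) :=
      contour_congr hε.le fun z _ => by ring
    have h : CircleIntegrable (fun z => 2 * (z * ((1 - 2 * z) * stringSum r z ^ k))) 0 ε :=
      i2.const_smul (a := (2 : ℂ))
    rw [this, contour_sub i1 h, contour_stringSum_pow hε hε2 hk hr,
      contour_const_mul, ← tr_eq_contour hε hε2 hk hr]
    ring
  have h2 : contour ε (fun z => (1 - 2 * z) ^ 2 * stringSum r z ^ k) =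
      ∑ j ∈ Finset.range (k + 1), (-1) ^ j * (k.choose j : ℂ) *
        contour ε (fun t => density k j t * (branchFun k j t)⁻¹ ^ r) := by
    rw [contour_congr hε.le fun z hz => stringSum_pow_eq hk (ne_zero_of_norm_eq hε hz)
      (one_sub_ne_zero_of_norm (hz.trans_lt hε2))
      (one_sub_two_mul_ne_zero_of_norm (hz.trans_lt hε2)), contour_sum fun j _ => i3 j]
    exact Finset.sum_congr rfl fun j _ => contour_const_mul _
  rw [← h2, h1]
  ring

/-! ### Existence and completeness of the small zeros -/

theorem Qpoly_eval (k j : ℕ) (x t : ℂ) : (Qpoly k j x).eval t = branchFun k j t - x := by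
  simp [Qpoly, branchFun]

theorem isRoot_Qpoly_iff {k j : ℕ} {x t : ℂ} : (Qpoly k j x).IsRoot t ↔ branchFun k j t = x := by
  rw [Polynomial.IsRoot, Qpoly_eval, sub_eq_zero]

/-- A local coordinate `h` at `0` whose `m`-th power is `t ^ m * (1 - t) ^ j`, with its inverse. -/
theorem exists_local_root {m : ℕ} (hm : m ≠ 0) (j : ℕ) : ∃ h g : ℂ → ℂ,
    (∀ᶠ t in 𝓝 0, h t ^ m = t ^ m * (1 - t) ^ j) ∧ Tendsto h (𝓝 0) (𝓝 0) ∧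
    Tendsto g (𝓝 0) (𝓝 0) ∧ (∀ᶠ t in 𝓝 0, g (h t) = t) ∧ ∀ᶠ w in 𝓝 0, h (g w) = w := by
  let h : ℂ → ℂ := fun t => t * (1 - t) ^ ((j : ℂ) / m)
  have h0 : h 0 = 0 := by simp [h]
  have hm' : (m : ℂ) ≠ 0 := by exact_mod_cast hm
  have hd : HasStrictDerivAt h 1 0 := by
    have h1 : HasStrictDerivAt (fun t : ℂ => 1 - t) (-1) 0 := (hasStrictDerivAt_id 0).const_sub 1
    have h2 := h1.cpow_const (c := (j : ℂ) / m) (by simp)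
    refine ((hasStrictDerivAt_id (0 : ℂ)).mul h2).congr_deriv ?_
    simp
  have hr := hd.eventually_right_inverse (one_ne_zero)
  have hl := hd.eventually_left_inverse (one_ne_zero)
  have hg := (HasStrictDerivAt.hasDerivAt (hd.to_localInverse one_ne_zero)).continuousAt
  have hg0 : hd.localInverse h 1 0 one_ne_zero (h 0) = 0 := hl.self_of_nhds
  rw [h0] at hr hg hg0
  refine ⟨h, hd.localInverse h 1 0 one_ne_zero, Eventually.of_forall fun t => ?_, ?_, ?_, hl, hr⟩
  · simp only [h]
    rw [mul_pow, ← Complex.cpow_nat_mul, mul_div_cancel₀ _ hm', Complex.cpow_natCast]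
  · have := (HasStrictDerivAt.hasDerivAt hd).continuousAt.tendsto
    rwa [h0] at this
  · have := hg.tendsto
    rwa [hg0] at this

theorem tendsto_cpow_inv {m : ℕ} (hm : m ≠ 0) (a : ℂ) :
    Tendsto (fun x : ℂ => a * x ^ ((m : ℂ)⁻¹)) (𝓝[≠] 0) (𝓝 0) := by
  have hre : 0 < ((m : ℂ)⁻¹).re := by
    rw [← Complex.ofReal_natCast, ← Complex.ofReal_inv, Complex.ofReal_re]
    positivity
  have h := (Complex.continuousAt_cpow_const_of_re_pos (z := 0) (w := (m : ℂ)⁻¹)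
    (Or.inl le_rfl) hre).tendsto
  rw [Complex.zero_cpow (by simpa using hm)] at h
  simpa using (h.const_mul a).mono_left (nhdsWithin_le_nhds (s := {0}ᶜ))

/-- The local branches of the zeros of `t ^ (k - j) * (1 - t) ^ j = x`. -/
theorem exists_branches {k j : ℕ} (hj : j < k) : ∃ t : Fin (k - j) → ℂ → ℂ,
    (∀ i, IsSmallZero k j (t i)) ∧
    (∀ᶠ x in 𝓝[≠] (0 : ℂ), Function.Injective fun i => t i x) ∧
    ∀ᶠ δ in 𝓝[>] (0 : ℝ), ∀ x : ℂ, x ≠ 0 → ∀ z, ‖z‖ ≤ δ → branchFun k j z = x →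
      ∃ i, z = t i x := by
  obtain ⟨h, g, hpow, hh, hg, hgh, hhg⟩ := exists_local_root (m := k - j) (by omega) j
  set m := k - j
  have hm : m ≠ 0 := by omega
  have hm0 : NeZero m := ⟨hm⟩
  let ζ := Complex.exp (2 * Real.pi * Complex.I / m)
  have hζ : IsPrimitiveRoot ζ m := Complex.isPrimitiveRoot_exp m hm
  let w : Fin m → ℂ → ℂ := fun i x => ζ ^ (i : ℕ) * x ^ ((m : ℂ)⁻¹)
  have hw : ∀ i, Tendsto (w i) (𝓝[≠] 0) (𝓝 0) := fun i => tendsto_cpow_inv hm _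
  have hwpow : ∀ i x, w i x ^ m = x := fun i x => by
    simp only [w]
    rw [mul_pow, ← pow_mul, mul_comm (i : ℕ), pow_mul, hζ.pow_eq_one, one_pow, one_mul,
      Complex.cpow_nat_inv_pow x hm]
  refine ⟨fun i x => g (w i x), fun i => ⟨?_, hg.comp (hw i)⟩, ?_, ?_⟩
  · filter_upwards [(hw i).eventually hhg, (hg.comp (hw i)).eventually hpow] with x hx1 hx2
    simp only [Function.comp_apply] at hx2
    rw [isRoot_Qpoly_iff, branchFun, ← hx2, hx1, hwpow]
  · filter_upwards [eventually_all.2 fun i => (hw i).eventually hhg, self_mem_nhdsWithin]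
      with x hx1 hx0 i i' hii
    simp only at hii
    have hwi : w i x = w i' x := by rw [← hx1 i, ← hx1 i', hii]
    have hx : x ^ ((m : ℂ)⁻¹) ≠ 0 := by
      intro h0
      have := Complex.cpow_nat_inv_pow x hm
      rw [h0, zero_pow hm] at this
      exact hx0 this.symm
    exact Fin.ext (hζ.pow_inj i.2 i'.2 (mul_right_cancel₀ hx hwi))
  · have hball : ∀ {p : ℂ → Prop}, (∀ᶠ z in 𝓝 0, p z) →
        ∀ᶠ δ in 𝓝[>] (0 : ℝ), ∀ z, ‖z‖ ≤ δ → p z := by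
      intro p hp
      obtain ⟨ε, hε, hp⟩ := Metric.eventually_nhds_iff.1 hp
      filter_upwards [Ioo_mem_nhdsGT hε] with δ hδ z hz
      exact hp (by rw [dist_zero_right]; exact hz.trans_lt hδ.2)
    filter_upwards [hball hpow, hball hgh] with δ h1 h2 x hx z hz hzx
    have h3 : h z ^ m = x := by rw [h1 z hz]; exact hzx
    set y := x ^ ((m : ℂ)⁻¹) with hy
    have hym : y ^ m = x := Complex.cpow_nat_inv_pow x hm
    have hy0 : y ≠ 0 := by
      intro h0
      rw [h0, zero_pow hm] at hym
      exact hx hym.symm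
    -- In the local coordinate a zero is an m-th root of x, so it differs from the principal root by
    -- a root of unity. The radius δ does not depend on x, which the later residue count on a fixed
    -- circle requires.
    obtain ⟨i, hi, hζi⟩ := hζ.eq_pow_of_pow_eq_one (ξ := h z / y)
      (by rw [div_pow, h3, hym, div_self hx])
    refine ⟨⟨i, hi⟩, ?_⟩
    simp only [w]
    rw [hζi, ← hy, div_mul_cancel₀ _ hy0, h2 z hz]

theorem exists_branches_of_le {k j : ℕ} (hj : j ≤ k) : ∃ t : Fin (k - j) → ℂ → ℂ,
    (∀ i, IsSmallZero k j (t i)) ∧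
    (∀ᶠ x in 𝓝[≠] (0 : ℂ), Function.Injective fun i => t i x) ∧
    ∀ᶠ δ in 𝓝[>] (0 : ℝ), ∀ᶠ x in 𝓝[≠] (0 : ℂ), ∀ z, ‖z‖ ≤ δ → branchFun k j z = x →
      ∃ i, z = t i x := by
  rcases hj.lt_or_eq with hj | rfl
  · obtain ⟨t, h1, h2, h3⟩ := exists_branches hj
    refine ⟨t, h1, h2, h3.mono fun δ hδ => ?_⟩
    filter_upwards [self_mem_nhdsWithin] with x hx
    exact hδ x hx
  -- For j = k the equation is (1−t)^k = x, which has no solution near 0 when x is small, so the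
  -- empty list is complete.
  · have hemp : IsEmpty (Fin (j - j)) := by rw [Nat.sub_self]; infer_instance
    refine ⟨fun _ _ => 0, fun i => hemp.elim i, Eventually.of_forall fun _ i => hemp.elim i, ?_⟩
    filter_upwards [Ioo_mem_nhdsGT (show (0 : ℝ) < 1 / 2 by norm_num)] with δ hδ
    have hx : ∀ᶠ x in 𝓝[≠] (0 : ℂ), ‖x‖ < (1 / 2) ^ j := by
      refine nhdsWithin_le_nhds ?_
      have := Metric.ball_mem_nhds (0 : ℂ) (show (0 : ℝ) < (1 / 2) ^ j by positivity)
      filter_upwards [this] with x hx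
      simpa using hx
    filter_upwards [hx] with x hx z hz hzx
    exfalso
    rw [← hzx, branchFun, Nat.sub_self, pow_zero, one_mul, norm_pow] at hx
    have h1 : 1 / 2 ≤ ‖1 - z‖ := by
      have := norm_sub_norm_le (1 : ℂ) z
      rw [norm_one] at this
      linarith [hδ.2]
    exact absurd hx (pow_le_pow_left₀ (by norm_num) h1 j).not_gt

theorem eventually_norm_le_of_tendsto {s : ℂ → ℂ} (hs : Tendsto s (𝓝[≠] 0) (𝓝 0)) {δ : ℝ}
    (hδ : 0 < δ) : ∀ᶠ x in 𝓝[≠] (0 : ℂ), ‖s x‖ < δ := by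
  filter_upwards [hs (Metric.ball_mem_nhds 0 hδ)] with x hx
  simpa using hx

theorem exists_isSmallZeroList {k j : ℕ} (hj : j ≤ k) :
    ∃ t : Fin (k - j) → ℂ → ℂ, IsSmallZeroList k j t := by
  obtain ⟨t, h1, h2, h3⟩ := exists_branches_of_le hj
  refine ⟨t, h1, h2, fun s hs => ?_⟩
  obtain ⟨δ, h4, hδ⟩ := (h3.and self_mem_nhdsWithin).exists
  filter_upwards [h4, hs.1, eventually_norm_le_of_tendsto hs.2 hδ] with x hx1 hx2 hx3
  exact hx1 _ hx3.le (isRoot_Qpoly_iff.1 hx2)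

/-- All zeros in a fixed small disc are listed by the small zeros. -/
theorem IsSmallZeroList.eventually_exists_eq {k j : ℕ} (hj : j ≤ k) {t : Fin (k - j) → ℂ → ℂ}
    (ht : IsSmallZeroList k j t) :
    ∀ᶠ δ in 𝓝[>] (0 : ℝ), ∀ᶠ x in 𝓝[≠] (0 : ℂ), ∀ z, ‖z‖ ≤ δ → branchFun k j z = x →
      ∃ i, z = t i x := by
  obtain ⟨u, h1, -, h3⟩ := exists_branches_of_le hj
  refine h3.mono fun δ hδ => ?_
  filter_upwards [hδ, eventually_all.2 fun i => ht.complete (u i) (h1 i)] with x hx1 hx2 z hz hzx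
  obtain ⟨i, rfl⟩ := hx1 z hz hzx
  exact hx2 i

/-! ### Summation over r and residues at the small zeros -/

/-- Dividing the identity that the Lagrange basis sums to 1 by the nodal polynomial is the partial
fraction expansion of its reciprocal; Cauchy's formula then applies to each term. -/
theorem contour_div_nodal {ι : Type*} [Fintype ι] [DecidableEq ι] {ε : ℝ} (hε : 0 < ε)
    {a : ι → ℂ} (ha : Function.Injective a) (haε : ∀ i, ‖a i‖ < ε) {H : ℂ → ℂ}
    (hH : ∀ z, ‖z‖ ≤ ε → DifferentiableAt ℂ H z) :
    contour ε (fun z => H z / (Lagrange.nodal Finset.univ a).eval z) =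
      ∑ i, Lagrange.nodalWeight Finset.univ a i * H (a i) := by
  rcases isEmpty_or_nonempty ι with hι | hι
  · simp only [Finset.univ_eq_empty, Lagrange.nodal_empty, Polynomial.eval_one, div_one,
      Finset.sum_empty]
    exact contour_eq_zero hε.le hH
  have hne : ∀ z, ‖z‖ = ε → ∀ i, z ≠ a i := by
    rintro z hz i rfl
    exact (haε i).ne hz
  have key : ∀ z, ‖z‖ = ε → H z / (Lagrange.nodal Finset.univ a).eval z =
      ∑ i, Lagrange.nodalWeight Finset.univ a i * ((z - a i)⁻¹ * H z) := by
    intro z hz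
    have h1 := congrArg (Polynomial.eval z)
      (Lagrange.sum_basis (s := Finset.univ) (v := a) ha.injOn Finset.univ_nonempty)
    rw [Polynomial.eval_finsetSum, Polynomial.eval_one, Finset.sum_congr rfl fun i hi =>
      Lagrange.eval_basis_not_at_node hi (hne z hz i), ← Finset.mul_sum] at h1
    have h2 : (Lagrange.nodal Finset.univ a).eval z ≠ 0 := left_ne_zero_of_mul_eq_one h1
    rw [div_eq_mul_inv, ← eq_inv_of_mul_eq_one_right h1, Finset.mul_sum]
    exact Finset.sum_congr rfl fun i _ => by ring
  have hint : ∀ i, CircleIntegrable (fun z => (z - a i)⁻¹ * H z) 0 ε := fun i =>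
    circleIntegrable_of_differentiableAt hε.le fun z hz => by
      have h1 : z - a i ≠ 0 := sub_ne_zero.2 (hne z hz i)
      have h2 := hH z hz.le
      fun_prop (disch := assumption)
  have hint' : ∀ i ∈ Finset.univ, CircleIntegrable
      (fun z => Lagrange.nodalWeight Finset.univ a i * ((z - a i)⁻¹ * H z)) 0 ε := fun i _ =>
    (hint i).const_smul (a := Lagrange.nodalWeight Finset.univ a i)
  rw [contour_congr hε.le key, contour_sum hint']
  refine Finset.sum_congr rfl fun i _ => ?_
  rw [contour_const_mul]
  congr 1
  exact Complex.two_pi_I_inv_smul_circleIntegral_sub_inv_smul_of_differentiable_on_off_countable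
    (f := H) Set.countable_empty (by simpa using haε i)
    (fun z hz => (hH z (by simpa using hz)).continuousAt.continuousWithinAt)
    (fun z hz => hH z (by have := hz.1; simp at this; exact this.le))

theorem hasSum_contour {ε : ℝ} (hε : 0 < ε) {F : ℕ → ℂ → ℂ} {f : ℂ → ℂ} {b : ℕ → ℝ}
    (hF : ∀ n z, ‖z‖ = ε → ContinuousAt (F n) z) (hb : ∀ n z, ‖z‖ = ε → ‖F n z‖ ≤ b n)
    (hsum : Summable b) (h : ∀ z, ‖z‖ = ε → HasSum (fun n => F n z) (f z)) :
    HasSum (fun n => contour ε (F n)) (contour ε f) := by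
  refine HasSum.mul_left _ ?_
  have hmem : ∀ θ, ‖circleMap 0 ε θ‖ = ε := fun θ => by
    rw [norm_circleMap_zero, abs_of_pos hε]
  refine intervalIntegral.hasSum_integral_of_dominated_convergence (fun n _ => ε * b n)
    (fun n => ?_) (fun n => Eventually.of_forall fun θ _ => ?_)
    (Eventually.of_forall fun θ _ => hsum.mul_left ε) ?_
    (Eventually.of_forall fun θ _ => (h _ (hmem θ)).const_smul _)
  · refine Continuous.aestronglyMeasurable ?_
    have h1 : Continuous fun θ => F n (circleMap 0 ε θ) := continuous_iff_continuousAt.2 fun θ =>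
      ContinuousAt.comp (hF n _ (hmem θ)) (continuous_circleMap 0 ε).continuousAt
    have h2 : Continuous (deriv (circleMap 0 ε)) := by
      have : deriv (circleMap 0 ε) = fun θ => circleMap 0 ε θ * Complex.I := by
        ext θ; exact deriv_circleMap 0 ε θ
      rw [this]
      exact (continuous_circleMap 0 ε).mul continuous_const
    exact h2.smul h1
  · rw [norm_smul, deriv_circleMap, norm_mul, Complex.norm_I, mul_one, hmem]
    exact mul_le_mul_of_nonneg_left (hb n _ (hmem θ)) hε.le
  · exact intervalIntegrable_const

theorem differentiableAt_density {k j : ℕ} {z : ℂ} (hz : ‖z‖ < 1 / 2) :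
    DifferentiableAt ℂ (density k j) z := by
  have h2 : (1 - 2 * z) ^ (k - 2) ≠ 0 := pow_ne_zero _ (one_sub_two_mul_ne_zero_of_norm hz)
  unfold density
  fun_prop (disch := assumption)

/-- On the circle the modulus of `branchFun` is at least c, because |1 − z| ≥ 1/2. For |x| < c the
geometric series therefore converges uniformly and may be integrated term by term. -/
theorem hasSum_contour_branchFun {ε : ℝ} (hε : 0 < ε) (hε2 : ε < 1 / 2) (k j : ℕ) :
    ∀ᶠ x in 𝓝[≠] (0 : ℂ), HasSum
      (fun r : ℕ => contour ε (fun z => density k j z * (branchFun k j z)⁻¹ ^ (r + 1)) *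
        x ^ (r + 1)) (contour ε fun z => density k j z * (x / (branchFun k j z - x))) := by
  obtain ⟨C, hC⟩ := (isCompact_sphere (0 : ℂ) ε).exists_bound_of_continuousOn (f := density k j)
    fun z hz => (differentiableAt_density
      (by rw [mem_sphere_zero_iff_norm.1 hz]; exact hε2)).continuousAt.continuousWithinAt
  simp only [mem_sphere_zero_iff_norm] at hC
  set c : ℝ := ε ^ (k - j) * (1 / 2) ^ j with hc
  have hc0 : 0 < c := by positivity
  have hq : ∀ z : ℂ, ‖z‖ = ε → c ≤ ‖branchFun k j z‖ := fun z hz => by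
    have h1 : 1 / 2 ≤ ‖1 - z‖ := by
      have := norm_sub_norm_le (1 : ℂ) z
      rw [norm_one] at this
      linarith
    rw [branchFun, norm_mul, norm_pow, norm_pow, hz, hc]
    gcongr
  have hx : ∀ᶠ x in 𝓝[≠] (0 : ℂ), ‖x‖ < c := by
    refine nhdsWithin_le_nhds ?_
    filter_upwards [Metric.ball_mem_nhds (0 : ℂ) hc0] with x hx
    simpa using hx
  filter_upwards [hx] with x hx
  have hcont : ∀ r z, ‖z‖ = ε → ContinuousAt (fun z => x ^ (r + 1) *
      (density k j z * (branchFun k j z)⁻¹ ^ (r + 1))) z := fun r z hz => by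
    have h0 : branchFun k j z ≠ 0 := norm_pos_iff.1 (hc0.trans_le (hq z hz))
    have h1 := (differentiableAt_density (k := k) (j := j) (hz.trans_lt hε2)).continuousAt
    have h2 : ContinuousAt (branchFun k j) z := by unfold branchFun; fun_prop
    exact continuousAt_const.mul (h1.mul ((h2.inv₀ h0).pow _))
  have h := hasSum_contour hε (b := fun n => C * (‖x‖ / c) ^ (n + 1)) (f := fun z =>
    density k j z * (x / (branchFun k j z - x))) hcont ?_ ?_ ?_
  · refine h.congr_fun ?_
    intro r
    rw [contour_const_mul, mul_comm]
  · intro n z hz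
    have h0 : 0 < ‖branchFun k j z‖ := hc0.trans_le (hq z hz)
    have h1 : ‖x ^ (n + 1) * (density k j z * (branchFun k j z)⁻¹ ^ (n + 1))‖ =
        ‖density k j z‖ * (‖x‖ / ‖branchFun k j z‖) ^ (n + 1) := by
      rw [norm_mul, norm_mul, norm_pow, norm_pow, norm_inv, div_pow, inv_pow]; ring
    rw [h1]
    have h2 := hC z hz
    have h3 := hq z hz
    have : 0 ≤ C := (norm_nonneg _).trans h2
    gcongr
  · have h1 : ‖x‖ / c < 1 := (div_lt_one hc0).2 hx
    exact ((summable_geometric_of_lt_one (by positivity) h1).mul_left (C * (‖x‖ / c))).congr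
      fun n => by ring
  · intro z hz
    have h0 : branchFun k j z ≠ 0 := norm_pos_iff.1 (hc0.trans_le (hq z hz))
    have h1 : ‖x / branchFun k j z‖ < 1 := by
      rw [norm_div, div_lt_one (hc0.trans_le (hq z hz))]
      exact hx.trans_le (hq z hz)
    have h2 : branchFun k j z - x ≠ 0 := by
      intro h2
      rw [sub_eq_zero.1 h2] at h0 h1
      rw [div_self h0, norm_one] at h1
      exact lt_irrefl _ h1
    have h3 := (hasSum_geometric_of_norm_lt_one h1).mul_left
      (density k j z * (x / branchFun k j z))
    have h4 : density k j z * (x / branchFun k j z) * (1 - x / branchFun k j z)⁻¹ =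
        density k j z * (x / (branchFun k j z - x)) := by
      have : 1 - x / branchFun k j z = (branchFun k j z - x) / branchFun k j z := by field_simp
      rw [this, inv_div]
      field_simp
    rw [h4] at h3
    refine h3.congr_fun fun n => ?_
    rw [div_pow, div_eq_mul_inv, inv_pow]
    field_simp
    ring

theorem eval_derivative_Qpoly {k j : ℕ} (hj : j ≤ k) (x t : ℂ) :
    (Qpoly k j x).derivative.eval t * (t * (1 - t)) =
      branchFun k j t * ((k : ℂ) - j - k * t) := by
  obtain ⟨m, rfl⟩ := Nat.exists_eq_add_of_le hj
  rw [Qpoly, branchFun, Nat.add_sub_cancel_left]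
  simp only [Polynomial.derivative_sub, Polynomial.derivative_mul,
    Polynomial.derivative_pow, Polynomial.derivative_one, Polynomial.derivative_X,
    Polynomial.derivative_C, Polynomial.eval_sub, Polynomial.eval_add, Polynomial.eval_mul,
    Polynomial.eval_pow, Polynomial.eval_X, Polynomial.eval_one, Polynomial.eval_C,
    Polynomial.eval_zero]
  rcases m with _ | m <;> rcases j with _ | j <;> push_cast <;> ring

/-- Residues of density · x/Q. At a small zero t, `eval_derivative_Qpoly` gives t(1−t)Q′(t) =
x(k−j−kt), so x cancels and the numerator gains the factor t(1−t). -/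
theorem IsSmallZeroList.contour_eq {k j : ℕ} (hj : j ≤ k) {t : Fin (k - j) → ℂ → ℂ}
    (ht : IsSmallZeroList k j t) : ∀ᶠ ε in 𝓝[>] (0 : ℝ), ∀ᶠ x in 𝓝[≠] (0 : ℂ),
      contour ε (fun z => density k j z * (x / (branchFun k j z - x))) =
        ∑ i : Fin (k - j), t i x ^ (j + 1) * (1 - t i x) ^ (k - j + 1) /
          ((1 - 2 * t i x) ^ (k - 2) * ((k : ℂ) - j - k * t i x)) := by
  -- For |t| < 1/(k+1) the modulus of kt is below 1 ≤ k − j, so k − j − kt cannot vanish at a listed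
  -- zero.
  have hk1 : (0 : ℝ) < 1 / (k + 1) := by positivity
  filter_upwards [ht.eventually_exists_eq hj,
    Ioo_mem_nhdsGT (lt_min (show (0 : ℝ) < 1 / 2 by norm_num) hk1)] with ε hcomp hε
  obtain ⟨hε0, hε1⟩ := hε
  obtain ⟨hε2, hε3⟩ := lt_min_iff.1 hε1
  filter_upwards [hcomp, ht.injective, eventually_all.2 fun i => (ht.isSmallZero i).1,
    eventually_all.2 fun i => eventually_norm_le_of_tendsto (ht.isSmallZero i).2 hε0,
    self_mem_nhdsWithin] with x hall hinj hroot hnorm hx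
  have hx0 : x ≠ 0 := hx
  set a : Fin (k - j) → ℂ := fun i => t i x with ha
  have ha0 : ∀ i, a i ≠ 0 := by
    intro i h0
    have h1 := isRoot_Qpoly_iff.1 (hroot i)
    change branchFun k j (a i) = x at h1
    have := i.2
    rw [branchFun, h0, zero_pow (by omega), zero_mul] at h1
    exact hx0 h1.symm
  have hb1 : ∀ i, 1 - a i ≠ 0 := fun i => one_sub_ne_zero_of_norm ((hnorm i).trans hε2)
  have hlin : ∀ i, (k : ℂ) - j - k * a i ≠ 0 := by
    intro i h0
    have h1 : ((k - j : ℕ) : ℂ) = k * a i := by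
      rw [Nat.cast_sub hj]; exact sub_eq_zero.1 h0
    have h2 : ((k - j : ℕ) : ℝ) = k * ‖a i‖ := by
      have := congrArg norm h1
      rwa [norm_mul, Complex.norm_natCast, Complex.norm_natCast] at this
    have h3 : (1 : ℝ) ≤ ((k - j : ℕ) : ℝ) := by
      have := i.2
      exact_mod_cast (by omega : 1 ≤ k - j)
    have h4 : (k : ℝ) * ‖a i‖ ≤ k * (1 / (k + 1)) :=
      mul_le_mul_of_nonneg_left ((hnorm i).le.trans hε3.le) (Nat.cast_nonneg k)
    have h5 : (k : ℝ) * (1 / (k + 1)) < 1 := by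
      rw [mul_one_div, div_lt_one (by positivity)]; linarith
    linarith
  have hdvd : Lagrange.nodal Finset.univ a ∣ Qpoly k j x := by
    rw [Lagrange.nodal_eq]
    exact Fintype.prod_dvd_of_coprime (Polynomial.pairwise_coprime_X_sub_C hinj)
      fun i => Polynomial.dvd_iff_isRoot.2 (hroot i)
  obtain ⟨R, hR⟩ := hdvd
  have hder : ∀ i, (Qpoly k j x).derivative.eval (a i) =
      (Lagrange.nodal Finset.univ a).derivative.eval (a i) * R.eval (a i) := by
    intro i
    rw [hR, Polynomial.derivative_mul, Polynomial.eval_add, Polynomial.eval_mul,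
      Polynomial.eval_mul, Lagrange.eval_nodal_at_node (Finset.mem_univ i), zero_mul, add_zero]
  have hder2 : ∀ i, (Qpoly k j x).derivative.eval (a i) * (a i * (1 - a i)) =
      x * ((k : ℂ) - j - k * a i) := by
    intro i
    rw [eval_derivative_Qpoly hj, isRoot_Qpoly_iff.1 (hroot i)]
  have hder0 : ∀ i, (Qpoly k j x).derivative.eval (a i) ≠ 0 := fun i h0 =>
    mul_ne_zero hx0 (hlin i) (by rw [← hder2 i, h0, zero_mul])
  -- A zero of the cofactor in the disc is a zero of Q, hence a listed one, hence a double zero; but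
  -- the derivative of Q does not vanish there.
  have hR0 : ∀ z, ‖z‖ ≤ ε → R.eval z ≠ 0 := by
    intro z hz h0
    have h1 : branchFun k j z = x := isRoot_Qpoly_iff.1 (by
      rw [Polynomial.IsRoot, hR, Polynomial.eval_mul, h0, mul_zero])
    obtain ⟨i, rfl⟩ := hall z hz h1
    refine hder0 i ?_
    rw [hder i]
    exact mul_eq_zero_of_right _ h0
  have hcongr : ∀ z, ‖z‖ = ε → density k j z * (x / (branchFun k j z - x)) =
      density k j z * x / R.eval z / (Lagrange.nodal Finset.univ a).eval z := by
    intro z hz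
    rw [← Qpoly_eval, hR, Polynomial.eval_mul, div_div, mul_comm (R.eval z), mul_div_assoc]
  rw [contour_congr hε0.le hcongr, contour_div_nodal hε0 hinj hnorm]
  · refine Finset.sum_congr rfl fun i _ => ?_
    have h1 := hder2 i
    have h2 := hder0 i
    rw [hder i] at h1 h2
    have h3 := hb1 i
    have h4 := hlin i
    have h5 := one_sub_two_mul_ne_zero_of_norm ((hnorm i).trans hε2)
    have h6 := ha0 i
    rw [Lagrange.nodalWeight_eq_eval_derivative_nodal (Finset.mem_univ i), density]
    change _ = a i ^ (j + 1) * (1 - a i) ^ (k - j + 1) /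
      ((1 - 2 * a i) ^ (k - 2) * ((k : ℂ) - j - k * a i))
    have h5' : 1 - 2 * a i ≠ 0 := h5
    have h7 : (Lagrange.nodal Finset.univ a).derivative.eval (a i) ≠ 0 := left_ne_zero_of_mul h2
    have h8 : R.eval (a i) ≠ 0 := right_ne_zero_of_mul h2
    have h9 : x = (Lagrange.nodal Finset.univ a).derivative.eval (a i) * R.eval (a i) *
        (a i * (1 - a i)) / ((k : ℂ) - j - k * a i) := by
      rw [h1, mul_div_cancel_right₀ _ h4]
    generalize (Lagrange.nodal Finset.univ a).derivative.eval (a i) = N at *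
    generalize R.eval (a i) = S at *
    generalize (k : ℂ) - j - k * a i = T at *
    generalize a i = b at *
    rw [h9]
    field_simp
    ring
  · intro z hz
    have h1 := hR0 z hz
    have h2 := differentiableAt_density (k := k) (j := j) (hz.trans_lt hε2)
    exact (h2.mul_const x).div R.differentiableAt h1

/-- The closed form of the generating function at `x`, in terms of the small zeros. -/
noncomputable def closedForm (k : ℕ) (t : (j : ℕ) → Fin (k - j) → ℂ → ℂ) (x : ℂ) : ℂ :=
  -(1 / 2) * ∑ j ∈ Finset.range (k + 1), (-1) ^ j * (k.choose j : ℂ) *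
    ∑ i : Fin (k - j), t j i x ^ (j + 1) * (1 - t j i x) ^ (k - j + 1) /
      ((1 - 2 * t j i x) ^ (k - 2) * ((k : ℂ) - j - k * t j i x))

theorem hasSum_closedForm {k : ℕ} (hk : 2 ≤ k) {t : (j : ℕ) → Fin (k - j) → ℂ → ℂ}
    (ht : ∀ j ≤ k, IsSmallZeroList k j (t j)) : ∀ᶠ x in 𝓝[≠] (0 : ℂ),
      HasSum (fun r : ℕ => (tr k (r + 1) : ℂ) * x ^ (r + 1)) (closedForm k t x) := by
  have h1 : ∀ᶠ ε in 𝓝[>] (0 : ℝ), ∀ j ∈ Finset.range (k + 1), ∀ᶠ x in 𝓝[≠] (0 : ℂ),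
      contour ε (fun z => density k j z * (x / (branchFun k j z - x))) =
        ∑ i : Fin (k - j), t j i x ^ (j + 1) * (1 - t j i x) ^ (k - j + 1) /
          ((1 - 2 * t j i x) ^ (k - 2) * ((k : ℂ) - j - k * t j i x)) := by
    rw [Finset.eventually_all]
    intro j hj
    have hj' : j ≤ k := by rw [Finset.mem_range] at hj; omega
    exact (ht j hj').contour_eq hj'
  -- One radius has to serve all j at once, since `tr_eq_sum_contour` uses the same circle for every
  -- term.
  obtain ⟨ε, h2, hε⟩ :=
    (h1.and (Ioo_mem_nhdsGT (show (0 : ℝ) < 1 / 2 by norm_num))).exists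
  have h3 : ∀ᶠ x in 𝓝[≠] (0 : ℂ), ∀ j ∈ Finset.range (k + 1),
      HasSum (fun r : ℕ => contour ε (fun z => density k j z * (branchFun k j z)⁻¹ ^ (r + 1)) *
        x ^ (r + 1)) (contour ε fun z => density k j z * (x / (branchFun k j z - x))) := by
    rw [Finset.eventually_all]
    exact fun j _ => hasSum_contour_branchFun hε.1 hε.2 k j
  have h4 : ∀ᶠ x in 𝓝[≠] (0 : ℂ), ∀ j ∈ Finset.range (k + 1),
      contour ε (fun z => density k j z * (x / (branchFun k j z - x))) =
        ∑ i : Fin (k - j), t j i x ^ (j + 1) * (1 - t j i x) ^ (k - j + 1) /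
          ((1 - 2 * t j i x) ^ (k - 2) * ((k : ℂ) - j - k * t j i x)) := by
    rw [Finset.eventually_all]
    exact h2
  filter_upwards [h3, h4] with x hx3 hx4
  have h5 := (hasSum_sum fun j hj =>
    (hx3 j hj).mul_left ((-1) ^ j * (k.choose j : ℂ))).mul_left (-(1 / 2) : ℂ)
  rw [Finset.sum_congr rfl fun j hj => by rw [hx4 j hj]] at h5
  refine h5.congr_fun fun r => ?_
  rw [tr_eq_sum_contour hε.1 hε.2 hk r.succ_pos, mul_assoc, Finset.sum_mul]
  congr 1
  exact Finset.sum_congr rfl fun j _ => by ring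

/-! ### Algebraicity of the generating function -/

/-- The power series `F` converges at `x` with sum `y`. -/
def HasEval (F : PowerSeries ℚ) (x y : ℂ) : Prop :=
  HasSum (fun n => ((PowerSeries.coeff n F : ℚ) : ℂ) * x ^ n) y

theorem HasEval.add {F G : PowerSeries ℚ} {x y z : ℂ} (hF : HasEval F x y) (hG : HasEval G x z) :
    HasEval (F + G) x (y + z) := by
  refine (HasSum.add hF hG).congr_fun fun n => ?_
  rw [map_add]; push_cast; ring

/-- Convergence in ℂ as an unordered sum is absolute, so the Cauchy product applies. -/
theorem HasEval.mul {F G : PowerSeries ℚ} {x y z : ℂ} (hF : HasEval F x y) (hG : HasEval G x z) :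
    HasEval (F * G) x (y * z) := by
  have h1 := hF.summable.norm
  have h2 := hG.summable.norm
  have h3 := (summable_norm_sum_mul_antidiagonal_of_summable_norm h1 h2).of_norm.hasSum
  rw [← tsum_mul_tsum_eq_tsum_sum_antidiagonal_of_summable_norm h1 h2, hF.tsum_eq, hG.tsum_eq] at h3
  refine h3.congr_fun fun n => ?_
  rw [PowerSeries.coeff_mul, Rat.cast_sum, Finset.sum_mul]
  refine Finset.sum_congr rfl fun p hp => ?_
  rw [Finset.HasAntidiagonal.mem_antidiagonal] at hp
  rw [← hp, pow_add]; push_cast; ring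

theorem hasEval_coe (p : Polynomial ℚ) (x : ℂ) :
    HasEval (p : PowerSeries ℚ) x (Polynomial.aeval x p) := by
  rw [Polynomial.aeval_eq_sum_range]
  have h : HasSum (fun n => ((p.coeff n : ℚ) : ℂ) * x ^ n)
      (∑ n ∈ Finset.range (p.natDegree + 1), ((p.coeff n : ℚ) : ℂ) * x ^ n) := by
    refine hasSum_sum_of_ne_finset_zero fun n hn => ?_
    rw [Finset.mem_range, not_lt] at hn
    rw [Polynomial.coeff_eq_zero_of_natDegree_lt (by omega)]; simp
  unfold HasEval
  simp only [Polynomial.coeff_coe]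
  convert h using 2 with n hn
  rw [Rat.smul_def]

theorem HasEval.pow {F : PowerSeries ℚ} {x y : ℂ} (hF : HasEval F x y) (n : ℕ) :
    HasEval (F ^ n) x (y ^ n) := by
  induction n with
  | zero => simpa using hasEval_coe 1 x
  | succ n ih => rw [pow_succ, pow_succ]; exact ih.mul hF

theorem HasEval.aeval {F : PowerSeries ℚ} {x y : ℂ} (hF : HasEval F x y)
    (P : Polynomial (Polynomial ℚ)) : HasEval (Polynomial.aeval F P) x
      (P.eval₂ (Polynomial.aeval x : Polynomial ℚ →ₐ[ℚ] ℂ).toRingHom y) := by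
  induction P using Polynomial.induction_on' with
  | add P Q hP hQ =>
    rw [map_add, Polynomial.eval₂_add]
    exact hP.add hQ
  | monomial n p =>
    rw [Polynomial.aeval_monomial, Polynomial.eval₂_monomial]
    refine HasEval.mul ?_ (hF.pow n)
    rw [PowerSeries.algebraMap_apply']
    simpa using hasEval_coe p x

/-- Uniqueness of power series coefficients. The value at 0 is not part of the hypothesis, so f
starts with the constant coefficient there, and continuity shows that it is 0. -/
theorem eq_zero_of_hasEval {F : PowerSeries ℚ} (h : ∀ᶠ x in 𝓝[≠] (0 : ℂ), HasEval F x 0) :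
    F = 0 := by
  let c : ℕ → ℂ := fun n => ((PowerSeries.coeff n F : ℚ) : ℂ)
  let f : ℂ → ℂ := fun x => if x = 0 then c 0 else 0
  have hf : HasFPowerSeriesAt f (FormalMultilinearSeries.ofScalars ℂ c) 0 := by
    rw [hasFPowerSeriesAt_iff]
    filter_upwards [eventually_nhdsWithin_iff.1 h] with x hx
    rw [zero_add]
    simp only [FormalMultilinearSeries.coeff_ofScalars, smul_eq_mul]
    by_cases hx0 : x = 0
    · subst hx0
      simp only [f, if_true]
      have h0 := hasSum_single (0 : ℕ) (f := fun n => (0 : ℂ) ^ n * c n)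
        fun n hn => by rw [zero_pow hn, zero_mul]
      rwa [pow_zero, one_mul] at h0
    · simp only [f, if_neg hx0]
      exact (hx hx0).congr_fun fun n => mul_comm _ _
  have hf0 : f =ᶠ[𝓝[≠] 0] 0 := by
    filter_upwards [self_mem_nhdsWithin] with x hx
    exact if_neg hx
  have hcont : f 0 = 0 := tendsto_nhds_unique
    (hf.continuousAt.tendsto.mono_left (nhdsWithin_le_nhds (s := {0}ᶜ)))
    (tendsto_const_nhds.congr' hf0.symm)
  have hfz : f = 0 := by
    ext x
    by_cases hx : x = 0
    · rw [hx, hcont]; rfl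
    · exact if_neg hx
  rw [hfz] at hf
  have h0 := hf.eq_zero
  ext n
  have h1 : (FormalMultilinearSeries.ofScalars ℂ c).coeff n = 0 := by rw [h0]; rfl
  rw [FormalMultilinearSeries.coeff_ofScalars] at h1
  rw [map_zero]
  exact Rat.cast_eq_zero.1 h1

/-- Rational polynomials as germs of functions on punctured neighbourhoods of `0`. -/
noncomputable def polyGerm : Polynomial ℚ →+* Germ (𝓝[≠] (0 : ℂ)) ℂ :=
  (Germ.coeRingHom (𝓝[≠] (0 : ℂ))).comp
    (RingHom.pi fun x : ℂ => (Polynomial.aeval x : Polynomial ℚ →ₐ[ℚ] ℂ).toRingHom)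

theorem eval₂_polyGerm (P : Polynomial (Polynomial ℚ)) (f : ℂ → ℂ) :
    P.eval₂ polyGerm (f : Germ (𝓝[≠] (0 : ℂ)) ℂ) =
      ((fun x => P.eval₂ (Polynomial.aeval x : Polynomial ℚ →ₐ[ℚ] ℂ).toRingHom (f x) : ℂ → ℂ) :
        Germ (𝓝[≠] (0 : ℂ)) ℂ) := by
  have h := Polynomial.hom_eval₂ P
    (RingHom.pi fun x : ℂ => (Polynomial.aeval x : Polynomial ℚ →ₐ[ℚ] ℂ).toRingHom)
    (Germ.coeRingHom (𝓝[≠] (0 : ℂ))) f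
  change _ = P.eval₂ polyGerm (f : Germ (𝓝[≠] (0 : ℂ)) ℂ) at h
  rw [← h]
  change ((_ : ℂ → ℂ) : Germ (𝓝[≠] (0 : ℂ)) ℂ) = _
  congr 1
  funext x
  exact Polynomial.hom_eval₂ P
    (RingHom.pi fun x : ℂ => (Polynomial.aeval x : Polynomial ℚ →ₐ[ℚ] ℂ).toRingHom)
    (Pi.evalRingHom (fun _ : ℂ => ℂ) x) f

/-- The function `f` satisfies a polynomial equation over `ℚ[x]` on a punctured neighbourhood
of `0`. -/
def IsAlgebraicFun (f : ℂ → ℂ) : Prop := ∃ P : Polynomial (Polynomial ℚ), P ≠ 0 ∧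
  ∀ᶠ x in 𝓝[≠] (0 : ℂ), P.eval₂ (Polynomial.aeval x : Polynomial ℚ →ₐ[ℚ] ℂ).toRingHom (f x) = 0

/-- Passing to germs turns an equation valid near 0 into algebraicity in a ℚ[x]-algebra, so that
closure under sums, products and powers can be quoted. -/
theorem isAlgebraicFun_iff (f : ℂ → ℂ) : IsAlgebraicFun f ↔
    let := polyGerm.toAlgebra
    IsAlgebraic (Polynomial ℚ) (f : Germ (𝓝[≠] (0 : ℂ)) ℂ) := by
  let := polyGerm.toAlgebra
  refine exists_congr fun P => and_congr_right fun _ => ?_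
  rw [Polynomial.aeval_def]
  change _ ↔ P.eval₂ polyGerm (f : Germ (𝓝[≠] (0 : ℂ)) ℂ) = 0
  rw [eval₂_polyGerm]
  exact Germ.coe_eq.symm

theorem IsAlgebraicFun.add {f g : ℂ → ℂ} (hf : IsAlgebraicFun f) (hg : IsAlgebraicFun g) :
    IsAlgebraicFun (fun x => f x + g x) := by
  let := polyGerm.toAlgebra
  rw [isAlgebraicFun_iff] at *
  exact IsAlgebraic.add hf hg

theorem IsAlgebraicFun.mul {f g : ℂ → ℂ} (hf : IsAlgebraicFun f) (hg : IsAlgebraicFun g) :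
    IsAlgebraicFun (fun x => f x * g x) := by
  let := polyGerm.toAlgebra
  rw [isAlgebraicFun_iff] at *
  exact IsAlgebraic.mul hf hg

theorem IsAlgebraicFun.pow {f : ℂ → ℂ} (hf : IsAlgebraicFun f) (n : ℕ) :
    IsAlgebraicFun (fun x => f x ^ n) := by
  let := polyGerm.toAlgebra
  rw [isAlgebraicFun_iff] at *
  exact IsAlgebraic.pow hf n

theorem isAlgebraicFun_const (q : ℚ) : IsAlgebraicFun (fun _ => (q : ℂ)) := by
  refine ⟨Polynomial.X - Polynomial.C (Polynomial.C q), Polynomial.X_sub_C_ne_zero _,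
    Eventually.of_forall fun x => ?_⟩
  simp

theorem IsAlgebraicFun.sub {f g : ℂ → ℂ} (hf : IsAlgebraicFun f) (hg : IsAlgebraicFun g) :
    IsAlgebraicFun (fun x => f x - g x) := by
  have := hf.add ((isAlgebraicFun_const (-1)).mul hg)
  push_cast at this
  simpa [sub_eq_add_neg] using this

/-- Germs of arbitrary functions do not form a field, so the inverse is taken of an element shown to
be invertible. -/
theorem IsAlgebraicFun.inv {f : ℂ → ℂ} (hf : IsAlgebraicFun f)
    (h0 : ∀ᶠ x in 𝓝[≠] (0 : ℂ), f x ≠ 0) : IsAlgebraicFun (fun x => (f x)⁻¹) := by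
  let := polyGerm.toAlgebra
  rw [isAlgebraicFun_iff] at *
  have h1 : ((fun x => (f x)⁻¹ : ℂ → ℂ) : Germ (𝓝[≠] (0 : ℂ)) ℂ) * (f : Germ _ ℂ) = 1 := by
    refine Germ.coe_eq.2 ?_
    filter_upwards [h0] with x hx
    exact inv_mul_cancel₀ hx
  let : Invertible (f : Germ (𝓝[≠] (0 : ℂ)) ℂ) := ⟨_, h1, by rw [mul_comm]; exact h1⟩
  exact IsAlgebraic.invOf hf

theorem isAlgebraicFun_sum {ι : Type*} (s : Finset ι) {f : ι → ℂ → ℂ}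
    (hf : ∀ i ∈ s, IsAlgebraicFun (f i)) : IsAlgebraicFun (fun x => ∑ i ∈ s, f i x) := by
  classical
  induction s using Finset.induction_on with
  | empty => simpa using isAlgebraicFun_const 0
  | insert a s ha ih =>
    simp only [Finset.sum_insert ha]
    exact (hf a (Finset.mem_insert_self a s)).add
      (ih fun i hi => hf i (Finset.mem_insert_of_mem hi))

theorem IsSmallZero.isAlgebraicFun {k j : ℕ} (hj : j < k) {s : ℂ → ℂ} (hs : IsSmallZero k j s) :
    IsAlgebraicFun s := by
  refine ⟨Polynomial.X ^ (k - j) * (1 - Polynomial.X) ^ j - Polynomial.C Polynomial.X, ?_, ?_⟩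
  · intro h
    have := congrArg (Polynomial.eval 0) h
    simp [show k - j ≠ 0 by omega] at this
  · filter_upwards [hs.1] with x hx
    have := isRoot_Qpoly_iff.1 hx
    rw [branchFun] at this
    simp [Polynomial.eval₂_mul, Polynomial.eval₂_pow, Polynomial.eval₂_sub, this]

theorem isAlgebraicFun_closedForm {k : ℕ} {t : (j : ℕ) → Fin (k - j) → ℂ → ℂ}
    (ht : ∀ j ≤ k, IsSmallZeroList k j (t j)) : IsAlgebraicFun (closedForm k t) := by
  have hc : ∀ {c : ℂ} (q : ℚ), (q : ℂ) = c → IsAlgebraicFun (fun _ => c) := by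
    rintro c q rfl
    exact isAlgebraicFun_const q
  unfold closedForm
  refine (hc (-(1 / 2)) (by push_cast; ring)).mul (isAlgebraicFun_sum _ fun j hj => ?_)
  refine ((hc ((-1) ^ j * k.choose j) (by push_cast; ring))).mul (isAlgebraicFun_sum _ fun i _ => ?_)
  have hj' : j < k := by have := i.2; omega
  have hs := (ht j hj'.le).isSmallZero i
  have ha := hs.isAlgebraicFun hj'
  have h1 := hc (c := 1) 1 (by simp)
  have h2 := hc (c := 2) 2 (by simp)
  have hk := hc (c := k) k (by simp)
  have hkj := hc (c := (k : ℂ) - j) (k - j) (by simp)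
  simp only [div_eq_mul_inv]
  refine ((ha.pow _).mul ((h1.sub ha).pow _)).mul (IsAlgebraicFun.inv
    (((h1.sub (h2.mul ha)).pow _).mul (hkj.sub (hk.mul ha))) ?_)
  have hlim : Tendsto (fun x => (k : ℂ) - j - k * t j i x) (𝓝[≠] 0) (𝓝 ((k : ℂ) - j)) := by
    simpa using (hs.2.const_mul (k : ℂ)).const_sub ((k : ℂ) - j)
  have hne : (k : ℂ) - j ≠ 0 := by
    rw [sub_ne_zero]
    exact_mod_cast hj'.ne'
  filter_upwards [hlim.eventually_ne hne,
    eventually_norm_le_of_tendsto hs.2 (show (0 : ℝ) < 1 / 2 by norm_num)] with x hx1 hx2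
  exact mul_ne_zero (pow_ne_zero _ (one_sub_two_mul_ne_zero_of_norm hx2)) hx1

theorem hasEval_horizontalGF {k : ℕ} {x y : ℂ}
    (h : HasSum (fun r : ℕ => (tr k (r + 1) : ℂ) * x ^ (r + 1)) y) :
    HasEval (horizontalGF k) x y := by
  rw [HasEval, ← hasSum_nat_add_iff' 1]
  simp only [horizontalGF, PowerSeries.coeff_mk]
  simpa using h

theorem theorem3p2 (k : ℕ) (hk : 2 ≤ k) :
    (∀ j ≤ k, ∃ t : Fin (k - j) → ℂ → ℂ, IsSmallZeroList k j t) ∧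
    (∀ t : (j : ℕ) → Fin (k - j) → ℂ → ℂ, (∀ j ≤ k, IsSmallZeroList k j (t j)) →
      ∀ᶠ x in 𝓝[≠] (0 : ℂ),
        HasSum (fun r : ℕ => (tr k (r + 1) : ℂ) * x ^ (r + 1))
          (-(1 / 2) * ∑ j ∈ Finset.range (k + 1), (-1) ^ j * (k.choose j : ℂ) *
            ∑ i : Fin (k - j),
              t j i x ^ (j + 1) * (1 - t j i x) ^ (k - j + 1) /
                ((1 - 2 * t j i x) ^ (k - 2) * ((k : ℂ) - j - k * t j i x)))) ∧
    IsAlgebraic (Polynomial ℚ) (horizontalGF k) := by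
  refine ⟨fun j hj => exists_isSmallZeroList hj, fun t ht => hasSum_closedForm hk ht, ?_⟩
  -- A total family is needed for the choice; for j > k the value is a dummy.
  have hex : ∀ j, ∃ t : Fin (k - j) → ℂ → ℂ, j ≤ k → IsSmallZeroList k j t := fun j => by
    by_cases hj : j ≤ k
    · obtain ⟨t, ht⟩ := exists_isSmallZeroList hj
      exact ⟨t, fun _ => ht⟩
    · exact ⟨fun _ _ => 0, fun h => absurd h hj⟩
  choose t ht using hex
  obtain ⟨P, hP, hPx⟩ := isAlgebraicFun_closedForm ht
  -- The polynomial annihilating the closed form, evaluated at the formal series, converges to 0 at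
  -- all small x ≠ 0.
  refine ⟨P, hP, eq_zero_of_hasEval ?_⟩
  filter_upwards [hPx, hasSum_closedForm hk ht] with x hx1 hx2
  have := (hasEval_horizontalGF hx2).aeval P
  rwa [hx1] at this
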